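/- \textbf{Setting.} Let $\Gamma$ be the chain graph made of rings $R_j$, $j\in\mathbb Z$, of circumference $2\pi$, where $R_{j-1}$ and $R_j$ touch at the vertex $v_j$; each ring consists of an upper and a lower semicircle, both joining $v_j$ to $v_{j+1}$ and parametrized by $x\in[0,\pi]$ from $v_j$ to $v_{j+1}$. For real sequences $(\alpha_j)_{j\in\mathbb Z}$, $(A_j)_{j\in\mathbb Z}$ consider in $L^2(\Gamma)$ the operator acting on the $j$-th ring as $-\mathscr D^2$, where $\mathscr D=\frac{d}{dx}+iA_j$ on the upper and $\mathscr D=\frac{d}{dx}-iA_j$ on the lower semicircle. Its domain consists of all $f\in L^2(\Gamma)$ that are $H^2$ on every edge, satisfy $\mathscr D^2f\in L^2(\Gamma)$, and obey the $\delta$-coupling at every vertex $v_j$: $f$ is continuous at $v_j$, and the sum of the quasiderivatives $\mathscr Df$ at $v_j$ along the two semicircles of $R_j$ minus the sum of those along the two semicircles of $R_{j-1}$ equals $\alpha_j f(v_j)$. Let $-\Delta_{\alpha,A}$ be this operator for the constant sequences $\alpha,A\in\mathbb R$, where $A\notin\mathbb Z$ and $A-\frac12\notin\mathbb Z$. Given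 $n\in\mathbb N$ and real numbers $\alpha_1,\dots,\alpha_n$, $A_1,\dots,A_n$, let $-\Delta_\varepsilon$ be the operator with coupling constants $\alpha+\varepsilon\alpha_j$ and potentials $A+\varepsilon A_j$ for $1\le j\le n$, and with $\alpha$ and $A$ for all other $j$. \textbf{Theorem.} Suppose that $\sum_{j=1}^n\alpha_j=0$ and $\sum_{j=1}^nA_j\neq0$. Then there is $\varepsilon_0\in(0,1)$ such that for every $\varepsilon\in(0,\varepsilon_0)$ the following holds. \begin{itemize} \item If $\operatorname{sgn}\big(\sum_{j=1}^nA_j\big)\neq-\operatorname{sgn}(\cot A\pi)$, then $\sigma(-\Delta_\varepsilon)=\sigma(-\Delta_{\alpha,A})$. \item If $\operatorname{sgn}\big(\sum_{j=1}^nA_j\big)=-\operatorname{sgn}(\cot A\pi)$, then $\sigma_{\mathrm{ess}}(-\Delta_\varepsilon)=\sigma(-\Delta_{\alpha,A})$, and $-\Delta_\varepsilon$ has precisely one eigenvalue, which is simple, in every gap of its essential spectrum, i.e. in every connected component of $\mathbb R\setminus\sigma_{\mathrm{ess}}(-\Delta_\varepsilon)$, including the unbounded one. \end{itemize} -/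

import Mathlib

open scoped Real

namespace RingChain

open MeasureTheory Set

/-! ### Unbounded operators on a complex Hilbert space: spectrum, eigenvalues, gaps -/

section Operators

variable {H : Type*} [NormedAddCommGroup H] [InnerProductSpace ℂ H]

/-- The resolvent set of an unbounded operator `T`: those `z` for which `T - z`, as a map from the
domain of `T` to `H`, has a bounded everywhere defined two-sided inverse. -/
def resolventSet (T : H →ₗ.[ℂ] H) : Set ℂ :=
  {z | ∃ R : H →L[ℂ] H,
    (∀ y : H, ∃ h : R y ∈ T.domain, T ⟨R y, h⟩ - z • R y = y) ∧
    (∀ x : T.domain, R (T x - z • (x : H)) = x)}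

/-- The spectrum of an unbounded operator. -/
def spec (T : H →ₗ.[ℂ] H) : Set ℂ := (resolventSet T)ᶜ

/-- The eigenspace `ker (T - z)`, as a subspace of the domain of `T`. -/
def eigenspace (T : H →ₗ.[ℂ] H) (z : ℂ) : Submodule ℂ T.domain :=
  LinearMap.ker (T.toFun - z • T.domain.subtype)

/-- `z` is an eigenvalue of `T`. -/
def IsEigenvalue (T : H →ₗ.[ℂ] H) (z : ℂ) : Prop := eigenspace T z ≠ ⊥

/-- `z` is a simple eigenvalue of `T`: its eigenspace has dimension one (`T` is self-adjoint in the
applications, so geometric and algebraic multiplicities agree). -/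
def IsSimpleEigenvalue (T : H →ₗ.[ℂ] H) (z : ℂ) : Prop :=
  Module.finrank ℂ (eigenspace T z) = 1

/-- The discrete spectrum: isolated points of the spectrum that are eigenvalues of finite
multiplicity. -/
def discreteSpec (T : H →ₗ.[ℂ] H) : Set ℂ :=
  {z | z ∈ spec T ∧ (∃ r > 0, ∀ w ∈ spec T, dist w z < r → w = z) ∧
    IsEigenvalue T z ∧ Module.Finite ℂ (eigenspace T z)}

/-- The essential spectrum (of a self-adjoint operator): the complement of the discrete spectrum
in the spectrum. -/
def essSpec (T : H →ₗ.[ℂ] H) : Set ℂ := spec T \ discreteSpec T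

/-- `I` is a gap of `S ⊆ ℂ` on the real line: a connected component of `ℝ \ S`. Unbounded
components, such as the half-line below the bottom of `S`, are included. -/
def IsGap (S : Set ℂ) (I : Set ℝ) : Prop :=
  ∃ x : ℝ, (x : ℂ) ∉ S ∧ I = connectedComponentIn {E : ℝ | (E : ℂ) ∉ S} x

end Operators

/-! ### The ring chain and its magnetic Laplacian -/

/-- Edges of the chain graph: `(j, true)` is the upper and `(j, false)` the lower semicircle of the
`j`-th ring. Each is parametrized by `[0, π]` from the left contact point (the `j`-th vertex) to the
right one (the `(j+1)`-st vertex). -/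
abbrev Edge : Type := ℤ × Bool

/-- Lebesgue measure on an edge. -/
noncomputable abbrev edgeMeasure : Measure ℝ := volume.restrict (Ioo 0 π)

/-- The Hilbert space `L²(Γ)`, the `ℓ²`-direct sum of the spaces `L²(0, π)` of the edges. -/
abbrev L2Graph : Type := lp (fun _ : Edge => Lp ℂ 2 edgeMeasure) 2

/-- The restriction of an element of `L²(Γ)` to an edge. -/
noncomputable def onEdge (f : L2Graph) (e : Edge) : Lp ℂ 2 edgeMeasure :=
  (f : ∀ _ : Edge, Lp ℂ 2 edgeMeasure) e

/-- `u` is (on `[0, π]`) the continuous representative of a function of the Sobolev space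
`H²(0, π)`, with first derivative `u₁` and second derivative `u₂`. -/
structure IsH2 (u u₁ u₂ : ℝ → ℂ) : Prop where
  memLp : MemLp u₂ 2 edgeMeasure
  deriv_eq : ∀ x ∈ Icc 0 π, u₁ x = u₁ 0 + ∫ t in (0 : ℝ)..x, u₂ t
  eq : ∀ x ∈ Icc 0 π, u x = u 0 + ∫ t in (0 : ℝ)..x, u₁ t

/-- The sign with which the vector potential enters the quasiderivative: `+` on the upper and `-`
on the lower semicircles. -/
def orient : Bool → ℝ
  | true => 1
  | false => -1

/-- The quasiderivative `𝒟u = u' + i a u`, where `u₁ = u'`. -/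
noncomputable def quasiDeriv (a : ℝ) (u u₁ : ℝ → ℂ) (x : ℝ) : ℂ :=
  u₁ x + Complex.I * a * u x

/-- `-𝒟² u = (i d/dx - a)² u = - u'' - 2 i a u' + a² u`, where `u₁ = u'` and `u₂ = u''`. -/
noncomputable def magneticSchrodinger (a : ℝ) (u u₁ u₂ : ℝ → ℂ) (x : ℝ) : ℂ :=
  -u₂ x - 2 * Complex.I * a * u₁ x + a ^ 2 * u x

/-- The `δ`-coupling of strength `α j` at the `j`-th vertex, where the rings `j - 1` and `j` touch:
continuity, and the sum of the outgoing quasiderivatives equals `α j` times the value. -/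
structure DeltaCoupling (α A : ℤ → ℝ) (u u₁ : ℤ → Bool → ℝ → ℂ) (j : ℤ) : Prop where
  cont_low : u j false 0 = u j true 0
  cont_left : ∀ s, u (j - 1) s π = u j true 0
  kirchhoff :
    (∑ s : Bool, quasiDeriv (orient s * A j) (u j s) (u₁ j s) 0)
      - (∑ s : Bool, quasiDeriv (orient s * A (j - 1)) (u (j - 1) s) (u₁ (j - 1) s) π)
      = α j * u j true 0

/-- `(f, g)` belongs to the graph of the magnetic Laplacian: `f` is `H²` on every edge and satisfies
the `δ`-coupling at every vertex, and `g = -𝒟² f` on every edge, with the potential `A j` on the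
`j`-th ring. -/
def InLaplacianGraph (α A : ℤ → ℝ) (f g : L2Graph) : Prop :=
  ∃ u u₁ u₂ : ℤ → Bool → ℝ → ℂ,
    (∀ j s, IsH2 (u j s) (u₁ j s) (u₂ j s)) ∧
    (∀ j s, onEdge f (j, s) =ᵐ[edgeMeasure] u j s) ∧
    (∀ j s, onEdge g (j, s) =ᵐ[edgeMeasure]
      magneticSchrodinger (orient s * A j) (u j s) (u₁ j s) (u₂ j s)) ∧
    (∀ j, DeltaCoupling α A u u₁ j)

lemma IsH2.intervalIntegrable₂ {u u₁ u₂ : ℝ → ℂ} (h : IsH2 u u₁ u₂) :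
    IntervalIntegrable u₂ volume 0 π := by
  rw [intervalIntegrable_iff_integrableOn_Ioo_of_le Real.pi_pos.le]
  exact h.memLp.integrable (by norm_num)

lemma sub_interval {f : ℝ → ℂ} (h : IntervalIntegrable f volume 0 π) {x : ℝ}
    (hx : x ∈ Icc 0 π) : IntervalIntegrable f volume 0 x :=
  h.mono_set (by rw [uIcc_of_le hx.1, uIcc_of_le Real.pi_pos.le]; exact Icc_subset_Icc_right hx.2)

lemma continuousOn_of_primitive {u v : ℝ → ℂ} (hv : IntervalIntegrable v volume 0 π)
    (h : ∀ x ∈ Icc 0 π, u x = u 0 + ∫ t in (0 : ℝ)..x, v t) : ContinuousOn u (Icc 0 π) := by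
  have hc := intervalIntegral.continuousOn_primitive_interval' hv left_mem_uIcc
  rw [uIcc_of_le Real.pi_pos.le] at hc
  exact (continuousOn_const.add hc).congr h

lemma IsH2.continuousOn₁ {u u₁ u₂ : ℝ → ℂ} (h : IsH2 u u₁ u₂) : ContinuousOn u₁ (Icc 0 π) :=
  continuousOn_of_primitive h.intervalIntegrable₂ h.deriv_eq

lemma IsH2.intervalIntegrable₁ {u u₁ u₂ : ℝ → ℂ} (h : IsH2 u u₁ u₂) :
    IntervalIntegrable u₁ volume 0 π :=
  ContinuousOn.intervalIntegrable (by rw [uIcc_of_le Real.pi_pos.le]; exact h.continuousOn₁)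

lemma IsH2.continuousOn {u u₁ u₂ : ℝ → ℂ} (h : IsH2 u u₁ u₂) : ContinuousOn u (Icc 0 π) :=
  continuousOn_of_primitive h.intervalIntegrable₁ h.eq

lemma IsH2.zero : IsH2 0 0 0 := ⟨MemLp.zero, by simp, by simp⟩

lemma IsH2.add {u u₁ u₂ v v₁ v₂ : ℝ → ℂ} (h : IsH2 u u₁ u₂) (k : IsH2 v v₁ v₂) :
    IsH2 (u + v) (u₁ + v₁) (u₂ + v₂) := by
  refine ⟨h.memLp.add k.memLp, fun x hx => ?_, fun x hx => ?_⟩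
  · simp only [Pi.add_apply]
    rw [intervalIntegral.integral_add (sub_interval h.intervalIntegrable₂ hx)
      (sub_interval k.intervalIntegrable₂ hx), h.deriv_eq x hx, k.deriv_eq x hx]
    ring
  · simp only [Pi.add_apply]
    rw [intervalIntegral.integral_add (sub_interval h.intervalIntegrable₁ hx)
      (sub_interval k.intervalIntegrable₁ hx), h.eq x hx, k.eq x hx]
    ring

lemma IsH2.smul {u u₁ u₂ : ℝ → ℂ} (c : ℂ) (h : IsH2 u u₁ u₂) :
    IsH2 (c • u) (c • u₁) (c • u₂) := by
  refine ⟨h.memLp.const_smul c, fun x hx => ?_, fun x hx => ?_⟩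
  · simp only [Pi.smul_apply]
    rw [intervalIntegral.integral_smul, h.deriv_eq x hx, smul_add]
  · simp only [Pi.smul_apply]
    rw [intervalIntegral.integral_smul, h.eq x hx, smul_add]

lemma ae_eq_zero_of_primitive_eq_zero {v : ℝ → ℂ} (hv : IntervalIntegrable v volume 0 π)
    (h : ∀ x ∈ Icc 0 π, ∫ t in (0 : ℝ)..x, v t = 0) : v =ᵐ[edgeMeasure] 0 := by
  rw [Filter.EventuallyEq, ae_restrict_iff' measurableSet_Ioo]
  filter_upwards [hv.ae_hasDerivAt_integral] with x hx hx'
  have hd := hx (by rw [uIcc_of_le Real.pi_pos.le]; exact Ioo_subset_Icc_self hx') 0 left_mem_uIcc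
  have h0 : (fun y => ∫ t in (0 : ℝ)..y, v t) =ᶠ[nhds x] fun _ => 0 := by
    filter_upwards [Ioo_mem_nhds hx'.1 hx'.2] with y hy using h y (Ioo_subset_Icc_self hy)
  exact hd.unique ((hasDerivAt_const x (0 : ℂ)).congr_of_eventuallyEq h0)

lemma eqOn_zero_of_ae {u : ℝ → ℂ} (hu : ContinuousOn u (Icc 0 π)) (h : u =ᵐ[edgeMeasure] 0) :
    ∀ x ∈ Icc 0 π, u x = 0 := by
  have h1 : EqOn u (fun _ => 0) (Ioo 0 π) :=
    Measure.eqOn_open_of_ae_eq h isOpen_Ioo (hu.mono Ioo_subset_Icc_self) continuousOn_const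
  have h2 : EqOn u (fun _ => 0) (Icc 0 π) := by
    refine h1.of_subset_closure hu continuousOn_const Ioo_subset_Icc_self ?_
    rw [closure_Ioo Real.pi_pos.ne]
  exact h2

lemma IsH2.ae_eq_zero {u u₁ u₂ : ℝ → ℂ} (h : IsH2 u u₁ u₂) (h0 : u =ᵐ[edgeMeasure] 0) :
    u₁ =ᵐ[edgeMeasure] 0 ∧ u₂ =ᵐ[edgeMeasure] 0 := by
  have hu := eqOn_zero_of_ae h.continuousOn h0
  have hz : (0 : ℝ) ∈ Icc 0 π := ⟨le_rfl, Real.pi_pos.le⟩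
  have h1 : u₁ =ᵐ[edgeMeasure] 0 := by
    refine ae_eq_zero_of_primitive_eq_zero h.intervalIntegrable₁ fun x hx => ?_
    have := h.eq x hx
    rw [hu x hx, hu 0 hz, zero_add] at this
    exact this.symm
  refine ⟨h1, ?_⟩
  have hu₁ := eqOn_zero_of_ae h.continuousOn₁ h1
  refine ae_eq_zero_of_primitive_eq_zero h.intervalIntegrable₂ fun x hx => ?_
  have := h.deriv_eq x hx
  rw [hu₁ x hx, hu₁ 0 hz, zero_add] at this
  exact this.symm

/-- The graph of the magnetic Laplacian as a subspace of `L²(Γ) × L²(Γ)`. -/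
noncomputable def laplacianGraph (α A : ℤ → ℝ) : Submodule ℂ (L2Graph × L2Graph) where
  carrier := {p | InLaplacianGraph α A p.1 p.2}
  zero_mem' := by
    refine ⟨0, 0, 0, fun _ _ => IsH2.zero, fun j s => ?_, fun j s => ?_, fun j => ?_⟩
    · exact Lp.coeFn_zero _ _ _
    · refine (Lp.coeFn_zero _ _ _).trans (Filter.Eventually.of_forall fun x => ?_)
      simp [magneticSchrodinger]
    · exact ⟨by simp, by simp, by simp [quasiDeriv]⟩
  add_mem' := by
    rintro p q ⟨u, u₁, u₂, hu, hf, hg, hd⟩ ⟨v, v₁, v₂, hv, hf', hg', hd'⟩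
    refine ⟨u + v, u₁ + v₁, u₂ + v₂, fun j s => (hu j s).add (hv j s), fun j s => ?_,
      fun j s => ?_, fun j => ?_⟩
    · exact (Lp.coeFn_add _ _).trans ((hf j s).add (hf' j s))
    · refine (Lp.coeFn_add _ _).trans (((hg j s).add (hg' j s)).trans
        (Filter.Eventually.of_forall fun x => ?_))
      simp only [magneticSchrodinger, Pi.add_apply]
      ring
    · refine ⟨?_, fun s => ?_, ?_⟩
      · simp [(hd j).cont_low, (hd' j).cont_low]
      · simp [(hd j).cont_left s, (hd' j).cont_left s]
      · have h1 := (hd j).kirchhoff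
        have h2 := (hd' j).kirchhoff
        simp only [quasiDeriv, Fintype.sum_bool, Pi.add_apply] at h1 h2 ⊢
        linear_combination h1 + h2
  smul_mem' := by
    rintro c p ⟨u, u₁, u₂, hu, hf, hg, hd⟩
    refine ⟨c • u, c • u₁, c • u₂, fun j s => (hu j s).smul c, fun j s => ?_,
      fun j s => ?_, fun j => ?_⟩
    · exact (Lp.coeFn_smul c _).trans ((hf j s).const_smul c)
    · refine (Lp.coeFn_smul c _).trans (((hg j s).const_smul c).trans
        (Filter.Eventually.of_forall fun x => ?_))
      simp only [magneticSchrodinger, Pi.smul_apply, smul_eq_mul]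
      ring
    · refine ⟨?_, fun s => ?_, ?_⟩
      · simp [(hd j).cont_low]
      · simp [(hd j).cont_left s]
      · have h1 := (hd j).kirchhoff
        simp only [quasiDeriv, Fintype.sum_bool, Pi.smul_apply, smul_eq_mul] at h1 ⊢
        linear_combination c * h1

lemma laplacianGraph_single_valued (α A : ℤ → ℝ) (p : L2Graph × L2Graph)
    (hp : p ∈ laplacianGraph α A) (h0 : p.1 = 0) : p.2 = 0 := by
  obtain ⟨u, u₁, u₂, hu, hf, hg, -⟩ := hp
  ext1
  funext e
  obtain ⟨j, s⟩ := e
  have hu0 : u j s =ᵐ[edgeMeasure] 0 := by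
    refine (hf j s).symm.trans ?_
    rw [h0]
    exact Lp.coeFn_zero _ _ _
  obtain ⟨h1, h2⟩ := (hu j s).ae_eq_zero hu0
  refine Lp.ext ((hg j s).trans (Filter.EventuallyEq.trans ?_ (Lp.coeFn_zero _ _ _).symm))
  filter_upwards [hu0, h1, h2] with x hx hx1 hx2
  simp [magneticSchrodinger, hx, hx1, hx2]

/-- The magnetic Laplacian on the chain of rings of circumference `2π`, with coupling constants
`α j` at the vertices and vector potentials `A j` on the rings, as an unbounded operator in
`L²(Γ)`. -/
noncomputable def magneticLaplacian (α A : ℤ → ℝ) : L2Graph →ₗ.[ℂ] L2Graph :=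
  (laplacianGraph α A).toLinearPMap

lemma mem_graph_magneticLaplacian (α A : ℤ → ℝ) (f g : L2Graph) :
    (f, g) ∈ (magneticLaplacian α A).graph ↔ InLaplacianGraph α A f g := by
  rw [magneticLaplacian,
    Submodule.toLinearPMap_graph_eq _ (laplacianGraph_single_valued α A)]
  rfl

/-- The periodic Hamiltonian `-Δ_{α,A}`. -/
noncomputable def periodicHamiltonian (α A : ℝ) : L2Graph →ₗ.[ℂ] L2Graph :=
  magneticLaplacian (fun _ => α) (fun _ => A)

/-- The weakly perturbed Hamiltonian `-Δ_ε`: the coupling constants are `α + ε α_j` and the vector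
potentials `A + ε A_j` for `j = 1, …, n`, and `α`, `A` for all other `j`. -/
noncomputable def perturbedHamiltonian (α A : ℝ) (n : ℕ) (a b : ℤ → ℝ) (ε : ℝ) :
    L2Graph →ₗ.[ℂ] L2Graph :=
  magneticLaplacian (fun j => if j ∈ Finset.Icc 1 (n : ℤ) then α + ε * a j else α)
    (fun j => if j ∈ Finset.Icc 1 (n : ℤ) then A + ε * b j else A)

end RingChain

/-! Gauging away the potential on each edge reduces `-𝒟²f = E f` to `-w'' = E w`, with phases
appearing only at the vertices. Off the Dirichlet points (`sinPi E = 0`) a solution is determined by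
its vertex values `ψ`, and the `δ`-coupling becomes `cos(A_j π) ψ_{j+1} + cos(A_{j-1} π) ψ_{j-1} = 2
disc(α_j, E) ψ_j` (`GaugedGraph.difference_eq`, with converse `exists_lift`). Hence the unperturbed
spectrum is `bandSet`: the Dirichlet points, of infinite multiplicity, and the energies with `|disc|
≤ |cos Aπ|`. A local perturbation keeps it, because for unimodular characteristic roots no nonzero
solution decays on a half-line.

In a gap let `x + 1/x = 2 disc / cos Aπ` with `|x| > 1`, and `y = x⁻²`. The solution decaying on the
left obeys a discrete Riccati recursion across the perturbed sites, and it continues to one decaying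
on the right exactly when `mismatch` vanishes. To first order in `ε`, with `∑ α_j = 0` removing the
coupling term, the mismatch is `(1 - y) - εκ` with `κ = -2π tan(Aπ) ∑ A_j`, up to an error `C ε (ε +
(1 - y))` (`mismatch_estimate`). The constant serves all gaps at once, since the effective coupling
is bounded uniformly in the energy (`exists_gapCoupling_bound`). This is why a single `ε₀` suffices
for infinitely many gaps.

If `κ < 0` the mismatch is positive in every gap, so the operator minus the energy is injective; a
finite-rank argument makes it surjective (`exists_solution`, `bijective_of_difference`), and the
spectrum is unchanged. If `κ > 0` the mismatch is negative near the band edge and positive far from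
it. Every gap reaches from a band edge to a Dirichlet point or to `-∞`, so it contains a zero
(`exists_gapMismatch_eq_zero`). Two zeros in one gap are excluded by a Wronskian argument
(`wronskian_false`), which rests on the monotonicity of `disc` wherever `|disc| < 1`
(`disc_sub_div_lt`) and on the sign pattern of the bound states. -/

namespace RingChain

open MeasureTheory Set Filter Topology

/-! ### Primitives of integrable functions on `[0, π]` -/

/-- On `[0, π]`, `F` is a primitive of the integrable function `f`. -/
structure IsPrimitive (F f : ℝ → ℂ) : Prop where
  int : IntervalIntegrable f volume 0 π
  eq : ∀ x ∈ Icc 0 π, F x = F 0 + ∫ t in (0 : ℝ)..x, f t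

lemma IsPrimitive.continuousOn {F f : ℝ → ℂ} (h : IsPrimitive F f) : ContinuousOn F (Icc 0 π) :=
  continuousOn_of_primitive h.int h.eq

/-- Real and imaginary parts are treated separately and recombined as multiples of the constants `1`
and `I`. -/
lemma absolutelyContinuousOnInterval_integral {f : ℝ → ℂ} (hf : IntervalIntegrable f volume 0 π) :
    AbsolutelyContinuousOnInterval (fun x => ∫ t in (0 : ℝ)..x, f t) 0 π := by
  have hre : IntervalIntegrable (fun t => (f t).re) volume 0 π := ⟨hf.1.re, hf.2.re⟩
  have him : IntervalIntegrable (fun t => (f t).im) volume 0 π := ⟨hf.1.im, hf.2.im⟩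
  have h1 := hre.absolutelyContinuousOnInterval_intervalIntegral (c := 0) left_mem_uIcc
  have h2 := him.absolutelyContinuousOnInterval_intervalIntegral (c := 0) left_mem_uIcc
  have hc : ∀ z : ℂ, AbsolutelyContinuousOnInterval (fun _ : ℝ => z) 0 π := fun z =>
    ((LipschitzWith.const' z).lipschitzOnWith (K := 0)).absolutelyContinuousOnInterval
  have h := (h1.smul (hc 1)).add (h2.smul (hc Complex.I))
  refine absolutelyContinuousOnInterval_iff _ _ _ |>.2 fun ε hε => ?_
  obtain ⟨δ, hδ, H⟩ := (absolutelyContinuousOnInterval_iff _ _ _).1 h ε hε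
  refine ⟨δ, hδ, fun E hE hE' => ?_⟩
  refine lt_of_eq_of_lt (Finset.sum_congr rfl fun i hi => ?_) (H E hE hE')
  have key : ∀ x ∈ uIcc 0 π, ∫ t in (0 : ℝ)..x, f t
      = ((fun x => ∫ t in (0 : ℝ)..x, (f t).re) • (fun _ : ℝ => (1 : ℂ))
        + (fun x => ∫ t in (0 : ℝ)..x, (f t).im) • fun _ : ℝ => Complex.I) x := by
    intro x hx
    rw [uIcc_of_le Real.pi_pos.le] at hx
    have hi := sub_interval hf hx
    have e1 := Complex.reCLM.intervalIntegral_comp_comm hi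
    have e2 := Complex.imCLM.intervalIntegral_comp_comm hi
    simp only [Complex.reCLM_apply, Complex.imCLM_apply] at e1 e2
    apply Complex.ext <;> simp [e1, e2]
  have := hE.1 i hi
  rw [key _ this.1, key _ this.2]

lemma IsPrimitive.absolutelyContinuous {F f : ℝ → ℂ} (h : IsPrimitive F f) :
    AbsolutelyContinuousOnInterval (fun x => F 0 + ∫ t in (0 : ℝ)..x, f t) 0 π :=
  (((LipschitzWith.const' (F 0)).lipschitzOnWith (K := 0)).absolutelyContinuousOnInterval).add
    (absolutelyContinuousOnInterval_integral h.int)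

lemma IsPrimitive.ae_hasDerivAt {F f : ℝ → ℂ} (h : IsPrimitive F f) :
    ∀ᵐ x, x ∈ uIcc 0 π → HasDerivAt (fun x => F 0 + ∫ t in (0 : ℝ)..x, f t) (f x) x := by
  filter_upwards [h.int.ae_hasDerivAt_integral] with x hx hx'
  exact (hx hx' 0 left_mem_uIcc).const_add _

lemma IsPrimitive.of_continuousOn_hasDerivAt {F f : ℝ → ℂ} (hd : ∀ x, HasDerivAt F (f x) x)
    (hc : Continuous f) : IsPrimitive F f :=
  ⟨hc.intervalIntegrable _ _, fun x _ => by
    rw [intervalIntegral.integral_eq_sub_of_hasDerivAt (fun y _ => hd y)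
      (hc.intervalIntegrable _ _)]; ring⟩

/-- The difference `FG - ∫ (fG + Fg)` is absolutely continuous with derivative zero almost
everywhere, hence constant. This product rule underlies both the gauge transformation and Green's
identity for functions whose second derivative is only square integrable. -/
lemma IsPrimitive.mul {F f G g : ℝ → ℂ} (hF : IsPrimitive F f) (hG : IsPrimitive G g) :
    IsPrimitive (F * G) (f * G + F * g) := by
  have hu : uIcc (0 : ℝ) π = Icc 0 π := uIcc_of_le Real.pi_pos.le
  have hi : IntervalIntegrable (f * G + F * g) volume 0 π :=
    (hF.int.mul_continuousOn (hu ▸ hG.continuousOn)).add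
      (hG.int.continuousOn_mul (hu ▸ hF.continuousOn))
  refine ⟨hi, fun x hx => ?_⟩
  have hac := (hF.absolutelyContinuous.smul hG.absolutelyContinuous).sub
    (absolutelyContinuousOnInterval_integral hi)
  have hd : ∀ᵐ x, x ∈ uIcc 0 π → HasDerivAt
      (((fun x => F 0 + ∫ t in (0 : ℝ)..x, f t) • fun x => G 0 + ∫ t in (0 : ℝ)..x, g t)
        - fun x => ∫ t in (0 : ℝ)..x, (f * G + F * g) t) 0 x := by
    filter_upwards [hF.ae_hasDerivAt, hG.ae_hasDerivAt, hi.ae_hasDerivAt_integral]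
      with x h1 h2 h3 hx
    have := ((h1 hx).mul (h2 hx)).sub (h3 hx 0 left_mem_uIcc)
    rw [hu] at hx
    rw [← hF.eq x hx, ← hG.eq x hx] at this
    refine this.congr_deriv ?_
    simp only [Pi.add_apply, Pi.mul_apply]; ring
  obtain ⟨C, hC⟩ := hac.const_of_ae_hasDerivAt_zero hd
  have e0 := hC 0 left_mem_uIcc
  have ex := hC x (hu ▸ hx)
  simp only [Pi.sub_apply, smul_eq_mul, Pi.mul_apply, intervalIntegral.integral_same,
    add_zero, sub_zero] at e0 ex
  rw [← hF.eq x hx, ← hG.eq x hx, ← e0] at ex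
  simp only [Pi.mul_apply]
  linear_combination ex

lemma IsPrimitive.add {F f G g : ℝ → ℂ} (hF : IsPrimitive F f) (hG : IsPrimitive G g) :
    IsPrimitive (F + G) (f + g) := by
  refine ⟨hF.int.add hG.int, fun x hx => ?_⟩
  simp only [Pi.add_apply]
  rw [intervalIntegral.integral_add (sub_interval hF.int hx) (sub_interval hG.int hx),
    hF.eq x hx, hG.eq x hx]
  ring

lemma IsPrimitive.const_mul {F f : ℝ → ℂ} (c : ℂ) (hF : IsPrimitive F f) :
    IsPrimitive (fun x => c * F x) (fun x => c * f x) := by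
  refine ⟨hF.int.const_mul c, fun x hx => ?_⟩
  rw [intervalIntegral.integral_const_mul, hF.eq x hx]
  ring

lemma IsPrimitive.congr {F f G g : ℝ → ℂ} (hF : IsPrimitive F f) (h : ∀ x ∈ Icc 0 π, F x = G x)
    (h' : f =ᵐ[edgeMeasure] g) : IsPrimitive G g := by
  have h'' : f =ᵐ[volume.restrict (Ioc 0 π)] g := by
    rw [← restrict_Ioo_eq_restrict_Ioc]; exact h'
  refine ⟨?_, fun x hx => ?_⟩
  · refine hF.int.congr_ae ?_
    rwa [uIoc_of_le Real.pi_pos.le]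
  · rw [← h x hx, ← h 0 ⟨le_rfl, Real.pi_pos.le⟩, hF.eq x hx]
    congr 1
    refine intervalIntegral.integral_congr_ae ?_
    rw [uIoc_of_le hx.1]
    rw [Filter.EventuallyEq, ae_restrict_iff' measurableSet_Ioc] at h''
    filter_upwards [h''] with t ht ht' using ht ⟨ht'.1, ht'.2.trans hx.2⟩

lemma IsPrimitive.integral_eq {F f : ℝ → ℂ} (hF : IsPrimitive F f) :
    ∫ t, f t ∂edgeMeasure = F π - F 0 := by
  rw [hF.eq π ⟨Real.pi_pos.le, le_rfl⟩, intervalIntegral.integral_of_le Real.pi_pos.le,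
    ← restrict_Ioo_eq_restrict_Ioc]
  ring

lemma IsPrimitive.eq_const {F f : ℝ → ℂ} (hF : IsPrimitive F f) (h : f =ᵐ[edgeMeasure] 0) :
    ∀ x ∈ Icc 0 π, F x = F 0 := by
  intro x hx
  rw [(hF.congr (fun _ _ => rfl) h).eq x hx]
  simp

/-! ### `H²` functions on an edge and the gauge transformation. -/

lemma IsH2.isPrimitive {u u₁ u₂ : ℝ → ℂ} (h : IsH2 u u₁ u₂) : IsPrimitive u u₁ :=
  ⟨h.intervalIntegrable₁, h.eq⟩

lemma IsH2.isPrimitive₁ {u u₁ u₂ : ℝ → ℂ} (h : IsH2 u u₁ u₂) : IsPrimitive u₁ u₂ :=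
  ⟨h.intervalIntegrable₂, h.deriv_eq⟩

lemma memLp_edge_of_continuousOn {u : ℝ → ℂ} (h : ContinuousOn u (Icc 0 π)) :
    MemLp u 2 edgeMeasure := by
  obtain ⟨C, hC⟩ := isCompact_Icc.exists_bound_of_continuousOn h
  refine MemLp.of_bound ((h.mono Ioo_subset_Icc_self).aestronglyMeasurable measurableSet_Ioo) C ?_
  rw [ae_restrict_iff' measurableSet_Ioo]
  exact Filter.Eventually.of_forall fun x hx => hC x (Ioo_subset_Icc_self hx)

lemma IsH2.of_isPrimitive {u u₁ u₂ : ℝ → ℂ} (h : IsPrimitive u u₁) (h₁ : IsPrimitive u₁ u₂)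
    (h₂ : MemLp u₂ 2 edgeMeasure) : IsH2 u u₁ u₂ := ⟨h₂, h₁.eq, h.eq⟩

/-- Multiplication by a smooth function preserves `H²`. -/
lemma IsH2.mul_smooth {u u₁ u₂ e e₁ e₂ : ℝ → ℂ} (h : IsH2 u u₁ u₂)
    (he : ∀ x, HasDerivAt e (e₁ x) x) (he₁ : ∀ x, HasDerivAt e₁ (e₂ x) x) (he₂ : Continuous e₂) :
    IsH2 (fun x => e x * u x) (fun x => e₁ x * u x + e x * u₁ x)
      (fun x => e₂ x * u x + 2 * (e₁ x * u₁ x) + e x * u₂ x) := by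
  have ce : Continuous e := continuous_iff_continuousAt.2 fun x => (he x).continuousAt
  have ce₁ : Continuous e₁ := continuous_iff_continuousAt.2 fun x => (he₁ x).continuousAt
  have p := IsPrimitive.of_continuousOn_hasDerivAt he ce₁
  have p₁ := IsPrimitive.of_continuousOn_hasDerivAt he₁ he₂
  refine IsH2.of_isPrimitive (p.mul h.isPrimitive) ?_ ?_
  · refine ((p₁.mul h.isPrimitive).add (p.mul h.isPrimitive₁)).congr (fun x _ => rfl)
      (Filter.Eventually.of_forall fun x => ?_)
    simp only [Pi.add_apply, Pi.mul_apply]; ring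
  · have m1 : MemLp (fun x => e₂ x * u x + 2 * (e₁ x * u₁ x)) 2 edgeMeasure := by
      refine memLp_edge_of_continuousOn ?_
      exact (he₂.continuousOn.mul h.continuousOn).add
        (continuousOn_const.mul (ce₁.continuousOn.mul h.continuousOn₁))
    obtain ⟨C, hC⟩ := isCompact_Icc.exists_bound_of_continuousOn (ce.continuousOn (s := Icc 0 π))
    refine m1.add (MemLp.of_le_mul (c := C) h.memLp
      (ce.aestronglyMeasurable.mul h.memLp.aestronglyMeasurable) ?_)
    rw [ae_restrict_iff' measurableSet_Ioo]
    refine Filter.Eventually.of_forall fun x hx => ?_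
    rw [norm_mul]
    exact mul_le_mul_of_nonneg_right (hC x (Ioo_subset_Icc_self hx)) (norm_nonneg _)

lemma IsH2.congr {u u₁ u₂ v v₁ v₂ : ℝ → ℂ} (h : IsH2 u u₁ u₂) (e : ∀ x, u x = v x)
    (e₁ : ∀ x, u₁ x = v₁ x) (e₂ : u₂ =ᵐ[edgeMeasure] v₂) : IsH2 v v₁ v₂ :=
  IsH2.of_isPrimitive (h.isPrimitive.congr (fun x _ => e x) (Filter.Eventually.of_forall e₁))
    (h.isPrimitive₁.congr (fun x _ => e₁ x) e₂) (h.memLp.ae_eq e₂)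

/-- The gauge factor `e^{i a x}`. -/
noncomputable def phase (a : ℝ) (x : ℝ) : ℂ := Complex.exp (Complex.I * a * x)

lemma norm_phase (a x : ℝ) : ‖phase a x‖ = 1 := by
  rw [phase, show Complex.I * a * x = ((a * x : ℝ) : ℂ) * Complex.I by push_cast; ring]
  exact Complex.norm_exp_ofReal_mul_I _

lemma phase_zero (a : ℝ) : phase a 0 = 1 := by simp [phase]

lemma phase_neg_mul (a x : ℝ) : phase (-a) x * phase a x = 1 := by
  rw [phase, phase, ← Complex.exp_add]
  simp

lemma phase_ne_zero (a x : ℝ) : phase a x ≠ 0 := Complex.exp_ne_zero _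

lemma hasDerivAt_phase (a x : ℝ) : HasDerivAt (phase a) (Complex.I * a * phase a x) x := by
  have h : HasDerivAt (fun y : ℝ => Complex.I * a * (y : ℂ)) (Complex.I * a) x := by
    simpa using (Complex.ofRealCLM.hasDerivAt (x := x)).const_mul (Complex.I * (a : ℂ))
  exact h.cexp.congr_deriv (by rw [phase]; ring)

lemma continuous_phase (a : ℝ) : Continuous (phase a) :=
  continuous_iff_continuousAt.2 fun x => (hasDerivAt_phase a x).continuousAt

/-- The gauge transformation turns `𝒟 = d/dx + i a` into `d/dx`. -/
lemma IsH2.phase_mul {u u₁ u₂ : ℝ → ℂ} (a : ℝ) (h : IsH2 u u₁ u₂) :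
    IsH2 (fun x => phase a x * u x) (fun x => phase a x * quasiDeriv a u u₁ x)
      (fun x => -(phase a x * magneticSchrodinger a u u₁ u₂ x)) := by
  refine (h.mul_smooth (hasDerivAt_phase a) (fun x => (hasDerivAt_phase a x).const_mul _)
    (continuous_const.mul (continuous_const.mul (continuous_phase a)))).congr (fun _ => rfl) (fun x => ?_)
    (Filter.Eventually.of_forall fun x => ?_)
  · simp only [quasiDeriv]; ring
  · simp only [magneticSchrodinger]
    linear_combination ((a : ℂ) ^ 2 * phase a x * u x) * Complex.I_sq

lemma quasiDeriv_phase_neg (a : ℝ) (w w₁ : ℝ → ℂ) (x : ℝ) :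
    quasiDeriv a (fun x => phase (-a) x * w x)
      (fun x => phase (-a) x * quasiDeriv (-a) w w₁ x) x = phase (-a) x * w₁ x := by
  simp only [quasiDeriv]; push_cast; ring

lemma magneticSchrodinger_phase_neg (a : ℝ) (w w₁ w₂ : ℝ → ℂ) (x : ℝ) :
    magneticSchrodinger a (fun x => phase (-a) x * w x)
      (fun x => phase (-a) x * quasiDeriv (-a) w w₁ x)
      (fun x => -(phase (-a) x * magneticSchrodinger (-a) w w₁ w₂ x)) x
      = -(phase (-a) x * w₂ x) := by
  simp only [quasiDeriv, magneticSchrodinger]; push_cast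
  linear_combination (2 * (a : ℂ) ^ 2 * phase (-a) x * w x) * Complex.I_sq

/-! ### The discrete Riccati equation -/

/-- The relative deviation of the ratio of consecutive values of the left decaying solution of the
perturbed difference equation from its unperturbed value. -/
noncomputable def riccati (y β : ℝ) (a s : ℕ → ℝ) : ℕ → ℝ
  | 0 => 0
  | k + 1 => a (k + 1) * β + y * (riccati y β a s k - s k) / (1 + riccati y β a s k)

/-- The mismatch between the left and the right decaying solution at site `n`. -/
noncomputable def mismatch (y β : ℝ) (a s : ℕ → ℝ) (n : ℕ) : ℝ :=
  1 + riccati y β a s n - y * (1 + s n)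

lemma abs_div_one_add_sub_one_le {y g : ℝ} (hy : y ∈ Icc (0 : ℝ) 1) (hg : |g| ≤ 1 / 2) :
    |y / (1 + g) - 1| ≤ 2 * ((1 - y) + |g|) := by
  have h1 : 1 / 2 ≤ 1 + g := by linarith [(abs_le.1 hg).1]
  rw [show y / (1 + g) - 1 = -((1 - y) + g) / (1 + g) by field_simp; ring, abs_div, abs_neg,
    abs_of_pos (by linarith : 0 < 1 + g), div_le_iff₀ (by linarith)]
  have h2 : |1 - y + g| ≤ (1 - y) + |g| :=
    (abs_add_le _ _).trans (by rw [abs_of_nonneg (by linarith [hy.2] : 0 ≤ 1 - y)])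
  nlinarith [abs_nonneg g, hy.2]

/-- Since `y / (1 + g) = 1 + O((1 - y) + |g|)`, the recursion is additive to first order: `g - s`
grows at site `k + 1` by `ε (β a_{k+1} - σ_{k+1})`. All constants are uniform in `y ∈ [0, 1]` and
`|β| ≤ B`, hence later in the energy. Keeping `1 - y` in the error matters: away from the band edge
that part is absorbed by the leading term `1 - y` of the mismatch. -/
lemma riccati_estimate (a σ : ℕ → ℝ) (s : ℝ → ℕ → ℝ) (B : ℝ) (hB : 0 ≤ B)
    (hs₀ : ∀ ε, s ε 0 = 0)
    (hs : ∀ k, ∃ C > 0, ∀ ε ∈ Ioo (0 : ℝ) 1, |s ε k - ε * σ k| ≤ C * ε ^ 2) (k : ℕ) :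
    ∃ C > 0, ∃ ε₁ ∈ Ioo (0 : ℝ) 1, ∀ ε ∈ Ioo 0 ε₁, ∀ y ∈ Icc (0 : ℝ) 1, ∀ β, |β| ≤ B →
      (∀ i ≤ k, |riccati y β (fun j => ε * a j) (s ε) i| ≤ 1 / 2) ∧
      |riccati y β (fun j => ε * a j) (s ε) k| ≤ C * ε ∧
      |riccati y β (fun j => ε * a j) (s ε) k - s ε k
        - ε * (β * ∑ i ∈ Finset.range k, a (i + 1) - ∑ i ∈ Finset.range k, σ (i + 1))|
        ≤ C * ε * (ε + (1 - y)) := by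
  induction k with
  | zero =>
    refine ⟨1, one_pos, 1 / 2, by norm_num, fun ε hε y hy β hβ => ⟨fun i hi => ?_, ?_, ?_⟩⟩
    · obtain rfl : i = 0 := by omega
      norm_num [riccati]
    · simpa [riccati] using hε.1.le
    · simp only [riccati, hs₀, Finset.range_zero, Finset.sum_empty]
      norm_num
      exact mul_nonneg hε.1.le (by linarith [hε.1, hy.2])
  | succ k ih =>
    obtain ⟨C, hC, ε₁, hε₁, H⟩ := ih
    obtain ⟨D, hD, hsD⟩ := hs k
    obtain ⟨D', hD', hsD'⟩ := hs (k + 1)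
    set C₁ : ℝ := C + D + |σ k| with hC₁
    have hC₁0 : 0 < C₁ := by positivity
    set C₂ : ℝ := |a (k + 1)| * B + 2 * C₁ with hC₂
    have hC₂0 : 0 < C₂ := by positivity
    set C₃ : ℝ := C₂ + C + 2 * C₁ * (1 + C) + D' with hC₃
    have hC₃0 : 0 < C₃ := by positivity
    -- The threshold `1 / (2 C₂)` keeps the next iterate within `1/2`, so that the denominator `1 +
    -- g` stays away from zero.
    refine ⟨C₃, hC₃0, min ε₁ (1 / (2 * C₂)), ⟨lt_min hε₁.1 (by positivity),
      (min_le_left _ _).trans_lt hε₁.2⟩, fun ε hε y hy β hβ => ?_⟩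
    have hε0 : 0 < ε := hε.1
    have hεε₁ : ε < ε₁ := hε.2.trans_le (min_le_left _ _)
    have hε1 : ε < 1 := hεε₁.trans hε₁.2
    obtain ⟨hi, h1, h2⟩ := H ε ⟨hε0, hεε₁⟩ y hy β hβ
    have hg := hi k le_rfl
    have hsk := hsD ε ⟨hε0, hε1⟩
    have hsk' := hsD' ε ⟨hε0, hε1⟩
    set g := riccati y β (fun j => ε * a j) (s ε) k with hgdef
    have hrec : riccati y β (fun j => ε * a j) (s ε) (k + 1)
        = ε * a (k + 1) * β + y * (g - s ε k) / (1 + g) := rfl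
    have hs1 : |s ε k| ≤ (D + |σ k|) * ε := by
      have : s ε k = (s ε k - ε * σ k) + ε * σ k := by ring
      rw [this]
      refine (abs_add_le _ _).trans ?_
      rw [abs_mul, abs_of_pos hε0]
      nlinarith [mul_pos hD hε0]
    have he : |g - s ε k| ≤ C₁ * ε := (abs_sub _ _).trans (by rw [hC₁]; linarith)
    have hdiv := abs_div_one_add_sub_one_le hy hg
    have hg1 : 1 / 2 ≤ 1 + g := by linarith [(abs_le.1 hg).1]
    have hyg : |y / (1 + g)| ≤ 2 := by
      rw [abs_of_nonneg (div_nonneg hy.1 (by linarith)), div_le_iff₀ (by linarith)]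
      linarith [hy.2]
    have hy1 : 0 ≤ 1 - y := by linarith [hy.2]
    have hg' : |riccati y β (fun j => ε * a j) (s ε) (k + 1)| ≤ C₂ * ε := by
      rw [hrec, show y * (g - s ε k) / (1 + g) = y / (1 + g) * (g - s ε k) by ring]
      refine (abs_add_le _ _).trans ?_
      rw [abs_mul, abs_mul, abs_mul, abs_of_pos hε0, hC₂]
      have e1 : ε * |a (k + 1)| * |β| ≤ ε * |a (k + 1)| * B :=
        mul_le_mul_of_nonneg_left hβ (by positivity)
      have e2 : |y / (1 + g)| * |g - s ε k| ≤ 2 * (C₁ * ε) :=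
        mul_le_mul hyg he (abs_nonneg _) (by norm_num)
      linarith
    refine ⟨fun i hik => ?_, ?_, ?_⟩
    · rcases Nat.lt_or_ge i (k + 1) with h | h
      · exact hi i (by omega)
      · obtain rfl : i = k + 1 := by omega
        refine hg'.trans ?_
        have : ε < 1 / (2 * C₂) := hε.2.trans_le (min_le_right _ _)
        rw [lt_div_iff₀ (by positivity)] at this
        linarith
    · refine hg'.trans (mul_le_mul_of_nonneg_right ?_ hε0.le)
      rw [hC₃]
      have : 0 ≤ 2 * C₁ * (1 + C) := by positivity
      linarith
    · rw [hrec, Finset.sum_range_succ, Finset.sum_range_succ]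
      set A := ∑ i ∈ Finset.range k, a (i + 1)
      set K := ∑ i ∈ Finset.range k, σ (i + 1)
      have hsplit : ε * a (k + 1) * β + y * (g - s ε k) / (1 + g) - s ε (k + 1)
          - ε * (β * (A + a (k + 1)) - (K + σ (k + 1)))
          = (g - s ε k - ε * (β * A - K)) + (y / (1 + g) - 1) * (g - s ε k)
            - (s ε (k + 1) - ε * σ (k + 1)) := by ring
      rw [hsplit]
      refine (abs_sub _ _).trans ((add_le_add (abs_add_le _ _) le_rfl).trans ?_)
      rw [abs_mul]
      have e1 : |y / (1 + g) - 1| * |g - s ε k| ≤ 2 * ((1 - y) + C * ε) * (C₁ * ε) :=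
        mul_le_mul (hdiv.trans (by linarith)) he (abs_nonneg _) (by positivity)
      have e2 : 2 * ((1 - y) + C * ε) * (C₁ * ε) ≤ 2 * C₁ * (1 + C) * ε * (ε + (1 - y)) := by
        have : 0 ≤ C₁ * ε * (ε + C * (1 - y)) := by positivity
        linarith
      have e3 : D' * ε ^ 2 ≤ D' * ε * (ε + (1 - y)) := by
        have : 0 ≤ D' * ε * (1 - y) := by positivity
        linarith
      have e4 : 0 ≤ C₂ * ε * (ε + (1 - y)) := by positivity
      rw [hC₃]
      linarith

/-- With `∑ a = 0` the `β`-dependent first-order term drops out. What remains of `y (1 + s)` beyond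
`y + s` is `(1 - y) s`, which is within the allowed error. -/
lemma mismatch_estimate (n : ℕ) (a σ : ℕ → ℝ) (s : ℝ → ℕ → ℝ) (B : ℝ) (hB : 0 ≤ B)
    (hs₀ : ∀ ε, s ε 0 = 0)
    (hs : ∀ k, ∃ C > 0, ∀ ε ∈ Ioo (0 : ℝ) 1, |s ε k - ε * σ k| ≤ C * ε ^ 2)
    (ha : ∑ i ∈ Finset.range n, a (i + 1) = 0) :
    ∃ C > 0, ∃ ε₁ ∈ Ioo (0 : ℝ) 1, ∀ ε ∈ Ioo 0 ε₁, ∀ y ∈ Icc (0 : ℝ) 1, ∀ β, |β| ≤ B →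
      (∀ i ≤ n, |riccati y β (fun j => ε * a j) (s ε) i| ≤ 1 / 2) ∧
      |mismatch y β (fun j => ε * a j) (s ε) n
        - ((1 - y) - ε * ∑ i ∈ Finset.range n, σ (i + 1))| ≤ C * ε * (ε + (1 - y)) := by
  obtain ⟨C, hC, ε₁, hε₁, H⟩ := riccati_estimate a σ s B hB hs₀ hs n
  obtain ⟨D, hD, hsD⟩ := hs n
  refine ⟨C + (D + |σ n|), by positivity, ε₁, hε₁, fun ε hε y hy β hβ => ?_⟩
  obtain ⟨hi, -, h2⟩ := H ε hε y hy β hβ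
  refine ⟨hi, ?_⟩
  rw [ha] at h2
  have hε0 : 0 < ε := hε.1
  have hε1 : ε < 1 := hε.2.trans hε₁.2
  have hs1 : |s ε n| ≤ (D + |σ n|) * ε := by
    have : s ε n = (s ε n - ε * σ n) + ε * σ n := by ring
    rw [this]
    refine (abs_add_le _ _).trans ?_
    rw [abs_mul, abs_of_pos hε0]
    nlinarith [hsD ε ⟨hε0, hε1⟩, mul_pos hD hε0]
  have hy1 : 0 ≤ 1 - y := by linarith [hy.2]
  rw [mismatch]
  set g := riccati y β (fun j => ε * a j) (s ε) n
  rw [show 1 + g - y * (1 + s ε n) - ((1 - y) - ε * ∑ i ∈ Finset.range n, σ (i + 1))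
    = (g - s ε n - ε * (β * 0 - ∑ i ∈ Finset.range n, σ (i + 1))) + (1 - y) * s ε n by ring]
  refine (abs_add_le _ _).trans ?_
  rw [abs_mul, abs_of_nonneg hy1]
  have e1 : (1 - y) * |s ε n| ≤ (1 - y) * ((D + |σ n|) * ε) := mul_le_mul_of_nonneg_left hs1 hy1
  have e2 : 0 ≤ (D + |σ n|) * ε * ε := by positivity
  nlinarith

/-- If the first order effect is repulsive, the left and right decaying solutions never match. -/
lemma mismatch_pos (n : ℕ) (a σ : ℕ → ℝ) (s : ℝ → ℕ → ℝ) (B : ℝ) (hB : 0 ≤ B)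
    (hs₀ : ∀ ε, s ε 0 = 0)
    (hs : ∀ k, ∃ C > 0, ∀ ε ∈ Ioo (0 : ℝ) 1, |s ε k - ε * σ k| ≤ C * ε ^ 2)
    (ha : ∑ i ∈ Finset.range n, a (i + 1) = 0)
    (hκ : ∑ i ∈ Finset.range n, σ (i + 1) < 0) :
    ∃ ε₁ ∈ Ioo (0 : ℝ) 1, ∀ ε ∈ Ioo 0 ε₁, ∀ y ∈ Icc (0 : ℝ) 1, ∀ β, |β| ≤ B →
      (∀ i ≤ n, |riccati y β (fun j => ε * a j) (s ε) i| ≤ 1 / 2) ∧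
      0 < mismatch y β (fun j => ε * a j) (s ε) n := by
  obtain ⟨C, hC, ε₁, hε₁, H⟩ := mismatch_estimate n a σ s B hB hs₀ hs ha
  set κ := ∑ i ∈ Finset.range n, σ (i + 1)
  -- `ε C < 1` absorbs the error `C ε (1 - y)` into `1 - y`, and `ε C < -κ` absorbs `C ε²` into
  -- `-εκ`.
  refine ⟨min ε₁ (min (1 / C) (-κ / C)), ⟨lt_min hε₁.1 (lt_min (by positivity)
    (div_pos (by linarith) hC)), (min_le_left _ _).trans_lt hε₁.2⟩, fun ε hε y hy β hβ => ?_⟩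
  have hε0 : 0 < ε := hε.1
  obtain ⟨h, hs'⟩ := H ε ⟨hε0, hε.2.trans_le (min_le_left _ _)⟩ y hy β hβ
  refine ⟨h, ?_⟩
  have e1 : ε < 1 / C := hε.2.trans_le ((min_le_right _ _).trans (min_le_left _ _))
  have e2 : ε < -κ / C := hε.2.trans_le ((min_le_right _ _).trans (min_le_right _ _))
  rw [lt_div_iff₀ hC] at e1 e2
  have hy1 : 0 ≤ 1 - y := by linarith [hy.2]
  have h1 := (abs_le.1 hs').1
  have e3 : 0 ≤ (1 - y) * (1 - ε * C) := mul_nonneg hy1 (by linarith)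
  have e4 : 0 < ε * (-κ - ε * C) := mul_pos hε0 (by linarith)
  nlinarith

/-- If the first order effect is attractive, the mismatch is negative near the band edge, and it is
nonpositive only near the band edge. -/
lemma mismatch_sign (n : ℕ) (a σ : ℕ → ℝ) (s : ℝ → ℕ → ℝ) (B : ℝ) (hB : 0 ≤ B)
    (hs₀ : ∀ ε, s ε 0 = 0)
    (hs : ∀ k, ∃ C > 0, ∀ ε ∈ Ioo (0 : ℝ) 1, |s ε k - ε * σ k| ≤ C * ε ^ 2)
    (ha : ∑ i ∈ Finset.range n, a (i + 1) = 0)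
    (hκ : 0 < ∑ i ∈ Finset.range n, σ (i + 1)) (δ : ℝ) (hδ : 0 < δ) :
    ∃ ε₁ ∈ Ioo (0 : ℝ) 1, ∀ ε ∈ Ioo 0 ε₁, ∃ r > 0, ∀ y ∈ Icc (0 : ℝ) 1, ∀ β, |β| ≤ B →
      (∀ i ≤ n, |riccati y β (fun j => ε * a j) (s ε) i| ≤ 1 / 2) ∧
      (1 - y < r → mismatch y β (fun j => ε * a j) (s ε) n < 0) ∧
      (mismatch y β (fun j => ε * a j) (s ε) n ≤ 0 → 1 - y < δ) := by
  obtain ⟨C, hC, ε₁, hε₁, H⟩ := mismatch_estimate n a σ s B hB hs₀ hs ha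
  set κ := ∑ i ∈ Finset.range n, σ (i + 1)
  -- For `1 - y < εκ/4` the mismatch is below `(3/2)(1 - y) - (3/4) εκ < 0`. Conversely, a
  -- nonpositive mismatch forces `(1 - y)/2 ≤ ε (κ + C) < δ/2`.
  refine ⟨min ε₁ (min (1 / (2 * C)) (min (κ / (4 * C)) (δ / (2 * (κ + C))))),
    ⟨lt_min hε₁.1 (lt_min (by positivity) (lt_min (by positivity) (by positivity))),
      (min_le_left _ _).trans_lt hε₁.2⟩, fun ε hε => ⟨ε * κ / 4, ?_, fun y hy β hβ => ?_⟩⟩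
  · have := hε.1
    positivity
  have hε0 : 0 < ε := hε.1
  obtain ⟨h, hs'⟩ := H ε ⟨hε0, hε.2.trans_le (min_le_left _ _)⟩ y hy β hβ
  have hε1 : ε < 1 := (hε.2.trans_le (min_le_left _ _)).trans hε₁.2
  have e1 : ε < 1 / (2 * C) := hε.2.trans_le ((min_le_right _ _).trans (min_le_left _ _))
  have e2 : ε < κ / (4 * C) :=
    hε.2.trans_le ((min_le_right _ _).trans ((min_le_right _ _).trans (min_le_left _ _)))
  have e3 : ε < δ / (2 * (κ + C)) :=
    hε.2.trans_le ((min_le_right _ _).trans ((min_le_right _ _).trans (min_le_right _ _)))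
  rw [lt_div_iff₀ (by positivity)] at e1 e2 e3
  have hy1 : 0 ≤ 1 - y := by linarith [hy.2]
  have h1 := abs_le.1 hs'
  refine ⟨h, fun hr => ?_, fun hm => ?_⟩
  · have f1 : (1 - y) * (ε * C) ≤ (1 - y) * (1 / 2) :=
      mul_le_mul_of_nonneg_left (by linarith) hy1
    have f2 : ε * (ε * C) ≤ ε * (κ / 4) := mul_le_mul_of_nonneg_left (by linarith) hε0.le
    nlinarith [mul_pos hε0 hκ]
  · have f1 : (1 - y) * (ε * C) ≤ (1 - y) * (1 / 2) :=
      mul_le_mul_of_nonneg_left (by linarith) hy1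
    have f2 : C * ε * ε ≤ C * ε * 1 := mul_le_mul_of_nonneg_left hε1.le (by positivity)
    nlinarith

/-! ### The fundamental system of `-w'' = E w` -/

/-- The solution of `-w'' = E w` with `w(0) = 1`, `w'(0) = 0`. -/
noncomputable def cosE (E x : ℝ) : ℝ := Real.cos (√E * x) * Real.cosh (√(-E) * x)

/-- The solution of `-w'' = E w` with `w(0) = 0`, `w'(0) = 1`. -/
noncomputable def sinE (E x : ℝ) : ℝ :=
  x * dslope Real.sin 0 (√E * x) * dslope Real.sinh 0 (√(-E) * x)

/-- One of `√E`, `√(-E)` is always zero, so in `sinE` one `dslope` factor equals 1 and this identity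
evaluates the other. -/
lemma dslope_zero_mul {f : ℝ → ℝ} (hf : f 0 = 0) {k x : ℝ} (hk : k ≠ 0) :
    x * dslope f 0 (k * x) = f (k * x) / k := by
  rcases eq_or_ne x 0 with rfl | hx
  · simp [hf]
  · rw [dslope_of_ne _ (mul_ne_zero hk hx), slope_def_field, hf, sub_zero, sub_zero]
    field_simp

lemma dslope_sin_zero : dslope Real.sin 0 0 = 1 := by simp [dslope_same]

lemma dslope_sinh_zero : dslope Real.sinh 0 0 = 1 := by simp [dslope_same]

lemma cosE_of_pos {E : ℝ} (hE : 0 < E) (x : ℝ) : cosE E x = Real.cos (√E * x) := by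
  simp [cosE, Real.sqrt_eq_zero_of_nonpos (by linarith : -E ≤ 0)]

lemma sinE_of_pos {E : ℝ} (hE : 0 < E) (x : ℝ) : sinE E x = Real.sin (√E * x) / √E := by
  rw [sinE, Real.sqrt_eq_zero_of_nonpos (by linarith : -E ≤ 0), zero_mul, dslope_sinh_zero, mul_one,
    dslope_zero_mul Real.sin_zero (Real.sqrt_pos.2 hE).ne']

lemma cosE_of_neg {E : ℝ} (hE : E < 0) (x : ℝ) : cosE E x = Real.cosh (√(-E) * x) := by
  simp [cosE, Real.sqrt_eq_zero_of_nonpos hE.le]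

lemma sinE_of_neg {E : ℝ} (hE : E < 0) (x : ℝ) : sinE E x = Real.sinh (√(-E) * x) / √(-E) := by
  rw [sinE, Real.sqrt_eq_zero_of_nonpos hE.le, zero_mul, dslope_sin_zero, mul_one,
    dslope_zero_mul Real.sinh_zero (Real.sqrt_pos.2 (by linarith)).ne']

lemma cosE_zero_left (x : ℝ) : cosE 0 x = 1 := by simp [cosE]

lemma sinE_zero_left (x : ℝ) : sinE 0 x = x := by simp [sinE]

lemma cosE_zero (E : ℝ) : cosE E 0 = 1 := by simp [cosE]

lemma sinE_zero (E : ℝ) : sinE E 0 = 0 := by simp [sinE]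

lemma hasDerivAt_sinE (E x : ℝ) : HasDerivAt (sinE E) (cosE E x) x := by
  rcases lt_trichotomy E 0 with h | rfl | h
  · have hk : √(-E) ≠ 0 := (Real.sqrt_pos.2 (by linarith)).ne'
    rw [funext (sinE_of_neg h), cosE_of_neg h]
    have := (((hasDerivAt_id x).const_mul (√(-E))).sinh).div_const (√(-E))
    refine this.congr_deriv ?_
    simp only [id_eq]; field_simp
  · rw [funext sinE_zero_left, cosE_zero_left]
    exact hasDerivAt_id x
  · have hk : √E ≠ 0 := (Real.sqrt_pos.2 h).ne'
    rw [funext (sinE_of_pos h), cosE_of_pos h]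
    have := (((hasDerivAt_id x).const_mul (√E)).sin).div_const (√E)
    refine this.congr_deriv ?_
    simp only [id_eq]; field_simp

lemma hasDerivAt_cosE (E x : ℝ) : HasDerivAt (cosE E) (-E * sinE E x) x := by
  rcases lt_trichotomy E 0 with h | rfl | h
  · have hk : √(-E) ≠ 0 := (Real.sqrt_pos.2 (by linarith)).ne'
    rw [funext (cosE_of_neg h), sinE_of_neg h]
    have := (((hasDerivAt_id x).const_mul (√(-E))).cosh)
    refine this.congr_deriv ?_
    have e := Real.mul_self_sqrt (by linarith : 0 ≤ -E)
    simp only [id_eq]; field_simp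
    linear_combination Real.sinh (√(-E) * x) * e
  · rw [funext cosE_zero_left]
    simpa using hasDerivAt_const x (1 : ℝ)
  · have hk : √E ≠ 0 := (Real.sqrt_pos.2 h).ne'
    rw [funext (cosE_of_pos h), sinE_of_pos h]
    have := (((hasDerivAt_id x).const_mul (√E)).cos)
    refine this.congr_deriv ?_
    have e := Real.mul_self_sqrt h.le
    simp only [id_eq]; field_simp
    linear_combination -Real.sin (√E * x) * e

lemma cosE_sq_add (E x : ℝ) : cosE E x ^ 2 + E * sinE E x ^ 2 = 1 := by
  rcases lt_trichotomy E 0 with h | rfl | h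
  · have hk : √(-E) ≠ 0 := (Real.sqrt_pos.2 (by linarith)).ne'
    rw [cosE_of_neg h, sinE_of_neg h]
    have e := Real.sq_sqrt (by linarith : 0 ≤ -E)
    have hE := h.ne
    rw [div_pow, e, Real.cosh_sq]
    field_simp; ring
  · simp [cosE_zero_left]
  · rw [cosE_of_pos h, sinE_of_pos h, div_pow, Real.sq_sqrt h.le]
    have := Real.sin_sq_add_cos_sq (√E * x)
    field_simp; linarith

lemma continuous_cosE_left (x : ℝ) : Continuous fun E => cosE E x := by
  unfold cosE; fun_prop

/-- Writing `sin t / t` and `sinh t / t` as divided slopes makes continuity at `E = 0` automatic. -/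
lemma continuous_sinE_left (x : ℝ) : Continuous fun E => sinE E x := by
  have h1 : Continuous (dslope Real.sin 0) := by
    rw [← Real.sinc_eq_dslope]; exact Real.continuous_sinc
  have h2 : Continuous (dslope Real.sinh 0) :=
    continuous_iff_continuousAt.2 fun y => by
      rcases eq_or_ne y 0 with rfl | hy
      · exact continuousAt_dslope_same.2 Real.differentiable_sinh.differentiableAt
      · exact (continuousAt_dslope_of_ne hy).2 Real.continuous_sinh.continuousAt
  unfold sinE
  exact ((continuous_const.mul (h1.comp (by fun_prop))).mul (h2.comp (by fun_prop)))

/-- `cos (k π)` as a function of `E = k²`. -/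
noncomputable def cosPi (E : ℝ) : ℝ := cosE E π

/-- `sin (k π) / k` as a function of `E = k²`. -/
noncomputable def sinPi (E : ℝ) : ℝ := sinE E π

/-- Half the trace of the monodromy matrix: `cos (k π) + α / (4 k) sin (k π)`. -/
noncomputable def disc (α E : ℝ) : ℝ := cosPi E + α / 4 * sinPi E

lemma continuous_cosPi : Continuous cosPi := continuous_cosE_left π

lemma continuous_sinPi : Continuous sinPi := continuous_sinE_left π

lemma continuous_disc (α : ℝ) : Continuous (disc α) :=
  continuous_cosPi.add (continuous_const.mul continuous_sinPi)

/-! ### Monotonicity of the discriminant in the energy. -/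

lemma hasDerivAt_sqrt_mul {E : ℝ} (hE : 0 < E) :
    HasDerivAt (fun E => √E * π) (π / (2 * √E)) E :=
  ((Real.hasDerivAt_sqrt hE.ne').mul_const π).congr_deriv (by ring)

lemma hasDerivAt_sqrt_neg_mul {E : ℝ} (hE : E < 0) :
    HasDerivAt (fun E => √(-E) * π) (-π / (2 * √(-E))) E :=
  (((hasDerivAt_neg E).sqrt (by linarith)).mul_const π).congr_deriv (by ring)

lemma hasDerivAt_cosPi {E : ℝ} (hE : E ≠ 0) : HasDerivAt cosPi (-π * sinPi E / 2) E := by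
  rcases lt_or_gt_of_ne hE with h | h
  · have hk : √(-E) ≠ 0 := (Real.sqrt_pos.2 (by linarith)).ne'
    have hev : cosPi =ᶠ[nhds E] fun E => Real.cosh (√(-E) * π) := by
      filter_upwards [Iio_mem_nhds h] with y hy using cosE_of_neg hy π
    refine ((hasDerivAt_sqrt_neg_mul h).cosh.congr_of_eventuallyEq hev).congr_deriv ?_
    rw [sinPi, sinE_of_neg h]; field_simp
  · have hk : √E ≠ 0 := (Real.sqrt_pos.2 h).ne'
    have hev : cosPi =ᶠ[nhds E] fun E => Real.cos (√E * π) := by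
      filter_upwards [Ioi_mem_nhds h] with y hy using cosE_of_pos hy π
    refine ((hasDerivAt_sqrt_mul h).cos.congr_of_eventuallyEq hev).congr_deriv ?_
    rw [sinPi, sinE_of_pos h]; field_simp

lemma hasDerivAt_sinPi {E : ℝ} (hE : E ≠ 0) :
    HasDerivAt sinPi ((π * cosPi E - sinPi E) / (2 * E)) E := by
  rcases lt_or_gt_of_ne hE with h | h
  · have hk : √(-E) ≠ 0 := (Real.sqrt_pos.2 (by linarith)).ne'
    have hev : sinPi =ᶠ[nhds E] fun E => Real.sinh (√(-E) * π) / √(-E) := by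
      filter_upwards [Iio_mem_nhds h] with y hy using sinE_of_neg hy π
    have := (hasDerivAt_sqrt_neg_mul h).sinh.div ((hasDerivAt_neg E).sqrt (by linarith)) hk
    refine (this.congr_of_eventuallyEq hev).congr_deriv ?_
    have e := Real.sq_sqrt (by linarith : 0 ≤ -E)
    have e' : E = -√(-E) ^ 2 := by linarith
    rw [cosPi, cosE_of_neg h, sinPi, sinE_of_neg h]
    set k := √(-E)
    rw [e']
    field_simp; ring
  · have hk : √E ≠ 0 := (Real.sqrt_pos.2 h).ne'
    have hev : sinPi =ᶠ[nhds E] fun E => Real.sin (√E * π) / √E := by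
      filter_upwards [Ioi_mem_nhds h] with y hy using sinE_of_pos hy π
    have := (hasDerivAt_sqrt_mul h).sin.div (Real.hasDerivAt_sqrt h.ne') hk
    refine (this.congr_of_eventuallyEq hev).congr_deriv ?_
    have e' : E = √E ^ 2 := (Real.sq_sqrt h.le).symm
    rw [cosPi, cosE_of_pos h, sinPi, sinE_of_pos h]
    set k := √E
    rw [e']
    field_simp

lemma abs_sinPi_lt {E : ℝ} (h : 0 < E) : |sinPi E| < π := by
  have hk : 0 < √E := Real.sqrt_pos.2 h
  have hx : 0 < √E * π := mul_pos hk Real.pi_pos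
  rw [sinPi, sinE_of_pos h, abs_div, abs_of_pos hk, div_lt_iff₀ hk, mul_comm π]
  refine abs_lt.2 ⟨?_, Real.sin_lt hx⟩
  have := Real.sin_lt (x := √E * π) hx
  have h2 := Real.lt_sin (x := -(√E * π)) (by linarith)
  rw [Real.sin_neg] at h2
  rcases le_or_gt (√E * π) 1 with h3 | h3
  · linarith [Real.sin_pos_of_pos_of_le_one hx h3]
  · linarith [Real.neg_one_le_sin (√E * π)]

lemma abs_cosPi_le {E : ℝ} (h : 0 < E) : |cosPi E| ≤ 1 := by
  rw [cosPi, cosE_of_pos h]; exact Real.abs_cos_le_one _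

lemma lt_sinPi {E : ℝ} (h : E < 0) : π < sinPi E := by
  have hk : 0 < √(-E) := Real.sqrt_pos.2 (by linarith)
  rw [sinPi, sinE_of_neg h, lt_div_iff₀ hk, mul_comm]
  exact Real.self_lt_sinh_iff.2 (mul_pos hk Real.pi_pos)

lemma one_lt_cosPi {E : ℝ} (h : E < 0) : 1 < cosPi E := by
  have hk : 0 < √(-E) := Real.sqrt_pos.2 (by linarith)
  rw [cosPi, cosE_of_neg h]
  exact Real.one_lt_cosh.2 (mul_pos hk Real.pi_pos).ne'

lemma disc_sub_div (α v E : ℝ) (h : sinPi E ≠ 0) :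
    (disc α E - v) / sinPi E = (cosPi E - v) / sinPi E + α / 4 := by
  rw [disc]; field_simp; ring

/-- By `C² + E S² = 1`, the numerator of the derivative is affine in `v` and splits into its values
at `v = 1` and `v = -1`. Both have a definite sign, because `|S| < π` and `|C| ≤ 1` for `E > 0`,
while `S > π` and `C > 1` for `E < 0`. -/
lemma deriv_cosPi_sub_div_neg {v E : ℝ} (hv : |v| < 1) (hE : E ≠ 0) (hS : sinPi E ≠ 0) :
    deriv (fun E => (cosPi E - v) / sinPi E) E < 0 := by
  have hd := ((hasDerivAt_cosPi hE).sub_const v).div (hasDerivAt_sinPi hE) hS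
  have hd' := hd.deriv
  simp only [Pi.div_def] at hd'
  rw [hd']
  have h1 := cosE_sq_add E π
  have hcs : cosPi E ^ 2 + E * sinPi E ^ 2 = 1 := h1
  obtain ⟨hv1, hv2⟩ := abs_lt.1 hv
  refine div_neg_of_neg_of_pos ?_ (by positivity)
  have key : -π * sinPi E / 2 * sinPi E - (cosPi E - v) * ((π * cosPi E - sinPi E) / (2 * E))
      = ((1 + v) / 2 * ((cosPi E - 1) * (sinPi E + π))
        + (1 - v) / 2 * ((cosPi E + 1) * (sinPi E - π))) / (2 * E) := by
    field_simp
    linear_combination (-2 * π) * hcs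
  rw [key]
  rcases lt_or_gt_of_ne hE with h | h
  · refine div_neg_of_pos_of_neg ?_ (by linarith)
    have := lt_sinPi h
    have := one_lt_cosPi h
    have p1 : 0 < (cosPi E - 1) * (sinPi E + π) := mul_pos (by linarith) (by linarith [Real.pi_pos])
    have p2 : 0 < (cosPi E + 1) * (sinPi E - π) := mul_pos (by linarith) (by linarith [Real.pi_pos])
    have p3 := mul_pos (by linarith : 0 < (1 + v) / 2) p1
    have p4 := mul_pos (by linarith : 0 < (1 - v) / 2) p2
    linarith
  · refine div_neg_of_neg_of_pos ?_ (by linarith)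
    obtain ⟨s1, s2⟩ := abs_lt.1 (abs_sinPi_lt h)
    obtain ⟨c1, c2⟩ := abs_le.1 (abs_cosPi_le h)
    have p3 := mul_nonneg (by linarith : 0 ≤ 1 + v)
      (mul_nonneg (by linarith : 0 ≤ 1 - cosPi E) (by linarith : 0 ≤ sinPi E + π))
    have p4 := mul_nonneg (by linarith : 0 ≤ 1 - v)
      (mul_nonneg (by linarith : 0 ≤ cosPi E + 1) (by linarith : 0 ≤ π - sinPi E))
    rcases lt_or_ge (cosPi E) 1 with hlt | hge
    · have p3' := mul_pos (by linarith : 0 < 1 + v)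
        (mul_pos (by linarith : 0 < 1 - cosPi E) (by linarith : 0 < sinPi E + π))
      linarith
    · have p4' := mul_pos (by linarith : 0 < 1 - v)
        (mul_pos (by linarith : 0 < cosPi E + 1) (by linarith : 0 < π - sinPi E))
      linarith

lemma cosPi_sub_div_lt {v x y : ℝ} (hv : |v| < 1) (hxy : x < y)
    (hS : ∀ E ∈ Icc x y, sinPi E ≠ 0) :
    (cosPi y - v) / sinPi y < (cosPi x - v) / sinPi x := by
  have main : ∀ x y : ℝ, x < y → (∀ E ∈ Icc x y, sinPi E ≠ 0) → (0 ≤ x ∨ y ≤ 0) →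
      (cosPi y - v) / sinPi y < (cosPi x - v) / sinPi x := by
    intro x y hxy hS h0
    have := strictAntiOn_of_deriv_neg (convex_Icc x y)
      (f := fun E => (cosPi E - v) / sinPi E)
      (((continuous_cosPi.sub continuous_const).continuousOn).div continuous_sinPi.continuousOn hS)
      (fun E hE => by
        rw [interior_Icc] at hE
        refine deriv_cosPi_sub_div_neg hv ?_ (hS E (Ioo_subset_Icc_self hE))
        rcases h0 with h0 | h0
        · exact (h0.trans_lt hE.1).ne'
        · exact (hE.2.trans_le h0).ne)
    exact this (left_mem_Icc.2 hxy.le) (right_mem_Icc.2 hxy.le) hxy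
  -- The derivative formula divides by `E`, so an interval containing zero in its interior is cut
  -- there.
  rcases le_or_gt 0 x with h | h
  · exact main x y hxy hS (Or.inl h)
  rcases le_or_gt y 0 with h' | h'
  · exact main x y hxy hS (Or.inr h')
  · exact (main 0 y h' (fun E hE => hS E ⟨h.le.trans hE.1, hE.2⟩) (Or.inl le_rfl)).trans
      (main x 0 h (fun E hE => hS E ⟨hE.1, hE.2.trans h'.le⟩) (Or.inr le_rfl))

/-- The discriminant is strictly monotone inside the bands. -/
lemma disc_sub_div_lt (α : ℝ) {v x y : ℝ} (hv : |v| < 1) (hxy : x < y)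
    (hS : ∀ E ∈ Icc x y, sinPi E ≠ 0) :
    (disc α y - v) / sinPi y < (disc α x - v) / sinPi x := by
  rw [disc_sub_div _ _ _ (hS y (right_mem_Icc.2 hxy.le)),
    disc_sub_div _ _ _ (hS x (left_mem_Icc.2 hxy.le))]
  linarith [cosPi_sub_div_lt hv hxy hS]

/-! ### Dirichlet points and the size of the discriminant. -/

lemma cosPi_natCast_sq (m : ℕ) : cosPi ((m : ℝ) ^ 2) = (-1) ^ m := by
  rcases Nat.eq_zero_or_pos m with rfl | hm
  · simp [cosPi, cosE_zero_left]
  · have : (0 : ℝ) < (m : ℝ) ^ 2 := by positivity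
    rw [cosPi, cosE_of_pos this, Real.sqrt_sq (by positivity), Real.cos_nat_mul_pi]

lemma sinPi_natCast_sq {m : ℕ} (hm : 1 ≤ m) : sinPi ((m : ℝ) ^ 2) = 0 := by
  have : (0 : ℝ) < (m : ℝ) ^ 2 := by positivity
  rw [sinPi, sinE_of_pos this, Real.sqrt_sq (by positivity), Real.sin_nat_mul_pi, zero_div]

lemma sinPi_pos_of_lt_one {E : ℝ} (h : E < 1) : 0 < sinPi E := by
  rcases lt_trichotomy E 0 with h0 | rfl | h0
  · exact Real.pi_pos.trans (lt_sinPi h0)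
  · rw [sinPi, sinE_zero_left]; exact Real.pi_pos
  · have hk : 0 < √E := Real.sqrt_pos.2 h0
    have hk1 : √E < 1 := by rw [Real.sqrt_lt' one_pos]; simpa using h
    rw [sinPi, sinE_of_pos h0]
    refine div_pos (Real.sin_pos_of_pos_of_lt_pi (mul_pos hk Real.pi_pos) ?_) hk
    nlinarith [Real.pi_pos]

lemma sinPi_sign {E : ℝ} {m : ℕ} (hm : (m : ℝ) ^ 2 < E) (hm' : E < ((m : ℝ) + 1) ^ 2) :
    0 < (-1) ^ m * sinPi E := by
  have h0 : 0 < E := (sq_nonneg _).trans_lt hm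
  have hk : 0 < √E := Real.sqrt_pos.2 h0
  have h1 : (m : ℝ) < √E := Real.lt_sqrt_of_sq_lt hm
  have h2 : √E < m + 1 := by rwa [Real.sqrt_lt' (by positivity)]
  rw [sinPi, sinE_of_pos h0, ← mul_div_assoc]
  refine div_pos ?_ hk
  have : (-1) ^ m * Real.sin (√E * π) = Real.sin (√E * π - m * π) := by
    rw [Real.sin_sub_nat_mul_pi]
  rw [this]
  refine Real.sin_pos_of_pos_of_lt_pi ?_ ?_ <;> nlinarith [Real.pi_pos]

/-- For `κ ≥ 1` and `κ ≥ |α|`, `sinh < cosh` gives `κ S ≤ C`, so the coupling term costs at most a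
quarter of `C`, and `C ≥ S > π > 3`. -/
lemma one_le_disc {α κ : ℝ} (h1 : 1 ≤ κ) (hα : |α| ≤ κ) :
    1 ≤ disc α (-κ ^ 2) ∧ sinPi (-κ ^ 2) ≤ 4 / 3 * disc α (-κ ^ 2) := by
  have hneg : -κ ^ 2 < 0 := by nlinarith
  have hs : √(- -κ ^ 2) = κ := by rw [neg_neg]; exact Real.sqrt_sq (by linarith)
  have hpi := Real.pi_gt_three
  have hS : 0 < sinPi (-κ ^ 2) := Real.pi_pos.trans (lt_sinPi hneg)
  have hC : cosPi (-κ ^ 2) = Real.cosh (κ * π) := by rw [cosPi, cosE_of_neg hneg, hs]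
  have hS' : sinPi (-κ ^ 2) = Real.sinh (κ * π) / κ := by rw [sinPi, sinE_of_neg hneg, hs]
  have hk : 0 < κ := by linarith
  have hsc : κ * sinPi (-κ ^ 2) ≤ cosPi (-κ ^ 2) := by
    rw [hC, hS', mul_div_cancel₀ _ hk.ne']; exact (Real.sinh_lt_cosh _).le
  have hα' : -κ * sinPi (-κ ^ 2) ≤ α * sinPi (-κ ^ 2) :=
    mul_le_mul_of_nonneg_right (by linarith [(abs_le.1 hα).1]) hS.le
  have hge : 3 / 4 * cosPi (-κ ^ 2) ≤ disc α (-κ ^ 2) := by rw [disc]; linarith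
  have hge2 : sinPi (-κ ^ 2) ≤ cosPi (-κ ^ 2) := by nlinarith
  have := lt_sinPi hneg
  constructor <;> linarith

lemma exists_disc_large (α x : ℝ) : ∃ l < x, 1 ≤ disc α l := by
  refine ⟨-(max 1 (max |α| (|x| + 1))) ^ 2, ?_, (one_le_disc (le_max_left _ _)
    ((le_max_left _ _).trans (le_max_right _ _))).1⟩
  have h1 : |x| + 1 ≤ max 1 (max |α| (|x| + 1)) := (le_max_right _ _).trans (le_max_right _ _)
  have h2 : 1 ≤ max 1 (max |α| (|x| + 1)) := le_max_left _ _
  have := neg_abs_le x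
  nlinarith

/-- Three ranges: `one_le_disc` far below zero, compactness on the remaining nonpositive energies,
and `|S| < π` for positive ones. The result is one constant for all gaps. -/
lemma abs_sinPi_le_mul_disc (α : ℝ) {c : ℝ} (hc : 0 < c) :
    ∃ B, 0 ≤ B ∧ ∀ E, c ≤ |disc α E| → |sinPi E| ≤ B * |disc α E| := by
  set κ₀ := max 1 |α|
  obtain ⟨M, hM⟩ := (isCompact_Icc (a := -κ₀ ^ 2) (b := 0)).exists_bound_of_continuousOn
    (continuous_sinPi.continuousOn)
  set M' := max (max M π) 0
  refine ⟨max (M' / c) (4 / 3), le_max_of_le_right (by norm_num), fun E hE => ?_⟩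
  rcases lt_or_ge E (-κ₀ ^ 2) with h | h
  · have hE0 : E < 0 := by nlinarith [sq_nonneg κ₀]
    have hk : κ₀ ≤ √(-E) := Real.le_sqrt_of_sq_le (by linarith)
    have := (one_le_disc (α := α) ((le_max_left _ _).trans hk) ((le_max_right _ _).trans hk)).2
    rw [Real.sq_sqrt (by linarith), neg_neg] at this
    rw [abs_of_pos (Real.pi_pos.trans (lt_sinPi hE0))]
    refine (this.trans (mul_le_mul_of_nonneg_left (le_abs_self _) (by norm_num))).trans ?_
    exact mul_le_mul_of_nonneg_right (le_max_right _ _) (abs_nonneg _)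
  · have hb : |sinPi E| ≤ M' := by
      rcases le_or_gt E 0 with h0 | h0
      · exact (hM E ⟨h, h0⟩).trans ((le_max_left _ _).trans (le_max_left _ _))
      · exact (abs_sinPi_lt h0).le.trans ((le_max_right _ _).trans (le_max_left _ _))
    have hM0 : 0 ≤ M' := le_max_right _ _
    calc |sinPi E| ≤ M' := hb
      _ = M' / c * c := by field_simp
      _ ≤ max (M' / c) (4 / 3) * |disc α E| :=
        mul_le_mul (le_max_left _ _) hE hc.le (le_max_of_le_right (by norm_num))

/-- Every point off the Dirichlet spectrum lies in an interval along which the discriminant passes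
from near `±1` to near `∓1`. -/
lemma exists_span (α : ℝ) {x b : ℝ} (hx : sinPi x ≠ 0) (hb : b < 1) :
    ∃ p : ℝ, (p = 1 ∨ p = -1) ∧ ∃ l r, l < x ∧ x < r ∧ (∀ E ∈ Icc l r, 0 < p * sinPi E) ∧
      b ≤ p * disc α l ∧ p * disc α r ≤ -b := by
  have hval : ∀ m : ℕ, 1 ≤ m → disc α ((m : ℝ) ^ 2) = (-1) ^ m := fun m hm => by
    rw [disc, cosPi_natCast_sq, sinPi_natCast_sq hm, mul_zero, add_zero]
  have hp : ∀ m : ℕ, ((-1 : ℝ) ^ m = 1 ∨ (-1 : ℝ) ^ m = -1) := fun m => neg_one_pow_eq_or ℝ m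
  have hpp : ∀ m : ℕ, ((-1 : ℝ) ^ m * (-1) ^ m = 1) := fun m => by
    rw [← mul_pow]; norm_num
  have hright : ∀ m : ℕ, x < ((m : ℝ) + 1) ^ 2 →
      ∃ r, x < r ∧ r < ((m : ℝ) + 1) ^ 2 ∧ (-1) ^ m * disc α r ≤ -b := by
    intro m hxm
    have hc : ContinuousAt (fun E => (-1 : ℝ) ^ m * disc α E) (((m : ℝ) + 1) ^ 2) :=
      (continuous_const.mul (continuous_disc α)).continuousAt
    have hv : (-1 : ℝ) ^ m * disc α (((m : ℝ) + 1) ^ 2) < -b := by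
      have := hval (m + 1) (by omega)
      push_cast at this
      rw [this, pow_succ, ← mul_assoc, hpp]; linarith
    have h1 := (hc.eventually_lt_const hv).filter_mono
      (nhdsWithin_le_nhds (s := Iio (((m : ℝ) + 1) ^ 2)))
    obtain ⟨r, hr, hr'⟩ := (h1.and (Ioo_mem_nhdsLT hxm)).exists
    exact ⟨r, hr'.1, hr'.2, hr.le⟩
  -- Below 1 the left end comes from the growth of `disc` at `-∞`. Otherwise `m² < x < (m+1)²` for
  -- some `m ≥ 1`, where `disc` equals `(-1)^m` and `-(-1)^m` at the two ends. The endpoints are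
  -- taken slightly inside, since `sinPi` vanishes at the squares; this is where `b < 1` is needed.
  rcases lt_or_ge x 1 with h | h
  · obtain ⟨l, hl, hl'⟩ := exists_disc_large α x
    obtain ⟨r, hr, hr1, hr'⟩ := hright 0 (by simpa using h)
    refine ⟨1, Or.inl rfl, l, r, hl, hr, fun E hE => ?_, by linarith, by simpa using hr'⟩
    rw [one_mul]
    exact sinPi_pos_of_lt_one (hE.2.trans_lt (by simpa using hr1))
  · set m := ⌊√x⌋₊
    have hs1 : 1 ≤ √x := Real.one_le_sqrt.2 h
    have hm1 : 1 ≤ m := Nat.le_floor (by simpa using hs1)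
    have hmle : (m : ℝ) ≤ √x := Nat.floor_le (Real.sqrt_nonneg _)
    have hmx : (m : ℝ) ^ 2 ≤ x := (Real.le_sqrt (by positivity) (by linarith)).1 hmle
    have hmx' : x < ((m : ℝ) + 1) ^ 2 := by
      rw [← Real.sqrt_lt' (by positivity)]; exact Nat.lt_floor_add_one _
    have hmlt : (m : ℝ) ^ 2 < x := by
      refine lt_of_le_of_ne hmx fun h => hx ?_
      rw [← h]; exact sinPi_natCast_sq hm1
    obtain ⟨r, hr, hr1, hr'⟩ := hright m hmx'
    have hc : ContinuousAt (fun E => (-1 : ℝ) ^ m * disc α E) ((m : ℝ) ^ 2) :=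
      (continuous_const.mul (continuous_disc α)).continuousAt
    have hv : b < (-1 : ℝ) ^ m * disc α ((m : ℝ) ^ 2) := by
      rw [hval m hm1, hpp]; exact hb
    have h1 := (hc.eventually_const_lt hv).filter_mono
      (nhdsWithin_le_nhds (s := Ioi ((m : ℝ) ^ 2)))
    obtain ⟨l, hl, hl'⟩ := (h1.and (Ioo_mem_nhdsGT hmlt)).exists
    exact ⟨(-1) ^ m, hp m, l, r, hl'.2, hr, fun E hE =>
      sinPi_sign (hl'.1.trans_le hE.1) (hE.2.trans_lt hr1), hl.le, hr'⟩

/-! ### Decaying solutions of the difference equation -/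

lemma eq_zero_of_expanding {w : ℕ → ℂ} {x : ℂ} (hx : 1 ≤ ‖x‖) (hw : ∀ k, w (k + 1) = x * w k)
    (h0 : Tendsto w atTop (𝓝 0)) : w 0 = 0 := by
  have h : ∀ k, ‖w 0‖ ≤ ‖w k‖ := by
    intro k
    induction k with
    | zero => exact le_rfl
    | succ k ih =>
      rw [hw, norm_mul]
      nlinarith [norm_nonneg (w k)]
  have h1 := ge_of_tendsto' h0.norm h
  rw [norm_zero] at h1
  exact norm_le_zero_iff.1 h1

lemma tendsto_left {ψ : ℤ → ℂ} (hψ : Tendsto ψ cofinite (𝓝 0)) (j : ℤ) :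
    Tendsto (fun k : ℕ => ψ (j - k)) atTop (𝓝 0) := by
  have : Function.Injective fun k : ℕ => j - (k : ℤ) := fun a b h => by simpa using h
  rw [← Nat.cofinite_eq_atTop]
  exact hψ.comp this.tendsto_cofinite

/-- A solution of the free equation that decays to the left. -/
lemma left_decaying {ψ : ℤ → ℂ} {x : ℂ} (hx : 1 ≤ ‖x‖) (hψ : Tendsto ψ cofinite (𝓝 0)) {N : ℤ}
    (h : ∀ j ≤ N, ψ (j + 1) + ψ (j - 1) = (x + x⁻¹) * ψ j) {j : ℤ} (hj : j ≤ N) :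
    ψ (j + 1) = x * ψ j := by
  have hx0 : x ≠ 0 := norm_pos_iff.1 (by linarith)
  -- `ψ(i+1) - x ψ(i)` isolates the component along the solution `x^{-i}`. It is multiplied by `x`
  -- at each step to the left, so decay forces it to vanish.
  have hw := eq_zero_of_expanding (w := fun k : ℕ => ψ (j - k + 1) - x * ψ (j - k)) hx
    (fun k => ?_) ?_
  · simpa [sub_eq_zero] using hw
  · have := h (j - k) (by omega)
    have e1 : j - ((k + 1 : ℕ) : ℤ) + 1 = j - k := by push_cast; ring
    have e2 : j - ((k + 1 : ℕ) : ℤ) = j - k - 1 := by push_cast; ring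
    simp only [e1]
    rw [e2]
    field_simp at this
    linear_combination -this
  · have h1 := tendsto_left hψ (j + 1)
    have h2 := (tendsto_left hψ j).const_mul x
    have := h1.sub h2
    simp only [mul_zero, sub_zero] at this
    refine this.congr fun k => ?_
    rw [show j + 1 - (k : ℤ) = j - k + 1 by ring]

/-- A solution of the free equation that decays to the right. -/
lemma right_decaying {ψ : ℤ → ℂ} {x : ℂ} (hx : 1 ≤ ‖x‖) (hψ : Tendsto ψ cofinite (𝓝 0)) {N : ℤ}
    (h : ∀ j ≥ N, ψ (j + 1) + ψ (j - 1) = (x + x⁻¹) * ψ j) {j : ℤ} (hj : N ≤ j) :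
    ψ (j - 1) = x * ψ j := by
  have := left_decaying (ψ := fun j => ψ (-j)) hx (hψ.comp neg_injective.tendsto_cofinite)
    (N := -N) (fun j hj => ?_) (neg_le_neg hj)
  · simpa [show -(-j + 1) = j - 1 by ring] using this
  · have := h (-j) (by omega)
    rw [show -(j + 1) = -j - 1 by ring, show -(j - 1) = -j + 1 by ring, add_comm, this]

/-- For a unimodular root both characteristic modes keep constant modulus, so nothing decays: after
`left_decaying` the surviving mode is killed by the same argument with `x⁻¹`. -/
lemma left_decaying_eq_zero {ψ : ℤ → ℂ} {x : ℂ} (hx : ‖x‖ = 1) (hψ : Tendsto ψ cofinite (𝓝 0))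
    {N : ℤ} (h : ∀ j ≤ N, ψ (j + 1) + ψ (j - 1) = (x + x⁻¹) * ψ j) {j : ℤ} (hj : j ≤ N) :
    ψ (j + 1) = 0 := by
  have hx0 : x ≠ 0 := norm_pos_iff.1 (by linarith)
  suffices h' : (fun k : ℕ => ψ (j + 1 - k)) 0 = 0 by simpa using h'
  refine eq_zero_of_expanding (x := x⁻¹) (by simp [hx]) (fun k => ?_) (tendsto_left hψ _)
  have := left_decaying hx.ge hψ h (j := j - k) (by omega)
  rw [show j + 1 - (k : ℤ) = j - k + 1 by ring, this,
    show j + 1 - ((k + 1 : ℕ) : ℤ) = j - k by push_cast; ring]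
  field_simp

lemma right_decaying_eq_zero {ψ : ℤ → ℂ} {x : ℂ} (hx : ‖x‖ = 1) (hψ : Tendsto ψ cofinite (𝓝 0))
    {N : ℤ} (h : ∀ j ≥ N, ψ (j + 1) + ψ (j - 1) = (x + x⁻¹) * ψ j) {j : ℤ} (hj : N ≤ j) :
    ψ (j - 1) = 0 := by
  have := left_decaying_eq_zero (ψ := fun j => ψ (-j)) hx
    (hψ.comp neg_injective.tendsto_cofinite) (N := -N) (fun j hj => ?_) (neg_le_neg hj)
  · simpa [show -(-j + 1) = j - 1 by ring] using this
  · have := h (-j) (by omega)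
    rw [show -(j + 1) = -j - 1 by ring, show -(j - 1) = -j + 1 by ring, add_comm, this]

/-- Forward uniqueness for three term recursions. -/
lemma eq_zero_forward {ψ : ℤ → ℂ} {c ξ : ℤ → ℂ} {L M : ℤ} (hc : ∀ j, c j ≠ 0)
    (h : ∀ j < M, c j * ψ (j + 1) + c (j - 1) * ψ (j - 1) = ξ j * ψ j)
    (hL : ∀ j ≤ L, ψ j = 0) (j : ℤ) (hj : j ≤ M) : ψ j = 0 := by
  have key : ∀ k : ℕ, ∀ i ≤ L + k, i ≤ M → ψ i = 0 := by
    intro k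
    induction k with
    | zero => exact fun i hi _ => hL i (by simpa using hi)
    | succ k ih =>
      intro i hi hiM
      rcases Int.lt_or_le (L + k) i with h' | h'
      · have h1 := ih (i - 1) (by push_cast at hi; omega) (by omega)
        have h2 := ih (i - 1 - 1) (by push_cast at hi; omega) (by omega)
        have := h (i - 1) (by omega)
        rw [h1, h2, show i - 1 + 1 = i by ring, mul_zero, mul_zero, add_zero] at this
        exact (mul_eq_zero.1 this).resolve_left (hc _)
      · exact ih i h' hiM
  exact key (j - L).toNat j (by omega) hj

/-- The locally perturbed chain in the gap parametrized by `x + 1/x`, `|x| > 1`. -/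
structure ChainData (n : ℕ) (x β : ℝ) (t e : ℤ → ℝ) (a s : ℕ → ℝ) : Prop where
  hx : 1 < |x|
  t_pos : ∀ j, 0 < t j
  t_out : ∀ j : ℤ, j ≤ 0 ∨ (n : ℤ) < j → t j = 1
  e_out : ∀ j : ℤ, j ≤ 0 ∨ (n : ℤ) < j → e j = 0
  e_eq : ∀ k < n, e ((k + 1 : ℕ) : ℤ) = a (k + 1) * β
  s_eq : ∀ k ≤ n, s k = t (k : ℤ) ^ 2 - 1

namespace ChainData

variable {n : ℕ} {x β : ℝ} {t e : ℤ → ℝ} {a s : ℕ → ℝ}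

lemma x_ne (h : ChainData n x β t e a s) : x ≠ 0 :=
  abs_pos.1 (one_pos.trans h.hx)

/-- `x (1 + g_k)` stands for `t_k ψ(k+1) / ψ(k)`; this is the three-term recursion divided by
`ψ(k+1)`, using `s_k = t_k² - 1`. -/
lemma riccati_step (h : ChainData n x β t e a s) {k : ℕ} (hk : k < n)
    (hg : 1 + riccati (x ^ 2)⁻¹ β a s k ≠ 0) :
    x * (1 + riccati (x ^ 2)⁻¹ β a s (k + 1))
      = x + x⁻¹ + x * e ((k + 1 : ℕ) : ℤ)
        - t k ^ 2 / (x * (1 + riccati (x ^ 2)⁻¹ β a s k)) := by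
  have hx0 := h.x_ne
  rw [riccati, h.e_eq k hk, h.s_eq k hk.le]
  generalize riccati (x ^ 2)⁻¹ β a s k = g at *
  field_simp
  ring

lemma forward (h : ChainData n x β t e a s)
    (hg : ∀ k ≤ n, 1 + riccati (x ^ 2)⁻¹ β a s k ≠ 0) {ψ : ℤ → ℂ}
    (hψ : Tendsto ψ cofinite (𝓝 0))
    (heq : ∀ j, t j * ψ (j + 1) + t (j - 1) * ψ (j - 1) = (x + x⁻¹ + x * e j : ℝ) * ψ j)
    (k : ℕ) (hk : k ≤ n) :
    t k * ψ (k + 1) = (x * (1 + riccati (x ^ 2)⁻¹ β a s k) : ℝ) * ψ k := by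
  have hx0 := h.x_ne
  induction k with
  | zero =>
    have := left_decaying (x := (x : ℂ)) (N := 0) (by simpa using h.hx.le) hψ (fun j hj => ?_)
      (le_refl 0)
    · simpa [riccati, h.t_out 0 (Or.inl le_rfl)] using this
    · have := heq j
      rw [h.t_out j (Or.inl hj), h.t_out (j - 1) (Or.inl (by omega)), h.e_out j (Or.inl hj)] at this
      push_cast at this
      simpa using this
  | succ k ih =>
    have ih := ih (by omega)
    have hgk := hg k (by omega)
    have hrec := heq ((k + 1 : ℕ) : ℤ)
    rw [h.riccati_step (by omega) hgk]
    have e1 : ((k + 1 : ℕ) : ℤ) - 1 = k := by push_cast; ring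
    rw [e1] at hrec
    have hgk' : (x : ℂ) * (1 + (riccati (x ^ 2)⁻¹ β a s k : ℂ)) ≠ 0 := by
      have := mul_ne_zero hx0 hgk
      exact_mod_cast this
    push_cast at hrec ih ⊢
    generalize (riccati (x ^ 2)⁻¹ β a s k : ℂ) = g at *
    have e2 : ψ k = t k * ψ (k + 1) / (x * (1 + g)) := by
      rw [ih, mul_div_cancel_left₀ _ hgk']
    rw [e2] at hrec
    linear_combination hrec

/-- A nonzero decaying solution forces the mismatch to vanish. -/
lemma mismatch_eq_zero (h : ChainData n x β t e a s)
    (hg : ∀ k ≤ n, 1 + riccati (x ^ 2)⁻¹ β a s k ≠ 0) {ψ : ℤ → ℂ}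
    (hψ : Tendsto ψ cofinite (𝓝 0))
    (heq : ∀ j, t j * ψ (j + 1) + t (j - 1) * ψ (j - 1) = (x + x⁻¹ + x * e j : ℝ) * ψ j)
    (h0 : ψ 0 ≠ 0) : mismatch (x ^ 2)⁻¹ β a s n = 0 := by
  have hx0 := h.x_ne
  have hfw := h.forward hg hψ heq
  have hne : ∀ k : ℕ, k ≤ n + 1 → ψ k ≠ 0 := by
    intro k
    induction k with
    | zero => exact fun _ => h0
    | succ k ih =>
      intro hk hz
      have h1 := hfw k (by omega)
      push_cast at hz
      rw [hz, mul_zero] at h1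
      have := mul_ne_zero (Complex.ofReal_ne_zero.2 (mul_ne_zero hx0 (hg k (by omega))))
        (ih (by omega))
      exact this h1.symm
  have hr := right_decaying (x := (x : ℂ)) (N := (n : ℤ) + 2) (by simpa using h.hx.le) hψ
    (fun j hj => ?_) (le_refl _)
  · have h1 := heq (n + 1)
    have h2 := hfw n le_rfl
    have h3 := hne (n + 1) le_rfl
    rw [h.t_out (n + 1) (Or.inr (by omega)), h.e_out (n + 1) (Or.inr (by omega)),
      show (n : ℤ) + 1 - 1 = n by ring, show (n : ℤ) + 1 + 1 = n + 2 by ring] at h1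
    rw [show (n : ℤ) + 2 - 1 = n + 1 by ring] at hr
    push_cast at h1 h2 h3
    have hxC : (x : ℂ) ≠ 0 := Complex.ofReal_ne_zero.2 hx0
    have h4 : (t n : ℂ) * ψ n = x * ψ (n + 1) := by
      have : ψ (n + 2) = (x : ℂ)⁻¹ * ψ (n + 1) := by rw [hr]; field_simp
      rw [this] at h1
      linear_combination h1
    have h5 : (t n : ℂ) ^ 2 * ψ (n + 1)
        = (x : ℂ) ^ 2 * (1 + (riccati (x ^ 2)⁻¹ β a s n : ℂ)) * ψ (n + 1) := by
      linear_combination (t n : ℂ) * h2 + (x : ℂ) * (1 + (riccati (x ^ 2)⁻¹ β a s n : ℂ)) * h4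
    have h6 := mul_right_cancel₀ h3 h5
    have h7 : t n ^ 2 = x ^ 2 * (1 + riccati (x ^ 2)⁻¹ β a s n) := by exact_mod_cast h6
    rw [mismatch, h.s_eq n le_rfl]
    rw [add_sub_cancel, h7]
    field_simp; ring
  · have := heq j
    rw [h.t_out j (Or.inr (by omega)), h.t_out (j - 1) (Or.inr (by omega)),
      h.e_out j (Or.inr (by omega))] at this
    push_cast at this
    simpa using this

/-- The decaying solution on the left is geometric, hence fixed by its value at 0, and the recursion
continues it uniquely to the right. This yields simplicity of eigenvalues and does not involve the
mismatch. -/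
lemma eq_zero_of_apply_zero (h : ChainData n x β t e a s) {ψ : ℤ → ℂ}
    (hψ : Tendsto ψ cofinite (𝓝 0))
    (heq : ∀ j, t j * ψ (j + 1) + t (j - 1) * ψ (j - 1) = (x + x⁻¹ + x * e j : ℝ) * ψ j)
    (h0 : ψ 0 = 0) : ψ = 0 := by
  have hl : ∀ j ≤ (0 : ℤ), ψ (j + 1) = x * ψ j := fun j hj =>
    left_decaying (x := (x : ℂ)) (N := 0) (by simpa using h.hx.le) hψ (fun j hj => by
      have := heq j
      rw [h.t_out j (Or.inl hj), h.t_out (j - 1) (Or.inl (by omega)), h.e_out j (Or.inl hj)] at this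
      push_cast at this
      simpa using this) hj
  have hxC : (x : ℂ) ≠ 0 := Complex.ofReal_ne_zero.2 h.x_ne
  have hz : ∀ k : ℕ, ψ (-k) = 0 := by
    intro k
    induction k with
    | zero => simpa using h0
    | succ k ih =>
      have := hl (-((k + 1 : ℕ) : ℤ)) (by omega)
      rw [show -((k + 1 : ℕ) : ℤ) + 1 = -k by push_cast; ring, ih] at this
      exact (mul_eq_zero.1 this.symm).resolve_left hxC
  funext j
  refine eq_zero_forward (c := fun j => (t j : ℂ)) (ξ := fun j => ((x + x⁻¹ + x * e j : ℝ) : ℂ))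
    (L := 0) (M := j) (fun j => Complex.ofReal_ne_zero.2 (h.t_pos j).ne') (fun j _ => heq j)
    (fun j hj => ?_) j le_rfl
  have := hz (-j).toNat
  rwa [show -(((-j).toNat : ℕ) : ℤ) = j by omega] at this

/-- The values of the bound state to the right of the origin. -/
noncomputable def boundRight (n : ℕ) (x β : ℝ) (t : ℤ → ℝ) (a s : ℕ → ℝ) : ℕ → ℝ
  | 0 => 1
  | k + 1 => (if k ≤ n then x * (1 + riccati (x ^ 2)⁻¹ β a s k) / t k else x⁻¹)
      * boundRight n x β t a s k

/-- The bound state. -/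
noncomputable def boundState (n : ℕ) (x β : ℝ) (t : ℤ → ℝ) (a s : ℕ → ℝ) (j : ℤ) : ℝ :=
  if 0 ≤ j then boundRight n x β t a s j.toNat else x⁻¹ ^ (-j).toNat

lemma boundState_natCast (k : ℕ) :
    boundState n x β t a s k = boundRight n x β t a s k := by
  rw [boundState, if_pos (by omega), Int.toNat_natCast]

lemma boundState_neg (k : ℕ) : boundState n x β t a s (-k) = x⁻¹ ^ k := by
  rcases Nat.eq_zero_or_pos k with rfl | hk
  · simp [boundState, boundRight]
  · rw [boundState, if_neg (by omega)]; simp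

/-- Every ratio of consecutive values has the sign of `x`. Two bound states in the same gap
therefore have a product of constant sign, as the Wronskian argument requires. -/
lemma boundState_sign (h : ChainData n x β t e a s)
    (hg : ∀ k ≤ n, 0 < 1 + riccati (x ^ 2)⁻¹ β a s k) (j : ℤ) :
    0 < boundState n x β t a s j * x ^ j := by
  have hx0 := h.x_ne
  rcases le_or_gt 0 j with hj | hj
  · obtain ⟨k, rfl⟩ := Int.eq_ofNat_of_zero_le hj
    rw [boundState_natCast, zpow_natCast]
    clear hj
    induction k with
    | zero => simp [boundRight]
    | succ k ih =>
      have hxx : 0 < x * x := mul_self_pos.2 hx0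
      rw [boundRight, pow_succ]
      split_ifs with hk
      · have := mul_pos (mul_pos hxx (div_pos (hg k hk) (h.t_pos k))) ih
        exact this.trans_eq (by ring_nf)
      · exact ih.trans_eq (by field_simp; ring)
  · obtain ⟨k, rfl⟩ : ∃ k : ℕ, j = -k := ⟨(-j).toNat, by omega⟩
    rw [boundState_neg, zpow_neg, zpow_natCast, inv_pow, ← mul_inv]
    have : 0 < x ^ k * x ^ k := mul_self_pos.2 (pow_ne_zero k hx0)
    positivity

lemma boundState_eq (h : ChainData n x β t e a s)
    (hg : ∀ k ≤ n, 0 < 1 + riccati (x ^ 2)⁻¹ β a s k) (hm : mismatch (x ^ 2)⁻¹ β a s n = 0)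
    (j : ℤ) :
    t j * boundState n x β t a s (j + 1) + t (j - 1) * boundState n x β t a s (j - 1)
      = (x + x⁻¹ + x * e j) * boundState n x β t a s j := by
  have hx0 := h.x_ne
  rcases lt_or_ge 0 j with hj | hj
  · obtain ⟨k, rfl⟩ : ∃ k : ℕ, j = ((k + 1 : ℕ) : ℤ) := ⟨(j - 1).toNat, by omega⟩
    rw [show ((k + 1 : ℕ) : ℤ) + 1 = ((k + 1 + 1 : ℕ) : ℤ) by push_cast; ring,
      show ((k + 1 : ℕ) : ℤ) - 1 = (k : ℤ) by push_cast; ring]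
    simp only [boundState_natCast]
    rw [boundRight]
    rcases lt_trichotomy k n with hk | rfl | hk
    · have hgk := hg k hk.le
      have ht := h.t_pos ((k + 1 : ℕ) : ℤ)
      have ht' := h.t_pos k
      rw [if_pos (by omega), h.riccati_step hk hgk.ne', boundRight, if_pos hk.le]
      generalize riccati (x ^ 2)⁻¹ β a s k = g at *
      generalize t ((k + 1 : ℕ) : ℤ) = t' at *
      generalize e ((k + 1 : ℕ) : ℤ) = e' at *
      field_simp
      ring
    -- The equation at site `n + 1` is the only one where the vanishing mismatch enters: there the
    -- Riccati ratios give way to the free decay `x⁻¹`.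
    · have hgk := hg k le_rfl
      have ht' := h.t_pos k
      rw [if_neg (by omega), boundRight, if_pos le_rfl, h.t_out _ (Or.inr (by push_cast; omega)),
        h.e_out _ (Or.inr (by push_cast; omega))]
      rw [mismatch, h.s_eq k le_rfl] at hm
      generalize riccati (x ^ 2)⁻¹ β a s k = g at *
      have : t k ^ 2 = x ^ 2 * (1 + g) := by
        field_simp at hm; linarith
      field_simp
      linear_combination boundRight k x β t a s k * this
    · rw [if_neg (by omega), boundRight, if_neg (by omega),
        h.t_out _ (Or.inr (by push_cast; omega)), h.e_out _ (Or.inr (by push_cast; omega)),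
        h.t_out _ (Or.inr (by omega))]
      field_simp; ring
  · obtain ⟨k, rfl⟩ : ∃ k : ℕ, j = -k := ⟨(-j).toNat, by omega⟩
    rw [h.t_out _ (Or.inl hj), h.t_out _ (Or.inl (by omega)), h.e_out _ (Or.inl hj),
      show -(k : ℤ) - 1 = -((k + 1 : ℕ) : ℤ) by push_cast; ring, boundState_neg, boundState_neg]
    rcases Nat.eq_zero_or_pos k with rfl | hk
    · have : boundState n x β t a s (-((0 : ℕ) : ℤ) + 1) = x := by
        have := boundState_natCast (n := n) (x := x) (β := β) (t := t) (a := a) (s := s) 1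
        push_cast at this
        simp [this, boundRight, riccati, h.t_out 0 (Or.inl le_rfl)]
      rw [this]; simp
    · obtain ⟨i, rfl⟩ : ∃ i, k = i + 1 := ⟨k - 1, by omega⟩
      rw [show -((i + 1 : ℕ) : ℤ) + 1 = -(i : ℤ) by push_cast; ring, boundState_neg, pow_succ,
        pow_succ]
      field_simp; ring

lemma boundState_summable (h : ChainData n x β t e a s) :
    Summable fun j => boundState n x β t a s j ^ 2 := by
  have hx0 := h.x_ne
  have hq : (x⁻¹) ^ 2 < 1 := by
    rw [sq_lt_one_iff_abs_lt_one, abs_inv]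
    exact inv_lt_one_of_one_lt₀ h.hx
  have hgeo : Summable fun k : ℕ => ((x⁻¹) ^ 2) ^ k :=
    summable_geometric_of_lt_one (sq_nonneg _) hq
  refine Summable.of_nat_of_neg ?_ ?_
  · rw [← summable_nat_add_iff (n + 1)]
    have : ∀ k : ℕ, boundRight n x β t a s (k + (n + 1))
        = x⁻¹ ^ k * boundRight n x β t a s (n + 1) := by
      intro k
      induction k with
      | zero => simp
      | succ k ih =>
        rw [show k + 1 + (n + 1) = k + (n + 1) + 1 by ring, boundRight, if_neg (by omega), ih]
        ring
    refine (hgeo.mul_right (boundRight n x β t a s (n + 1) ^ 2)).congr fun k => ?_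
    rw [boundState_natCast, this]; ring
  · refine hgeo.congr fun k => ?_
    rw [boundState_neg]; ring

end ChainData

/-- A Wronskian argument: two decaying solutions with product of constant sign cannot belong to
ordered potentials. -/
lemma wronskian_false {c ξ η : ℤ → ℝ} {φ ψ : ℤ → ℝ} {K : ℝ} (hc : ∀ j, |c j| ≤ K)
    (hφ : Tendsto φ cofinite (𝓝 0)) (hψ : Tendsto ψ cofinite (𝓝 0))
    (h₁ : ∀ j, c j * φ (j + 1) + c (j - 1) * φ (j - 1) = ξ j * φ j)
    (h₂ : ∀ j, c j * ψ (j + 1) + c (j - 1) * ψ (j - 1) = η j * ψ j)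
    (hpos : ∀ j, 0 < (ξ j - η j) * (φ j * ψ j)) : False := by
  set W : ℤ → ℝ := fun j => c j * (φ (j + 1) * ψ j - φ j * ψ (j + 1)) with hW
  -- The increment of the Wronskian at site `j` is `(ξ_j - η_j) φ_j ψ_j > 0`. A strictly increasing
  -- sequence cannot tend to zero at both ends.
  have hstep : ∀ j, W (j - 1) < W j := by
    intro j
    have : W j - W (j - 1) = (ξ j - η j) * (φ j * ψ j) := by
      simp only [hW, sub_add_cancel]
      linear_combination ψ j * h₁ j - φ j * h₂ j
    linarith [hpos j]
  have hmono : StrictMono W := strictMono_int_of_lt_succ fun j => by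
    simpa using hstep (j + 1)
  have hshift : Function.Injective fun j : ℤ => j + 1 := add_left_injective 1
  have hlim : Tendsto W cofinite (𝓝 0) := by
    have h1 := (hφ.comp hshift.tendsto_cofinite).mul hψ
    have h2 := hφ.mul (hψ.comp hshift.tendsto_cofinite)
    have h3 := h1.sub h2
    simp only [mul_zero, sub_zero] at h3
    have h4 := (h3.abs.const_mul K)
    rw [abs_zero, mul_zero] at h4
    refine squeeze_zero_norm (fun j => ?_) h4
    rw [Real.norm_eq_abs, abs_mul]
    exact mul_le_mul_of_nonneg_right (hc j) (abs_nonneg _)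
  have hR : Tendsto (fun k : ℕ => W k) atTop (𝓝 0) := by
    rw [← Nat.cofinite_eq_atTop]
    exact hlim.comp (Nat.cast_injective (R := ℤ)).tendsto_cofinite
  have hL : Tendsto (fun k : ℕ => W (-k)) atTop (𝓝 0) := by
    have : Function.Injective fun k : ℕ => -(k : ℤ) := fun a b h => by simpa using h
    rw [← Nat.cofinite_eq_atTop]
    exact hlim.comp this.tendsto_cofinite
  have e1 : W 1 ≤ 0 := ge_of_tendsto hR (by
    filter_upwards [eventually_ge_atTop 1] with k hk
    exact hmono.monotone (by exact_mod_cast hk))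
  have e2 : 0 ≤ W 0 := le_of_tendsto hL (Eventually.of_forall fun k =>
    hmono.monotone (by simp))
  linarith [hmono (show (0 : ℤ) < 1 by norm_num)]

/-! ### The difference operator on `ℓ²(ℤ)` -/

/-- `A + F = A (1 + K)` with `K = A⁻¹ F` of finite rank, and `1 + K` maps the range of `K` into
itself, where injectivity implies surjectivity. Solving `(1 + K) w = K A⁻¹ y` there gives the
preimage `A⁻¹ y - w`. -/
lemma surjective_of_injective_of_finite_rank {𝕜 E : Type*} [Field 𝕜] [AddCommGroup E] [Module 𝕜 E]
    (A : E ≃ₗ[𝕜] E) (F : E →ₗ[𝕜] E) [FiniteDimensional 𝕜 (LinearMap.range F)]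
    (hinj : ∀ v, A v + F v = 0 → v = 0) (y : E) : ∃ v, A v + F v = y := by
  set K : E →ₗ[𝕜] E := A.symm.toLinearMap ∘ₗ F with hK
  set W := LinearMap.range K with hW
  have hWfin : FiniteDimensional 𝕜 W := by
    rw [hW, hK, LinearMap.range_comp]; infer_instance
  have hKW : ∀ v ∈ W, ((LinearMap.id : E →ₗ[𝕜] E) + K) v ∈ W := fun v hv =>
    W.add_mem hv (LinearMap.mem_range_self K v)
  set L : W →ₗ[𝕜] W := ((LinearMap.id : E →ₗ[𝕜] E) + K).restrict hKW
  have hLinj : Function.Injective L := by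
    rw [← LinearMap.ker_eq_bot, LinearMap.ker_eq_bot']
    intro w hw
    have hw' : (w : E) + K w = 0 := congrArg Subtype.val hw
    apply Subtype.ext
    apply hinj
    have := congrArg A hw'
    simpa [hK] using this
  obtain ⟨w, hw⟩ := LinearMap.injective_iff_surjective.1 hLinj
    ⟨K (A.symm y), LinearMap.mem_range_self K _⟩
  have hw' : (w : E) + K w = K (A.symm y) := congrArg Subtype.val hw
  have := congrArg A hw'
  simp only [hK, LinearMap.comp_apply, map_add, LinearEquiv.coe_coe,
    LinearEquiv.apply_symm_apply] at this
  refine ⟨A.symm y - w, ?_⟩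
  rw [map_sub, map_sub, LinearEquiv.apply_symm_apply, ← this]
  abel

/-- The space `ℓ²(ℤ)`. -/
abbrev SeqSpace : Type := lp (fun _ : ℤ => ℂ) 2

lemma memℓp_two_iff {ι : Type*} {E : ι → Type*} [∀ i, NormedAddCommGroup (E i)] {f : ∀ i, E i} :
    Memℓp f 2 ↔ Summable fun i => ‖f i‖ ^ 2 := by
  rw [memℓp_gen_iff (by norm_num)]
  simp

lemma memℓp_comp_add {ψ : ℤ → ℂ} (h : Memℓp ψ 2) (m : ℤ) : Memℓp (fun j => ψ (j + m)) 2 := by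
  rw [memℓp_two_iff] at h ⊢
  have h' : Summable ((fun j => ‖ψ j‖ ^ 2) ∘ fun j => j + m) :=
    h.comp_injective (add_left_injective m)
  exact h'

/-- The translation by `m` on `ℓ²(ℤ)`. -/
noncomputable def translation (m : ℤ) : SeqSpace →ₗᵢ[ℂ] SeqSpace where
  toFun ψ := ⟨fun j => ψ (j + m), memℓp_comp_add (lp.memℓp ψ) m⟩
  map_add' _ _ := rfl
  map_smul' _ _ := rfl
  norm_map' ψ := by
    have h2 : (0 : ℝ) < (2 : ENNReal).toReal := by norm_num
    rw [lp.norm_eq_tsum_rpow h2, lp.norm_eq_tsum_rpow h2]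
    congr 1
    exact (Equiv.addRight m).tsum_eq fun j => ‖(ψ : ℤ → ℂ) j‖ ^ (2 : ENNReal).toReal

/-- The free difference operator at an energy outside its spectrum is invertible. -/
lemma exists_free_equiv {c ξ : ℝ} (h : 2 * |c| < |ξ|) :
    ∃ A : SeqSpace ≃ₗ[ℂ] SeqSpace, ∀ (ψ : SeqSpace) (j : ℤ),
      (A ψ : ℤ → ℂ) j = c * ψ (j + 1) + c * ψ (j - 1) - ξ * ψ j := by
  set U : SeqSpace →L[ℂ] SeqSpace := (translation 1).toContinuousLinearMap with hU
  set V : SeqSpace →L[ℂ] SeqSpace := (translation (-1)).toContinuousLinearMap with hV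
  have h1 : ‖U‖ ≤ 1 := LinearIsometry.norm_toContinuousLinearMap_le _
  have h2 : ‖V‖ ≤ 1 := LinearIsometry.norm_toContinuousLinearMap_le _
  set J : SeqSpace →L[ℂ] SeqSpace := (c : ℂ) • (U + V) with hJ
  have hnorm : ‖J‖ < ‖(ξ : ℂ)‖ := by
    have h3 : ‖J‖ ≤ ‖(c : ℂ)‖ * ‖U + V‖ := ContinuousLinearMap.opNorm_smul_le _ _
    have h4 : ‖U + V‖ ≤ ‖U‖ + ‖V‖ := ContinuousLinearMap.opNorm_add_le _ _
    rw [Complex.norm_real, Real.norm_eq_abs] at *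
    nlinarith [abs_nonneg c]
  -- The operator `J` is `c` times the sum of two isometric shifts, so `‖J‖ ≤ 2|c| < |ξ|`.
  have hmem : (ξ : ℂ) ∈ _root_.resolventSet ℂ J := by
    refine spectrum.mem_resolventSet_of_norm_lt_mul (lt_of_le_of_lt ?_ hnorm)
    calc ‖J‖ * ‖(1 : SeqSpace →L[ℂ] SeqSpace)‖ ≤ ‖J‖ * 1 := by
          exact mul_le_mul_of_nonneg_left (ContinuousLinearMap.opNorm_le_bound _ zero_le_one
            fun w => by rw [one_mul]; rfl) (norm_nonneg _)
      _ = ‖J‖ := mul_one _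
  obtain ⟨u, hu⟩ := hmem
  -- The unit provided by the resolvent set is `ξ - J`, whereas `J - ξ` is wanted, hence the sign
  -- change.
  refine ⟨(LinearEquiv.neg ℂ).trans
    (ContinuousLinearEquiv.unitsEquiv ℂ SeqSpace u).toLinearEquiv, fun ψ j => ?_⟩
  have : ((LinearEquiv.neg ℂ).trans
    (ContinuousLinearEquiv.unitsEquiv ℂ SeqSpace u).toLinearEquiv) ψ
      = (u : SeqSpace →L[ℂ] SeqSpace) (-ψ) := rfl
  rw [this, hu]
  simp only [hJ, hU, hV, Algebra.algebraMap_eq_smul_one]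
  change (ξ : ℂ) * (-(ψ : ℤ → ℂ) j) - (c : ℂ) * (-(ψ : ℤ → ℂ) (j + 1) + -(ψ : ℤ → ℂ) (j + -1)) = _
  rw [← sub_eq_add_neg j 1]
  ring

/-- A locally perturbed difference operator at an energy outside the free spectrum is surjective if
it is injective. -/
lemma exists_solution {c ξ : ℤ → ℝ} {c₀ ξ₀ : ℝ} (J : Finset ℤ) (h : 2 * |c₀| < |ξ₀|)
    (hc : ∀ j ∉ J, c j = c₀ ∧ c (j - 1) = c₀) (hξ : ∀ j ∉ J, ξ j = ξ₀)
    (hinj : ∀ ψ : ℤ → ℂ, Memℓp ψ 2 →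
      (∀ j, c j * ψ (j + 1) + c (j - 1) * ψ (j - 1) = ξ j * ψ j) → ψ = 0)
    {r : ℤ → ℂ} (hr : Memℓp r 2) :
    ∃ ψ : ℤ → ℂ, Memℓp ψ 2 ∧
      ∀ j, c j * ψ (j + 1) + c (j - 1) * ψ (j - 1) - ξ j * ψ j = r j := by
  obtain ⟨A, hA⟩ := exists_free_equiv h
  -- `φ j` is row `j` of the perturbation minus the free operator. It vanishes off `J`, so the
  -- difference `F` factors through `J → ℂ` and has finite rank.
  let φ : ℤ → SeqSpace →ₗ[ℂ] ℂ := fun j =>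
    ((c j - c₀ : ℝ) : ℂ) • lp.evalₗ (𝕜 := ℂ) (fun _ : ℤ => ℂ) 2 (j + 1)
    + ((c (j - 1) - c₀ : ℝ) : ℂ) • lp.evalₗ (𝕜 := ℂ) (fun _ : ℤ => ℂ) 2 (j - 1)
    - ((ξ j - ξ₀ : ℝ) : ℂ) • lp.evalₗ (𝕜 := ℂ) (fun _ : ℤ => ℂ) 2 j
  let Φ : SeqSpace →ₗ[ℂ] (J → ℂ) := LinearMap.pi fun j => φ j
  let S : (J → ℂ) →ₗ[ℂ] SeqSpace :=
    ∑ j : J, (lp.lsingle (𝕜 := ℂ) (E := fun _ : ℤ => ℂ) 2 (j : ℤ)) ∘ₗ LinearMap.proj j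
  let F : SeqSpace →ₗ[ℂ] SeqSpace := S ∘ₗ Φ
  have hfin : FiniteDimensional ℂ (LinearMap.range F) :=
    Submodule.finiteDimensional_of_le (LinearMap.range_comp_le_range Φ S)
  have hF : ∀ (ψ : SeqSpace) (j : ℤ), (F ψ : ℤ → ℂ) j
      = ((c j - c₀ : ℝ) : ℂ) * ψ (j + 1) + ((c (j - 1) - c₀ : ℝ) : ℂ) * ψ (j - 1)
        - ((ξ j - ξ₀ : ℝ) : ℂ) * ψ j := by
    intro ψ j
    have e1 : (F ψ : ℤ → ℂ) j = ∑ i : J, (lp.single 2 (i : ℤ) (φ i ψ) : SeqSpace) j := by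
      simp only [F, S, Φ, LinearMap.comp_apply, LinearMap.sum_apply, lp.coeFn_sum,
        Finset.sum_apply]
      rfl
    have e2 : φ j ψ = ((c j - c₀ : ℝ) : ℂ) * ψ (j + 1) + ((c (j - 1) - c₀ : ℝ) : ℂ) * ψ (j - 1)
        - ((ξ j - ξ₀ : ℝ) : ℂ) * ψ j := rfl
    rw [e1, ← e2]
    by_cases hj : j ∈ J
    · rw [Finset.sum_eq_single (⟨j, hj⟩ : J)]
      · exact lp.single_apply_self _ _ _
      · intro i _ hi
        exact lp.single_apply_ne _ _ _ fun h => hi (Subtype.ext h.symm)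
      · simp
    · rw [Finset.sum_eq_zero]
      · rw [e2, (hc j hj).1, (hc j hj).2, hξ j hj]; simp
      · intro i _
        exact lp.single_apply_ne _ _ _ fun h => hj (h ▸ i.2)
  have hAF : ∀ (ψ : SeqSpace) (j : ℤ), (A ψ + F ψ : SeqSpace) j
      = c j * ψ (j + 1) + c (j - 1) * ψ (j - 1) - ξ j * ψ j := by
    intro ψ j
    rw [lp.coeFn_add, Pi.add_apply, hA, hF]
    push_cast; ring
  have hker : ∀ ψ, A ψ + F ψ = 0 → ψ = 0 := fun ψ hψ => by
    refine lp.ext (hinj ψ (lp.memℓp ψ) fun j => ?_)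
    rw [← sub_eq_zero, ← hAF, hψ]
    rfl
  obtain ⟨ψ, hψ⟩ := surjective_of_injective_of_finite_rank A F hker ⟨r, hr⟩
  refine ⟨ψ, lp.memℓp ψ, fun j => ?_⟩
  rw [← hAF, hψ]

lemma tendsto_of_memℓp {ψ : ℤ → ℂ} (h : Memℓp ψ 2) : Tendsto ψ cofinite (𝓝 0) := by
  have h1 := (memℓp_two_iff.1 h).tendsto_cofinite_zero
  rw [tendsto_zero_iff_norm_tendsto_zero]
  have h2 := h1.sqrt
  simpa using h2

/-! ### Symmetric operators -/

section Symmetric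

variable {H : Type*} [NormedAddCommGroup H] [InnerProductSpace ℂ H] [CompleteSpace H]

/-- A symmetric operator with `T - E` bijective for a real `E` has a bounded selfadjoint inverse of
`T - E`. -/
lemma exists_resolvent_of_bijective {T : H →ₗ.[ℂ] H}
    (hsym : ∀ x y : T.domain, inner ℂ (T x) (y : H) = inner ℂ (x : H) (T y)) {E : ℝ}
    (hinj : ∀ x : T.domain, T x - (E : ℂ) • (x : H) = 0 → x = 0)
    (hsurj : ∀ y : H, ∃ x : T.domain, T x - (E : ℂ) • (x : H) = y) :
    ∃ R : H →L[ℂ] H, IsSelfAdjoint R ∧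
      (∀ y : H, ∃ h : R y ∈ T.domain, T ⟨R y, h⟩ - (E : ℂ) • R y = y) ∧
      (∀ x : T.domain, R (T x - (E : ℂ) • (x : H)) = x) := by
  let L : T.domain →ₗ[ℂ] H := T.toFun - (E : ℂ) • T.domain.subtype
  have hL : ∀ x, L x = T x - (E : ℂ) • (x : H) := fun x => rfl
  let e : T.domain ≃ₗ[ℂ] H := LinearEquiv.ofBijective L
    ⟨LinearMap.ker_eq_bot.1 (LinearMap.ker_eq_bot'.2 hinj), hsurj⟩
  have he : ∀ x, e x = T x - (E : ℂ) • (x : H) := fun x => rfl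
  let R₀ : H →ₗ[ℂ] H := T.domain.subtype ∘ₗ e.symm.toLinearMap
  have hR₀ : ∀ x : T.domain, R₀ (e x) = x := fun x => by simp [R₀]
  have hsymm : R₀.IsSymmetric := by
    intro u v
    obtain ⟨x, rfl⟩ := e.surjective u
    obtain ⟨y, rfl⟩ := e.surjective v
    rw [hR₀, hR₀, he, he, inner_sub_left, inner_sub_right, hsym, inner_smul_left, inner_smul_right,
      Complex.conj_ofReal]
  -- An everywhere defined symmetric operator on a complete space is bounded (Hellinger–Toeplitz).
  let R : H →L[ℂ] H := ⟨R₀, hsymm.continuous⟩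
  refine ⟨R, ContinuousLinearMap.isSelfAdjoint_iff_isSymmetric.2 hsymm, fun y => ?_, hR₀⟩
  have : R y = (e.symm y : H) := rfl
  refine ⟨this ▸ (e.symm y).2, ?_⟩
  exact e.apply_symm_apply y

lemma mem_resolventSet_of_bijective {T : H →ₗ.[ℂ] H}
    (hsym : ∀ x y : T.domain, inner ℂ (T x) (y : H) = inner ℂ (x : H) (T y)) {E : ℝ}
    (hinj : ∀ x : T.domain, T x - (E : ℂ) • (x : H) = 0 → x = 0)
    (hsurj : ∀ y : H, ∃ x : T.domain, T x - (E : ℂ) • (x : H) = y) :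
    (E : ℂ) ∈ resolventSet T := by
  obtain ⟨R, -, h1, h2⟩ := exists_resolvent_of_bijective hsym hinj hsurj
  exact ⟨R, h1, h2⟩

/-- `T - z = (z - E) ((z - E)⁻¹ - R) (T - E)` with `R = (T - E)⁻¹` selfadjoint. The middle factor is
invertible because the spectrum of `R` is real. One real point of the resolvent set thus handles all
nonreal energies, without a separate proof of selfadjointness of `T`. -/
lemma mem_resolventSet_of_im_ne_zero {T : H →ₗ.[ℂ] H}
    (hsym : ∀ x y : T.domain, inner ℂ (T x) (y : H) = inner ℂ (x : H) (T y)) {E : ℝ}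
    (hinj : ∀ x : T.domain, T x - (E : ℂ) • (x : H) = 0 → x = 0)
    (hsurj : ∀ y : H, ∃ x : T.domain, T x - (E : ℂ) • (x : H) = y) {z : ℂ} (hz : z.im ≠ 0) :
    z ∈ resolventSet T := by
  obtain ⟨R, hR, h1, h2⟩ := exists_resolvent_of_bijective hsym hinj hsurj
  have hzE : z - E ≠ 0 := fun h => hz (by simpa using congrArg Complex.im h)
  have hmem : (z - E)⁻¹ ∉ spectrum ℂ R := fun h => by
    have h3 := hR.mem_spectrum_eq_re h
    have h4 : ((z - E)⁻¹).im = 0 := by rw [h3]; simp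
    rw [Complex.inv_im, div_eq_zero_iff] at h4
    rcases h4 with h4 | h4
    · apply hz; simpa using h4
    · exact hzE (Complex.normSq_eq_zero.1 h4)
  rw [spectrum.notMem_iff] at hmem
  obtain ⟨u, hu⟩ := hmem
  have hu' : ∀ w, (u : H →L[ℂ] H) w = (z - E)⁻¹ • w - R w := fun w => by
    rw [hu]; simp [Algebra.algebraMap_eq_smul_one]
  have huinv : ∀ w, (u : H →L[ℂ] H) ((↑u⁻¹ : H →L[ℂ] H) w) = w := fun w => by
    rw [← mul_apply_eq_comp, u.mul_inv]; rfl
  have hinvu : ∀ w, (↑u⁻¹ : H →L[ℂ] H) ((u : H →L[ℂ] H) w) = w := fun w => by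
    rw [← mul_apply_eq_comp, u.inv_mul]; rfl
  refine ⟨R ∘L ((z - E)⁻¹ • (↑u⁻¹ : H →L[ℂ] H)), fun y => ?_, fun x => ?_⟩
  · have e1 : (R ∘L ((z - E)⁻¹ • (↑u⁻¹ : H →L[ℂ] H))) y
        = R ((z - E)⁻¹ • (↑u⁻¹ : H →L[ℂ] H) y) := rfl
    rw [e1]
    obtain ⟨h, h3⟩ := h1 ((z - E)⁻¹ • (↑u⁻¹ : H →L[ℂ] H) y)
    refine ⟨h, ?_⟩
    have h5 := huinv y
    rw [hu'] at h5
    rw [sub_eq_iff_eq_add.1 h3]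
    rw [map_smul, smul_smul, smul_smul]
    have : (z - E) * (z - E)⁻¹ = 1 := mul_inv_cancel₀ hzE
    calc (z - E)⁻¹ • (↑u⁻¹ : H →L[ℂ] H) y + ((E : ℂ) * (z - E)⁻¹) • R ((↑u⁻¹ : H →L[ℂ] H) y)
          - (z * (z - E)⁻¹) • R ((↑u⁻¹ : H →L[ℂ] H) y)
        = (z - E)⁻¹ • (↑u⁻¹ : H →L[ℂ] H) y
          - ((z - E) * (z - E)⁻¹) • R ((↑u⁻¹ : H →L[ℂ] H) y) := by module
      _ = y := by rw [this, one_smul, h5]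
  · have e1 : T x - z • (x : H) = (z - E) • (u : H →L[ℂ] H) (T x - (E : ℂ) • (x : H)) := by
      rw [hu', h2, smul_sub, smul_smul, mul_inv_cancel₀ hzE, one_smul]
      module
    rw [e1]
    simp only [ContinuousLinearMap.comp_apply, smul_apply, map_smul, hinvu]
    rw [smul_smul, mul_inv_cancel₀ hzE, one_smul, h2]

end Symmetric

/-! ### Estimates on a single edge -/

/-- The norm of `L²(0, π)`. -/
noncomputable def edgeNorm (u : ℝ → ℂ) : ℝ := (eLpNorm u 2 edgeMeasure).toReal

lemma edgeNorm_nonneg (u : ℝ → ℂ) : 0 ≤ edgeNorm u := ENNReal.toReal_nonneg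

lemma edgeNorm_congr {u v : ℝ → ℂ} (h : u =ᵐ[edgeMeasure] v) : edgeNorm u = edgeNorm v := by
  rw [edgeNorm, edgeNorm, eLpNorm_congr_ae h]

lemma edgeNorm_congr_norm {u v : ℝ → ℂ} (h : ∀ x, ‖u x‖ = ‖v x‖) : edgeNorm u = edgeNorm v := by
  rw [edgeNorm, edgeNorm, eLpNorm_congr_norm_ae (Eventually.of_forall h)]

lemma edgeNorm_coe (f : Lp ℂ 2 edgeMeasure) : edgeNorm f = ‖f‖ := (Lp.norm_def f).symm

lemma edgeMeasure_univ : edgeMeasure univ = ENNReal.ofReal π := by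
  simp [edgeMeasure]

lemma sqrt_pi_le_two : √π ≤ 2 := by
  rw [Real.sqrt_le_left (by norm_num)]; linarith [Real.pi_le_four]

lemma integral_norm_le_edgeNorm {u : ℝ → ℂ} (hu : MemLp u 2 edgeMeasure) :
    ∫ t, ‖u t‖ ∂edgeMeasure ≤ 2 * edgeNorm u := by
  have h1 := eLpNorm_le_eLpNorm_mul_rpow_measure_univ (p := 1) (q := 2) (by norm_num)
    hu.aestronglyMeasurable
  have h2 : ∫ t, ‖u t‖ ∂edgeMeasure = (eLpNorm u 1 edgeMeasure).toReal := by
    rw [integral_norm_eq_lintegral_enorm hu.aestronglyMeasurable, eLpNorm_one_eq_lintegral_enorm]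
  rw [h2]
  have hfin : eLpNorm u 2 edgeMeasure
      * edgeMeasure univ ^ (1 / (1 : ENNReal).toReal - 1 / (2 : ENNReal).toReal) ≠ ⊤ := by
    refine ENNReal.mul_ne_top hu.2.ne (ENNReal.rpow_ne_top_of_nonneg (by norm_num) ?_)
    rw [edgeMeasure_univ]; exact ENNReal.ofReal_ne_top
  refine (ENNReal.toReal_mono hfin h1).trans ?_
  rw [ENNReal.toReal_mul, mul_comm, edgeMeasure_univ, ← ENNReal.toReal_rpow,
    ENNReal.toReal_ofReal Real.pi_pos.le]
  refine mul_le_mul_of_nonneg_right ?_ (edgeNorm_nonneg u)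
  have : π ^ (1 / (1 : ENNReal).toReal - 1 / (2 : ENNReal).toReal) = √π := by
    rw [Real.sqrt_eq_rpow]; norm_num
  rw [this]; exact sqrt_pi_le_two

lemma norm_integral_mul_le {u v : ℝ → ℂ} (hu : MemLp u 2 edgeMeasure) {M : ℝ}
    (hv : ∀ x ∈ Icc 0 π, ‖v x‖ ≤ M) {x : ℝ} (hx : x ∈ Icc 0 π) :
    ‖∫ t in (0 : ℝ)..x, v t * u t‖ ≤ 2 * M * edgeNorm u := by
  have hM : 0 ≤ M := (norm_nonneg _).trans (hv 0 ⟨le_rfl, Real.pi_pos.le⟩)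
  have hui : Integrable u edgeMeasure := hu.integrable (by norm_num)
  have h1 : ‖∫ t in (0 : ℝ)..x, v t * u t‖ ≤ ∫ t in Ioc 0 x, M * ‖u t‖ := by
    rw [intervalIntegral.integral_of_le hx.1]
    refine norm_integral_le_of_norm_le ?_ ?_
    · have : IntegrableOn u (Ioc 0 x) :=
        ((integrableOn_Ioc_iff_integrableOn_Ioo).2 hui).mono_set (Ioc_subset_Ioc_right hx.2)
      exact this.norm.const_mul M
    · rw [ae_restrict_iff' measurableSet_Ioc]
      refine Eventually.of_forall fun t ht => ?_
      rw [norm_mul]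
      exact mul_le_mul_of_nonneg_right (hv t ⟨ht.1.le, ht.2.trans hx.2⟩) (norm_nonneg _)
  have h2 : ∫ t in Ioc 0 x, M * ‖u t‖ ≤ ∫ t in Ioc 0 π, M * ‖u t‖ := by
    refine setIntegral_mono_set ?_ (Eventually.of_forall fun t => by positivity)
      (Ioc_subset_Ioc_right hx.2).eventuallyLE
    exact (((integrableOn_Ioc_iff_integrableOn_Ioo).2 hui).norm).const_mul M
  have h3 : ∫ t in Ioc 0 π, M * ‖u t‖ = M * ∫ t, ‖u t‖ ∂edgeMeasure := by
    rw [integral_const_mul, ← restrict_Ioo_eq_restrict_Ioc]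
  have h4 := mul_le_mul_of_nonneg_left (integral_norm_le_edgeNorm hu) hM
  linarith

lemma edgeNorm_le_of_bound {u : ℝ → ℂ} {M : ℝ} (hM : ∀ x ∈ Icc 0 π, ‖u x‖ ≤ M) :
    edgeNorm u ≤ 2 * M := by
  have hM0 : 0 ≤ M := (norm_nonneg _).trans (hM 0 ⟨le_rfl, Real.pi_pos.le⟩)
  have h1 : eLpNorm u 2 edgeMeasure ≤ edgeMeasure univ ^ (2 : ENNReal).toReal⁻¹ * ENNReal.ofReal M := by
    refine eLpNorm_le_of_ae_bound ?_
    rw [ae_restrict_iff' measurableSet_Ioo]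
    exact Eventually.of_forall fun x hx => hM x (Ioo_subset_Icc_self hx)
  have hfin : edgeMeasure univ ^ (2 : ENNReal).toReal⁻¹ * ENNReal.ofReal M ≠ ⊤ := by
    refine ENNReal.mul_ne_top (ENNReal.rpow_ne_top_of_nonneg (by norm_num) ?_) ENNReal.ofReal_ne_top
    rw [edgeMeasure_univ]; exact ENNReal.ofReal_ne_top
  refine (ENNReal.toReal_mono hfin h1).trans ?_
  rw [ENNReal.toReal_mul, ENNReal.toReal_ofReal hM0, edgeMeasure_univ, ← ENNReal.toReal_rpow,
    ENNReal.toReal_ofReal Real.pi_pos.le]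
  refine mul_le_mul_of_nonneg_right ?_ hM0
  have : π ^ (2 : ENNReal).toReal⁻¹ = √π := by
    rw [Real.sqrt_eq_rpow]; norm_num
  rw [this]; exact sqrt_pi_le_two

lemma IsH2.memLp₀ {u u₁ u₂ : ℝ → ℂ} (h : IsH2 u u₁ u₂) : MemLp u 2 edgeMeasure :=
  memLp_edge_of_continuousOn h.continuousOn

lemma IsH2.of_smooth {ρ ρ₁ ρ₂ : ℝ → ℂ} (h : ∀ x, HasDerivAt ρ (ρ₁ x) x)
    (h₁ : ∀ x, HasDerivAt ρ₁ (ρ₂ x) x) (h₂ : Continuous ρ₂) : IsH2 ρ ρ₁ ρ₂ :=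
  IsH2.of_isPrimitive (IsPrimitive.of_continuousOn_hasDerivAt h
      (continuous_iff_continuousAt.2 fun x => (h₁ x).continuousAt))
    (IsPrimitive.of_continuousOn_hasDerivAt h₁ h₂) (memLp_edge_of_continuousOn h₂.continuousOn)

/-- The Wronskian of two `H²` functions is a primitive. -/
lemma IsH2.wronskian {w w₁ w₂ v v₁ v₂ : ℝ → ℂ} (hw : IsH2 w w₁ w₂) (hv : IsH2 v v₁ v₂) :
    IsPrimitive (fun x => w₁ x * v x - w x * v₁ x) (fun x => w₂ x * v x - w x * v₂ x) :=
  ((hw.isPrimitive₁.mul hv.isPrimitive).add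
    ((hw.isPrimitive.mul hv.isPrimitive₁).const_mul (-1))).congr
    (fun x _ => by simp only [Pi.add_apply, Pi.mul_apply]; ring)
    (Eventually.of_forall fun x => by simp only [Pi.add_apply, Pi.mul_apply]; ring)

/-- Green's identity. -/
lemma IsH2.green {w w₁ w₂ v v₁ v₂ : ℝ → ℂ} (hw : IsH2 w w₁ w₂) (hv : IsH2 v v₁ v₂) :
    ∫ x, (w₂ x * v x - w x * v₂ x) ∂edgeMeasure
      = (w₁ π * v π - w π * v₁ π) - (w₁ 0 * v 0 - w 0 * v₁ 0) :=
  (hw.wronskian hv).integral_eq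

lemma isH2_cubic (a b c d : ℂ) :
    IsH2 (fun x : ℝ => a + b * x + c * x ^ 2 + d * x ^ 3)
      (fun x : ℝ => b + 2 * c * x + 3 * d * x ^ 2) (fun x : ℝ => 2 * c + 6 * d * x) := by
  have hx : ∀ x : ℝ, HasDerivAt (fun y : ℝ => (y : ℂ)) 1 x := fun x =>
    Complex.ofRealCLM.hasDerivAt
  refine IsH2.of_smooth (fun x => ?_) (fun x => ?_) (by fun_prop)
  · exact (((((hx x).const_mul b).const_add a).add (((hx x).pow 2).const_mul c)).add
      (((hx x).pow 3).const_mul d)).congr_deriv (by simp; ring)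
  · exact ((((hx x).const_mul (2 * c)).const_add b).add
      (((hx x).pow 2).const_mul (3 * d))).congr_deriv (by simp; ring)

/-- Green's identity against a test function `v`: choosing the boundary values of `v` and `v'`
extracts a single trace of `w`. -/
lemma norm_integral_test_le {w w₁ w₂ v v₁ v₂ : ℝ → ℂ} (hw : IsH2 w w₁ w₂) (hv : IsH2 v v₁ v₂)
    {M : ℝ} (hM : ∀ x ∈ Icc 0 π, ‖v x‖ ≤ M) (hM' : ∀ x ∈ Icc 0 π, ‖v₂ x‖ ≤ M) :
    ‖(w₁ π * v π - w π * v₁ π) - (w₁ 0 * v 0 - w 0 * v₁ 0)‖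
      ≤ 2 * M * (edgeNorm w + edgeNorm w₂) := by
  have hπ : π ∈ Icc (0 : ℝ) π := ⟨Real.pi_pos.le, le_rfl⟩
  have h0 := (hw.wronskian hv).eq π hπ
  have hi1 : IntervalIntegrable (fun t => v t * w₂ t) volume 0 π :=
    hw.intervalIntegrable₂.continuousOn_mul
      (by rw [uIcc_of_le Real.pi_pos.le]; exact hv.continuousOn)
  have hi2 : IntervalIntegrable (fun t => v₂ t * w t) volume 0 π :=
    hv.intervalIntegrable₂.mul_continuousOn
      (by rw [uIcc_of_le Real.pi_pos.le]; exact hw.continuousOn)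
  have h1 : ∫ t in (0 : ℝ)..π, (w₂ t * v t - w t * v₂ t)
      = (∫ t in (0 : ℝ)..π, v t * w₂ t) - ∫ t in (0 : ℝ)..π, v₂ t * w t := by
    rw [← intervalIntegral.integral_sub hi1 hi2]
    congr 1; funext t; ring
  rw [h0, add_sub_cancel_left, h1]
  refine (norm_sub_le _ _).trans ?_
  have e1 := norm_integral_mul_le hw.memLp hM hπ
  have e2 := norm_integral_mul_le hw.memLp₀ hM' hπ
  linarith

/-- Traces are bounded in `H²`. -/
lemma exists_trace_bound : ∃ K, 0 ≤ K ∧ ∀ w w₁ w₂ : ℝ → ℂ, IsH2 w w₁ w₂ →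
    ‖w 0‖ ≤ K * (edgeNorm w + edgeNorm w₂) ∧ ‖w₁ 0‖ ≤ K * (edgeNorm w + edgeNorm w₂) := by
  have hp : (π : ℂ) ≠ 0 := Complex.ofReal_ne_zero.2 Real.pi_pos.ne'
  have key : ∀ a b c d : ℂ, ∃ M, 0 ≤ M ∧ (∀ x ∈ Icc 0 π, ‖a + b * x + c * (x : ℂ) ^ 2 + d * x ^ 3‖ ≤ M)
      ∧ ∀ x ∈ Icc 0 π, ‖2 * c + 6 * d * (x : ℝ)‖ ≤ M := by
    intro a b c d
    obtain ⟨M₁, h1⟩ := isCompact_Icc.exists_bound_of_continuousOn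
      (isH2_cubic a b c d).continuousOn
    obtain ⟨M₂, h2⟩ := (isCompact_Icc (a := (0 : ℝ)) (b := π)).exists_bound_of_continuousOn
      (f := fun x : ℝ => 2 * c + 6 * d * (x : ℂ)) (by fun_prop)
    exact ⟨max 0 (max M₁ M₂), le_max_left _ _, fun x hx => (h1 x hx).trans
      ((le_max_left _ _).trans (le_max_right _ _)), fun x hx => (h2 x hx).trans
      ((le_max_right _ _).trans (le_max_right _ _))⟩
  -- Cubic Hermite polynomials whose value and derivative vanish at `π`: the first has value 0 and
  -- slope 1 at 0, the second value 1 and slope 0. They isolate `w 0` and `-w₁ 0`.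
  obtain ⟨M, hM0, hM, hM'⟩ := key 0 1 (-2 / π) (1 / π ^ 2)
  obtain ⟨M₁, hM₁0, hM₁, hM₁'⟩ := key 1 0 (-3 / π ^ 2) (2 / π ^ 3)
  refine ⟨2 * max M M₁, by positivity, fun w w₁ w₂ hw => ⟨?_, ?_⟩⟩
  · have := norm_integral_test_le hw (isH2_cubic 0 1 (-2 / π) (1 / π ^ 2)) hM hM'
    have e : (w₁ π * (0 + 1 * (π : ℂ) + -2 / π * (π : ℂ) ^ 2 + 1 / (π : ℂ) ^ 2 * π ^ 3)
        - w π * (1 + 2 * (-2 / π) * (π : ℂ) + 3 * (1 / (π : ℂ) ^ 2) * π ^ 2))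
        - (w₁ 0 * (0 + 1 * ((0 : ℝ) : ℂ) + -2 / π * ((0 : ℝ) : ℂ) ^ 2 + 1 / (π : ℂ) ^ 2 * ((0 : ℝ) : ℂ) ^ 3)
        - w 0 * (1 + 2 * (-2 / π) * ((0 : ℝ) : ℂ) + 3 * (1 / (π : ℂ) ^ 2) * ((0 : ℝ) : ℂ) ^ 2)) = w 0 := by
      simp only [Complex.ofReal_zero]; field_simp; ring
    rw [e] at this
    refine this.trans (mul_le_mul_of_nonneg_right ?_
      (add_nonneg (edgeNorm_nonneg _) (edgeNorm_nonneg _)))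
    have := le_max_left M M₁
    linarith
  · have := norm_integral_test_le hw (isH2_cubic 1 0 (-3 / π ^ 2) (2 / π ^ 3)) hM₁ hM₁'
    have e : (w₁ π * (1 + 0 * (π : ℂ) + -3 / (π : ℂ) ^ 2 * (π : ℂ) ^ 2 + 2 / (π : ℂ) ^ 3 * π ^ 3)
        - w π * (0 + 2 * (-3 / (π : ℂ) ^ 2) * (π : ℂ) + 3 * (2 / (π : ℂ) ^ 3) * π ^ 2))
        - (w₁ 0 * (1 + 0 * ((0 : ℝ) : ℂ) + -3 / (π : ℂ) ^ 2 * ((0 : ℝ) : ℂ) ^ 2 + 2 / (π : ℂ) ^ 3 * ((0 : ℝ) : ℂ) ^ 3)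
        - w 0 * (0 + 2 * (-3 / (π : ℂ) ^ 2) * ((0 : ℝ) : ℂ) + 3 * (2 / (π : ℂ) ^ 3) * ((0 : ℝ) : ℂ) ^ 2)) = -w₁ 0 := by
      simp only [Complex.ofReal_zero]; field_simp; ring
    rw [e, norm_neg] at this
    refine this.trans (mul_le_mul_of_nonneg_right ?_
      (add_nonneg (edgeNorm_nonneg _) (edgeNorm_nonneg _)))
    have := le_max_right M M₁
    linarith

/-! ### The equation `-w'' = E w + y` on an edge -/

lemma hasDerivAt_cosE_ofReal (E x : ℝ) :
    HasDerivAt (fun x => (cosE E x : ℂ)) (-E * sinE E x : ℂ) x := by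
  have := (hasDerivAt_cosE E x).ofReal_comp
  push_cast at this
  exact this

lemma hasDerivAt_sinE_ofReal (E x : ℝ) :
    HasDerivAt (fun x => (sinE E x : ℂ)) (cosE E x : ℂ) x :=
  (hasDerivAt_sinE E x).ofReal_comp

lemma continuous_cosE (E : ℝ) : Continuous (cosE E) :=
  continuous_iff_continuousAt.2 fun x => (hasDerivAt_cosE E x).continuousAt

lemma continuous_sinE (E : ℝ) : Continuous (sinE E) :=
  continuous_iff_continuousAt.2 fun x => (hasDerivAt_sinE E x).continuousAt

lemma isH2_cosE (E : ℝ) : IsH2 (fun x => (cosE E x : ℂ)) (fun x => -E * (sinE E x : ℂ))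
    (fun x => -E * (cosE E x : ℂ)) :=
  IsH2.of_smooth (hasDerivAt_cosE_ofReal E) (fun x => (hasDerivAt_sinE_ofReal E x).const_mul _)
    (continuous_const.mul (Complex.continuous_ofReal.comp (continuous_cosE E)))

lemma isH2_sinE (E : ℝ) : IsH2 (fun x => (sinE E x : ℂ)) (fun x => (cosE E x : ℂ))
    (fun x => -E * (sinE E x : ℂ)) :=
  IsH2.of_smooth (hasDerivAt_sinE_ofReal E) (hasDerivAt_cosE_ofReal E)
    (continuous_const.mul (Complex.continuous_ofReal.comp (continuous_sinE E)))

lemma cosE_sq_add_ofReal (E x : ℝ) : (cosE E x : ℂ) ^ 2 + E * (sinE E x : ℂ) ^ 2 = 1 := by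
  exact_mod_cast cosE_sq_add E x

/-- Solutions of `-w'' = E w` are combinations of the fundamental system. -/
lemma IsH2.eq_fundamental {w w₁ w₂ : ℝ → ℂ} {E : ℝ} (h : IsH2 w w₁ w₂)
    (he : w₂ =ᵐ[edgeMeasure] fun x => -E * w x) {x : ℝ} (hx : x ∈ Icc 0 π) :
    w x = w 0 * cosE E x + w₁ 0 * sinE E x ∧ w₁ x = w₁ 0 * cosE E x - E * w 0 * sinE E x := by
  -- The Wronskians with `cosE` and `sinE` are constant. Together with `cosE² + E sinE² = 1` this is
  -- a linear system for `w x` and `w₁ x`.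
  have h1 := (h.wronskian (isH2_cosE E)).eq_const (by
    filter_upwards [he] with t ht
    simp only [Pi.zero_apply]
    rw [ht]; ring) x hx
  have h2 := (h.wronskian (isH2_sinE E)).eq_const (by
    filter_upwards [he] with t ht
    simp only [Pi.zero_apply]
    rw [ht]; ring) x hx
  have h3 := cosE_sq_add_ofReal E x
  simp only [cosE_zero, sinE_zero, Complex.ofReal_one, Complex.ofReal_zero] at h1 h2
  constructor
  · linear_combination (sinE E x : ℂ) * h1 - (cosE E x : ℂ) * h2 - w x * h3
  · linear_combination (cosE E x : ℂ) * h1 + (E * sinE E x : ℂ) * h2 - w₁ x * h3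

/-- A particular solution of `-w'' = E w + y` with vanishing initial data. -/
lemma exists_particular (E : ℝ) : ∃ K, 0 ≤ K ∧ ∀ y : ℝ → ℂ, MemLp y 2 edgeMeasure →
    ∃ p p₁ : ℝ → ℂ, IsH2 p p₁ (fun x => -y x - E * p x) ∧ p 0 = 0 ∧ p₁ 0 = 0 ∧
      ∀ x ∈ Icc 0 π, ‖p x‖ ≤ K * edgeNorm y ∧ ‖p₁ x‖ ≤ K * edgeNorm y := by
  obtain ⟨M₁, h1⟩ := isCompact_Icc.exists_bound_of_continuousOn (isH2_cosE E).continuousOn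
  obtain ⟨M₂, h2⟩ := isCompact_Icc.exists_bound_of_continuousOn (isH2_sinE E).continuousOn
  set M := max M₁ M₂
  have hc : ∀ x ∈ Icc 0 π, ‖(cosE E x : ℂ)‖ ≤ M := fun x hx => (h1 x hx).trans (le_max_left _ _)
  have hs : ∀ x ∈ Icc 0 π, ‖(sinE E x : ℂ)‖ ≤ M := fun x hx => (h2 x hx).trans (le_max_right _ _)
  have hM : 0 ≤ M := (norm_nonneg _).trans (hc 0 ⟨le_rfl, Real.pi_pos.le⟩)
  refine ⟨M * (2 * M) * (2 + |E|), by positivity, fun y hy => ?_⟩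
  have hyi : IntervalIntegrable y volume 0 π := by
    rw [intervalIntegrable_iff_integrableOn_Ioo_of_le Real.pi_pos.le]
    exact hy.integrable (by norm_num)
  set Ic : ℝ → ℂ := fun x => ∫ t in (0 : ℝ)..x, cosE E t * y t with hIc
  set Is : ℝ → ℂ := fun x => ∫ t in (0 : ℝ)..x, sinE E t * y t with hIs
  have hprim : ∀ v : ℝ → ℂ, Continuous v →
      IsPrimitive (fun x => ∫ t in (0 : ℝ)..x, v t * y t) (fun x => v x * y x) := fun v hv =>
    ⟨hyi.continuousOn_mul hv.continuousOn, fun x _ => by simp⟩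
  have pc : IsPrimitive Ic (fun x => cosE E x * y x) :=
    hprim _ (Complex.continuous_ofReal.comp (continuous_cosE E))
  have ps : IsPrimitive Is (fun x => sinE E x * y x) :=
    hprim _ (Complex.continuous_ofReal.comp (continuous_sinE E))
  have qc := (isH2_cosE E).isPrimitive
  have qs := (isH2_sinE E).isPrimitive
  -- Variation of constants: the solution is minus the convolution of `sinE` with `y`, expanded by
  -- the addition theorem.
  have hp : IsPrimitive (fun x => cosE E x * Is x - sinE E x * Ic x)
      (fun x => -(cosE E x * Ic x + E * sinE E x * Is x)) := by
    refine ((qc.mul ps).add ((qs.mul pc).const_mul (-1))).congr (fun x _ => ?_)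
      (Eventually.of_forall fun x => ?_)
    · simp only [Pi.add_apply, Pi.mul_apply]; ring
    · simp only [Pi.add_apply, Pi.mul_apply]; ring
  have hp₁ : IsPrimitive (fun x => -(cosE E x * Ic x + E * sinE E x * Is x))
      (fun x => -y x - E * (cosE E x * Is x - sinE E x * Ic x)) := by
    refine (((qc.mul pc).add ((qs.mul ps).const_mul E)).const_mul (-1)).congr (fun x _ => ?_)
      (Eventually.of_forall fun x => ?_)
    · simp only [Pi.add_apply, Pi.mul_apply]; ring
    · simp only [Pi.add_apply, Pi.mul_apply]
      linear_combination (-y x) * cosE_sq_add_ofReal E x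
  refine ⟨_, _, IsH2.of_isPrimitive hp hp₁ ?_, by simp [hIc, hIs], by simp [hIc, hIs],
    fun x hx => ?_⟩
  · exact hy.neg.sub ((memLp_edge_of_continuousOn hp.continuousOn).const_mul (E : ℂ))
  · have b1 := norm_integral_mul_le hy hc hx
    have b2 := norm_integral_mul_le hy hs hx
    have hN := edgeNorm_nonneg y
    have c1 : ‖(cosE E x : ℂ) * Ic x‖ ≤ M * (2 * M * edgeNorm y) := by
      rw [norm_mul]; exact mul_le_mul (hc x hx) b1 (norm_nonneg _) hM
    have c2 : ‖(sinE E x : ℂ) * Is x‖ ≤ M * (2 * M * edgeNorm y) := by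
      rw [norm_mul]; exact mul_le_mul (hs x hx) b2 (norm_nonneg _) hM
    have c3 : ‖(cosE E x : ℂ) * Is x‖ ≤ M * (2 * M * edgeNorm y) := by
      rw [norm_mul]; exact mul_le_mul (hc x hx) b2 (norm_nonneg _) hM
    have c4 : ‖(sinE E x : ℂ) * Ic x‖ ≤ M * (2 * M * edgeNorm y) := by
      rw [norm_mul]; exact mul_le_mul (hs x hx) b1 (norm_nonneg _) hM
    have hB : 0 ≤ M * (2 * M * edgeNorm y) := by positivity
    constructor
    · refine (norm_sub_le _ _).trans ?_
      nlinarith [abs_nonneg E, mul_nonneg hB (abs_nonneg E)]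
    · rw [norm_neg]
      refine (norm_add_le _ _).trans ?_
      rw [mul_assoc (E : ℂ), norm_mul (E : ℂ), Complex.norm_real, Real.norm_eq_abs]
      have := mul_le_mul_of_nonneg_left c2 (abs_nonneg E)
      nlinarith

/-- Solution of the Dirichlet problem for `-w'' = E w + y`, with the derivatives at the end
points. -/
lemma exists_edge_solution {E : ℝ} (hS : sinPi E ≠ 0) : ∃ K, 0 ≤ K ∧ ∀ y : ℝ → ℂ,
    MemLp y 2 edgeMeasure → ∃ r r' : ℂ, ‖r‖ ≤ K * edgeNorm y ∧ ‖r'‖ ≤ K * edgeNorm y ∧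
      ∀ b b' : ℂ, ∃ w w₁ : ℝ → ℂ, IsH2 w w₁ (fun x => -y x - E * w x) ∧ w 0 = b ∧ w π = b' ∧
        (∀ x ∈ Icc 0 π, ‖w x‖ ≤ K * (‖b‖ + ‖b'‖ + edgeNorm y)) ∧
        w₁ 0 = (b' - cosPi E * b) / sinPi E + r ∧
        w₁ π = (cosPi E * b' - b) / sinPi E + r' := by
  obtain ⟨K₀, hK₀, H⟩ := exists_particular E
  obtain ⟨M₁, h1⟩ := isCompact_Icc.exists_bound_of_continuousOn (isH2_cosE E).continuousOn
  obtain ⟨M₂, h2⟩ := isCompact_Icc.exists_bound_of_continuousOn (isH2_sinE E).continuousOn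
  set M := max M₁ M₂
  have hc : ∀ x ∈ Icc 0 π, ‖(cosE E x : ℂ)‖ ≤ M := fun x hx => (h1 x hx).trans (le_max_left _ _)
  have hs : ∀ x ∈ Icc 0 π, ‖(sinE E x : ℂ)‖ ≤ M := fun x hx => (h2 x hx).trans (le_max_right _ _)
  have hM : 0 ≤ M := (norm_nonneg _).trans (hc 0 ⟨le_rfl, Real.pi_pos.le⟩)
  have hSC : (sinPi E : ℂ) ≠ 0 := Complex.ofReal_ne_zero.2 hS
  set q : ℝ := ‖((sinPi E : ℂ))⁻¹‖ with hq
  set d : ℝ := ‖(cosPi E : ℂ)‖ with hd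
  have hq0 : 0 ≤ q := norm_nonneg _
  have hd0 : 0 ≤ d := norm_nonneg _
  refine ⟨K₀ + K₀ * q + K₀ * d * q + M + M * q * (1 + d + K₀), by positivity, fun y hy => ?_⟩
  obtain ⟨p, p₁, hp, hp0, hp₁0, hb⟩ := H y hy
  have hN := edgeNorm_nonneg y
  obtain ⟨hbπ, hbπ'⟩ := hb π ⟨Real.pi_pos.le, le_rfl⟩
  -- These corrections come from cancelling `p π` at the right end by a multiple of `sinE`. They do
  -- not depend on the boundary values `b`, `b'`.
  refine ⟨-p π / sinPi E, p₁ π - cosPi E * p π / sinPi E, ?_, ?_, fun b b' => ?_⟩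
  · rw [neg_div, norm_neg, div_eq_mul_inv, norm_mul, ← hq]
    have := mul_le_mul_of_nonneg_right hbπ hq0
    have h0 : 0 ≤ (K₀ + K₀ * d * q + M + M * q * (1 + d + K₀)) * edgeNorm y := by positivity
    nlinarith
  · refine (norm_sub_le _ _).trans ?_
    rw [div_eq_mul_inv, norm_mul, norm_mul, ← hq, ← hd]
    have := mul_le_mul_of_nonneg_right (mul_le_mul_of_nonneg_left hbπ hd0) hq0
    have h0 : 0 ≤ (K₀ * q + M + M * q * (1 + d + K₀)) * edgeNorm y := by positivity
    nlinarith
  · set D : ℂ := (b' - p π - b * cosPi E) / sinPi E with hD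
    have hDn : ‖D‖ ≤ (‖b'‖ + K₀ * edgeNorm y + ‖b‖ * d) * q := by
      rw [hD, div_eq_mul_inv, norm_mul, ← hq]
      refine mul_le_mul_of_nonneg_right ?_ hq0
      refine (norm_sub_le _ _).trans ?_
      rw [norm_mul, ← hd]
      have := norm_sub_le b' (p π)
      linarith
    refine ⟨fun x => p x + (b * cosE E x + D * sinE E x),
      fun x => p₁ x + (b * (-E * sinE E x) + D * cosE E x), ?_, ?_, ?_, fun x hx => ?_, ?_, ?_⟩
    · refine (hp.add (((isH2_cosE E).smul b).add ((isH2_sinE E).smul D))).congr (fun x => rfl)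
        (fun x => rfl) (Eventually.of_forall fun x => ?_)
      simp only [Pi.add_apply, Pi.smul_apply, smul_eq_mul]; ring
    · simp [hp0, cosE_zero, sinE_zero]
    · change p π + (b * cosPi E + D * sinPi E) = b'
      rw [hD]; field_simp; ring
    · have e1 := (hb x hx).1
      have e2 : ‖b * (cosE E x : ℂ)‖ ≤ ‖b‖ * M := by
        rw [norm_mul]; exact mul_le_mul_of_nonneg_left (hc x hx) (norm_nonneg _)
      have e3 : ‖D * (sinE E x : ℂ)‖ ≤ (‖b'‖ + K₀ * edgeNorm y + ‖b‖ * d) * q * M := by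
        rw [norm_mul]; exact mul_le_mul hDn (hs x hx) (norm_nonneg _) (by positivity)
      refine (norm_add_le _ _).trans (?_ : _ + _ ≤ _)
      refine (add_le_add e1 ((norm_add_le _ _).trans (add_le_add e2 e3))).trans ?_
      have hb0 := norm_nonneg b
      have hb'0 := norm_nonneg b'
      have h0 : 0 ≤ (K₀ * q + K₀ * d * q) * (‖b‖ + ‖b'‖ + edgeNorm y) := by positivity
      have h1 : 0 ≤ K₀ * (‖b‖ + ‖b'‖) := by positivity
      have h2 : 0 ≤ M * (‖b'‖ + edgeNorm y) := by positivity
      have h3 : 0 ≤ M * q * (‖b‖ + edgeNorm y + d * (‖b'‖ + edgeNorm y) + K₀ * (‖b‖ + ‖b'‖)) := by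
        positivity
      nlinarith
    · simp only [hp₁0, cosE_zero, sinE_zero, Complex.ofReal_one, Complex.ofReal_zero]
      rw [hD]; field_simp; ring
    · change p₁ π + (b * (-E * sinPi E) + D * cosPi E) = _
      have h3 : (cosPi E : ℂ) ^ 2 + E * (sinPi E : ℂ) ^ 2 = 1 := cosE_sq_add_ofReal E π
      rw [hD]; field_simp
      linear_combination (-b) * h3

/-! ### The magnetic Laplacian in the gauge without vector potential on the edges -/

/-- `(f, g)` belongs to the graph of the magnetic Laplacian, with vertex values `ψ` and gauge
transformed functions `w` on the edges. -/
structure GaugedGraph (α A : ℤ → ℝ) (f g : L2Graph) (ψ : ℤ → ℂ) (w w₁ w₂ : ℤ → Bool → ℝ → ℂ) :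
    Prop where
  isH2 : ∀ j s, IsH2 (w j s) (w₁ j s) (w₂ j s)
  fst : ∀ j s, onEdge f (j, s) =ᵐ[edgeMeasure] fun x => phase (-(orient s * A j)) x * w j s x
  snd : ∀ j s, onEdge g (j, s) =ᵐ[edgeMeasure] fun x => -(phase (-(orient s * A j)) x * w₂ j s x)
  left : ∀ j s, w j s 0 = ψ j
  right : ∀ j s, w j s π = phase (orient s * A j) π * ψ (j + 1)
  kirchhoff : ∀ j, (∑ s : Bool, w₁ j s 0)
    - (∑ s : Bool, phase (-(orient s * A (j - 1))) π * w₁ (j - 1) s π) = α j * ψ j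

lemma inLaplacianGraph_iff {α A : ℤ → ℝ} {f g : L2Graph} :
    InLaplacianGraph α A f g ↔ ∃ ψ w w₁ w₂, GaugedGraph α A f g ψ w w₁ w₂ := by
  constructor
  · rintro ⟨u, u₁, u₂, hu, hf, hg, hd⟩
    refine ⟨fun j => u j true 0, fun j s x => phase (orient s * A j) x * u j s x,
      fun j s x => phase (orient s * A j) x * quasiDeriv (orient s * A j) (u j s) (u₁ j s) x,
      fun j s x => -(phase (orient s * A j) x
        * magneticSchrodinger (orient s * A j) (u j s) (u₁ j s) (u₂ j s) x),
      fun j s => (hu j s).phase_mul _, fun j s => ?_, fun j s => ?_, fun j s => ?_, fun j s => ?_,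
      fun j => ?_⟩
    · filter_upwards [hf j s] with x hx
      rw [hx, ← mul_assoc, phase_neg_mul, one_mul]
    · filter_upwards [hg j s] with x hx
      rw [hx, mul_neg, neg_neg, ← mul_assoc, phase_neg_mul, one_mul]
    · cases s
      · simp [phase_zero, (hd j).cont_low]
      · simp [phase_zero]
    · have := (hd (j + 1)).cont_left s
      rw [add_sub_cancel_right] at this
      simp only [this]
    · rw [← (hd j).kirchhoff]
      simp only [phase_zero, one_mul, ← mul_assoc, phase_neg_mul]
  · rintro ⟨ψ, w, w₁, w₂, h⟩
    refine ⟨fun j s x => phase (-(orient s * A j)) x * w j s x,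
      fun j s x => phase (-(orient s * A j)) x * quasiDeriv (-(orient s * A j)) (w j s) (w₁ j s) x,
      fun j s x => -(phase (-(orient s * A j)) x
        * magneticSchrodinger (-(orient s * A j)) (w j s) (w₁ j s) (w₂ j s) x),
      fun j s => (h.isH2 j s).phase_mul _, h.fst, fun j s => ?_, fun j => ⟨?_, fun s => ?_, ?_⟩⟩
    · filter_upwards [h.snd j s] with x hx
      rw [hx, magneticSchrodinger_phase_neg]
    · simp [phase_zero, h.left]
    · have := h.right (j - 1) s
      rw [sub_add_cancel] at this
      simp only [this, ← mul_assoc, phase_neg_mul, one_mul, phase_zero, h.left]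
    · simp only [quasiDeriv_phase_neg, phase_zero, one_mul, h.left]
      exact h.kirchhoff j

lemma inLaplacianGraph_apply {α A : ℤ → ℝ} (x : (magneticLaplacian α A).domain) :
    InLaplacianGraph α A x (magneticLaplacian α A x) :=
  (mem_graph_magneticLaplacian _ _ _ _).1 (LinearPMap.mem_graph _ x)

lemma exists_mem_domain {α A : ℤ → ℝ} {f g : L2Graph} (h : InLaplacianGraph α A f g) :
    ∃ hf : f ∈ (magneticLaplacian α A).domain, magneticLaplacian α A ⟨f, hf⟩ = g := by
  obtain ⟨x, hx, hx'⟩ := (LinearPMap.mem_graph_iff _).1 ((mem_graph_magneticLaplacian _ _ _ _).2 h)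
  simp only at hx hx'
  subst hx
  exact ⟨x.2, hx'⟩

lemma edgeNorm_phase_mul (a : ℝ) (u : ℝ → ℂ) : edgeNorm (fun x => phase a x * u x) = edgeNorm u :=
  edgeNorm_congr_norm fun x => by rw [norm_mul, norm_phase, one_mul]

lemma norm_onEdge_eq {f : L2Graph} {e : Edge} {u : ℝ → ℂ} (h : onEdge f e =ᵐ[edgeMeasure] u) :
    ‖onEdge f e‖ = edgeNorm u := by
  rw [← edgeNorm_coe, edgeNorm_congr h]

lemma memℓp_onEdge (f : L2Graph) (s : Bool) : Memℓp (fun j : ℤ => ‖onEdge f (j, s)‖) 2 := by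
  have h := memℓp_two_iff.1 (lp.memℓp f)
  rw [memℓp_two_iff]
  have h' := h.comp_injective (i := fun j : ℤ => ((j, s) : Edge)) fun a b hab => by simpa using hab
  refine h'.congr fun j => ?_
  simp [onEdge]

lemma memℓp_of_norm_le {ι : Type*} {E : ι → Type*} [∀ i, NormedAddCommGroup (E i)]
    {f : ∀ i, E i} {g : ι → ℝ} (hg : Memℓp g 2) (h : ∀ i, ‖f i‖ ≤ g i) : Memℓp f 2 := by
  rw [memℓp_two_iff] at hg ⊢
  refine Summable.of_nonneg_of_le (fun i => sq_nonneg _) (fun i => ?_) hg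
  have := h i
  rw [Real.norm_eq_abs, sq_abs]
  exact pow_le_pow_left₀ (norm_nonneg _) this 2

lemma memℓp_norm {ψ : ℤ → ℂ} (h : Memℓp ψ 2) : Memℓp (fun j => ‖ψ j‖) 2 := by
  rw [memℓp_two_iff] at h ⊢
  simpa using h

/-- Elements of `L²(Γ)` from functions on the edges. -/
lemma exists_L2Graph {u : Edge → ℝ → ℂ} (hu : ∀ e, MemLp (u e) 2 edgeMeasure) {B : Edge → ℝ}
    (hB : Memℓp B 2) (h : ∀ e, edgeNorm (u e) ≤ B e) :
    ∃ f : L2Graph, ∀ e, onEdge f e =ᵐ[edgeMeasure] u e :=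
  ⟨⟨fun e => (hu e).toLp (u e), memℓp_of_norm_le hB fun e => by
    rw [Lp.norm_toLp]; exact h e⟩, fun e => (hu e).coeFn_toLp⟩

lemma memℓp_edge {B : ℤ → Bool → ℝ} (h : ∀ s, Memℓp (fun j => B j s) 2) :
    Memℓp (fun e : Edge => B e.1 e.2) 2 := by
  simp only [memℓp_two_iff] at h ⊢
  rw [summable_prod_of_nonneg (fun e => sq_nonneg _)]
  refine ⟨fun j => Summable.of_finite, ?_⟩
  simp only [tsum_fintype, Fintype.sum_bool]
  exact (h true).add (h false)

namespace GaugedGraph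

variable {α A : ℤ → ℝ} {f g : L2Graph} {ψ : ℤ → ℂ} {w w₁ w₂ : ℤ → Bool → ℝ → ℂ}

lemma edgeNorm_fst (h : GaugedGraph α A f g ψ w w₁ w₂) (j : ℤ) (s : Bool) :
    edgeNorm (w j s) = ‖onEdge f (j, s)‖ := by
  rw [norm_onEdge_eq (h.fst j s), edgeNorm_phase_mul]

lemma edgeNorm_snd (h : GaugedGraph α A f g ψ w w₁ w₂) (j : ℤ) (s : Bool) :
    edgeNorm (w₂ j s) = ‖onEdge g (j, s)‖ := by
  rw [norm_onEdge_eq (h.snd j s), ← edgeNorm_phase_mul (-(orient s * A j)) (w₂ j s)]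
  exact edgeNorm_congr_norm fun x => by rw [norm_neg]

/-- The `H²` trace bound has the same constant on all edges, so square summability passes from the
edge norms of `f` and `g` to the vertex values. -/
lemma memℓp_value (h : GaugedGraph α A f g ψ w w₁ w₂) : Memℓp ψ 2 := by
  obtain ⟨K, -, H⟩ := exists_trace_bound
  refine memℓp_of_norm_le (((memℓp_onEdge f true).add (memℓp_onEdge g true)).const_mul K)
    fun j => ?_
  rw [← h.left j true]
  simpa only [Pi.add_apply, ← h.edgeNorm_fst, ← h.edgeNorm_snd] using (H _ _ _ (h.isH2 j true)).1

lemma memℓp_deriv (h : GaugedGraph α A f g ψ w w₁ w₂) (s : Bool) :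
    Memℓp (fun j => w₁ j s 0) 2 := by
  obtain ⟨K, -, H⟩ := exists_trace_bound
  refine memℓp_of_norm_le (((memℓp_onEdge f s).add (memℓp_onEdge g s)).const_mul K)
    fun j => ?_
  simpa only [Pi.add_apply, ← h.edgeNorm_fst, ← h.edgeNorm_snd] using (H _ _ _ (h.isH2 j s)).2

/-- `f` satisfies `-𝒟² f = E f` on the edge `(j, s)`. -/
lemma ae_eq_of_homogeneous (h : GaugedGraph α A f g ψ w w₁ w₂) {E : ℝ} {j : ℤ} {s : Bool}
    (he : onEdge g (j, s) = (E : ℂ) • onEdge f (j, s)) :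
    w₂ j s =ᵐ[edgeMeasure] fun x => -E * w j s x := by
  have h1 := h.snd j s
  rw [he] at h1
  filter_upwards [h1, h.fst j s, Lp.coeFn_smul (E : ℂ) (onEdge f (j, s))] with x hx hx' hx''
  rw [hx'', Pi.smul_apply, hx', smul_eq_mul] at hx
  have hne := phase_ne_zero (-(orient s * A j)) x
  have : phase (-(orient s * A j)) x * w₂ j s x
      = phase (-(orient s * A j)) x * (-E * w j s x) := by linear_combination hx
  exact mul_left_cancel₀ hne this

lemma deriv_of_homogeneous (h : GaugedGraph α A f g ψ w w₁ w₂) {E : ℝ} (hS : sinPi E ≠ 0) {j : ℤ}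
    {s : Bool} (he : onEdge g (j, s) = (E : ℂ) • onEdge f (j, s)) :
    w₁ j s 0 = (phase (orient s * A j) π * ψ (j + 1) - cosPi E * ψ j) / sinPi E ∧
    w₁ j s π = (cosPi E * (phase (orient s * A j) π * ψ (j + 1)) - ψ j) / sinPi E := by
  obtain ⟨h1, h2⟩ := (h.isH2 j s).eq_fundamental (h.ae_eq_of_homogeneous he)
    (x := π) ⟨Real.pi_pos.le, le_rfl⟩
  rw [h.right, h.left] at h1
  rw [h.left] at h2
  have hSC : (sinPi E : ℂ) ≠ 0 := Complex.ofReal_ne_zero.2 hS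
  have h3 : (cosPi E : ℂ) ^ 2 + E * (sinPi E : ℂ) ^ 2 = 1 := cosE_sq_add_ofReal E π
  change _ = ψ j * (cosPi E : ℂ) + w₁ j s 0 * (sinPi E : ℂ) at h1
  change _ = w₁ j s 0 * (cosPi E : ℂ) - E * ψ j * (sinPi E : ℂ) at h2
  constructor
  · field_simp; linear_combination -h1
  · rw [h2]; field_simp
    linear_combination (-(cosPi E : ℂ)) * h1 - ψ j * h3

lemma phase_add_phase_neg (a : ℝ) : phase a π + phase (-a) π = 2 * (Real.cos (a * π) : ℂ) := by
  rw [phase, phase, Complex.ofReal_cos, Complex.cos]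
  push_cast
  rw [show Complex.I * (a : ℂ) * π = a * π * Complex.I by ring,
    show Complex.I * -(a : ℂ) * π = -(a * π) * Complex.I by ring]
  ring

/-- The difference equation for the vertex values. -/
lemma difference_eq (h : GaugedGraph α A f g ψ w w₁ w₂) {E : ℝ} (hS : sinPi E ≠ 0) {j : ℤ}
    (he : ∀ s, onEdge g (j, s) = (E : ℂ) • onEdge f (j, s))
    (he' : ∀ s, onEdge g (j - 1, s) = (E : ℂ) • onEdge f (j - 1, s)) :
    (Real.cos (A j * π) : ℂ) * ψ (j + 1) + (Real.cos (A (j - 1) * π) : ℂ) * ψ (j - 1)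
      = (2 * disc (α j) E : ℝ) * ψ j := by
  have hk := h.kirchhoff j
  have hSC : (sinPi E : ℂ) ≠ 0 := Complex.ofReal_ne_zero.2 hS
  simp only [Fintype.sum_bool, (h.deriv_of_homogeneous hS (he _)).1,
    (h.deriv_of_homogeneous hS (he' _)).2, sub_add_cancel, orient, one_mul, neg_mul,
    neg_neg] at hk
  have p1 := phase_add_phase_neg (A j)
  have p2 := phase_add_phase_neg (A (j - 1))
  have p3 := phase_neg_mul (A (j - 1)) π
  field_simp at hk
  rw [disc]; push_cast at p1 p2 ⊢
  linear_combination hk / 2 - ψ (j + 1) / 2 * p1 - ψ (j - 1) / 2 * p2 + (cosPi E : ℂ) * ψ j * p3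

lemma onEdge_eq_zero (h : GaugedGraph α A f g ψ w w₁ w₂) {E : ℝ} (hS : sinPi E ≠ 0) {j : ℤ}
    {s : Bool} (he : onEdge g (j, s) = (E : ℂ) • onEdge f (j, s)) (h0 : ψ j = 0)
    (h1 : ψ (j + 1) = 0) : onEdge f (j, s) = 0 := by
  have hd := (h.deriv_of_homogeneous hS he).1
  rw [h0, h1] at hd
  have hw : ∀ x ∈ Icc 0 π, w j s x = 0 := fun x hx => by
    rw [((h.isH2 j s).eq_fundamental (h.ae_eq_of_homogeneous he) hx).1, h.left, h0, hd]
    simp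
  refine Lp.ext ?_
  have hm : ∀ᵐ x ∂edgeMeasure, x ∈ Ioo 0 π := ae_restrict_mem measurableSet_Ioo
  filter_upwards [h.fst j s, Lp.coeFn_zero ℂ 2 edgeMeasure, hm] with x hx hx' hx''
  rw [hx, hx', hw x (Ioo_subset_Icc_self hx''), mul_zero]; rfl

end GaugedGraph

/-- Lifting of solutions of the inhomogeneous difference equation to the graph. -/
lemma exists_lift (α A : ℤ → ℝ) {E : ℝ} (hS : sinPi E ≠ 0) (y : L2Graph) :
    ∃ r : ℤ → ℂ, Memℓp r 2 ∧ (y = 0 → r = 0) ∧ ∀ ψ : ℤ → ℂ, Memℓp ψ 2 →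
      (∀ j, (Real.cos (A j * π) : ℂ) * ψ (j + 1) + (Real.cos (A (j - 1) * π) : ℂ) * ψ (j - 1)
        - (2 * disc (α j) E : ℝ) * ψ j = r j) →
      ∃ f w w₁ w₂, GaugedGraph α A f (y + (E : ℂ) • f) ψ w w₁ w₂ := by
  obtain ⟨K, hK, H⟩ := exists_edge_solution hS
  set a : ℤ → Bool → ℝ := fun j s => orient s * A j with ha
  set Y : ℤ → Bool → ℝ → ℂ := fun j s x => phase (a j s) x * onEdge y (j, s) x with hY
  have hphase : ∀ b : ℝ, ∀ v : ℝ → ℂ, MemLp v 2 edgeMeasure →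
      MemLp (fun x => phase b x * v x) 2 edgeMeasure := fun b v hv =>
    hv.of_le ((continuous_phase b).aestronglyMeasurable.mul hv.aestronglyMeasurable)
      (Eventually.of_forall fun x => by rw [norm_mul, norm_phase, one_mul])
  have hYm : ∀ j s, MemLp (Y j s) 2 edgeMeasure := fun j s => hphase _ _ (Lp.memLp _)
  have hYn : ∀ j s, edgeNorm (Y j s) = ‖onEdge y (j, s)‖ := fun j s => by
    rw [hY, edgeNorm_phase_mul, edgeNorm_coe]
  choose r r' hr hr' hsol using fun j s => H (Y j s) (hYm j s)
  -- The contribution of `y` to the Kirchhoff condition, after multiplying that condition by `sinPi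
  -- E / 2` to bring it into the form of the difference equation.
  set R : ℤ → ℂ := fun j => -(sinPi E / 2 : ℂ) * (∑ s, r j s - ∑ s, phase (-(a (j - 1) s)) π
    * r' (j - 1) s) with hR
  have hRb : ∀ j, ‖R j‖ ≤ ‖(sinPi E / 2 : ℂ)‖ * K * (‖onEdge y (j, true)‖ + ‖onEdge y (j, false)‖
      + (‖onEdge y (j + -1, true)‖ + ‖onEdge y (j + -1, false)‖)) := by
    intro j
    rw [hR]
    simp only [norm_mul, norm_neg, mul_assoc]
    refine mul_le_mul_of_nonneg_left ?_ (norm_nonneg _)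
    simp only [Fintype.sum_bool]
    refine (norm_sub_le _ _).trans ((add_le_add (norm_add_le _ _) (norm_add_le _ _)).trans ?_)
    simp only [norm_mul, norm_phase, one_mul]
    have e1 := hr j true
    have e2 := hr j false
    have e3 := hr' (j - 1) true
    have e4 := hr' (j - 1) false
    rw [hYn] at e1 e2 e3 e4
    rw [← sub_eq_add_neg j 1]
    linarith
  have hsh : ∀ s, Memℓp (fun j : ℤ => ‖onEdge y (j + -1, s)‖) 2 := fun s => by
    have := memℓp_two_iff.1 (memℓp_onEdge y s)
    rw [memℓp_two_iff]
    exact this.comp_injective (i := fun j : ℤ => j + -1) (add_left_injective _)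
  refine ⟨R, ?_, ?_, fun ψ hψ heq => ?_⟩
  · exact memℓp_of_norm_le ((((memℓp_onEdge y true).add (memℓp_onEdge y false)).add
      ((hsh true).add (hsh false))).const_mul _) hRb
  · rintro rfl
    funext j
    have hz : ∀ e, onEdge (0 : L2Graph) e = 0 := fun e => rfl
    have := hRb j
    simp only [hz, norm_zero, add_zero, mul_zero] at this
    simpa using this
  · choose w w₁ hw hw0 hwπ hwb hd0 hdπ using fun j s =>
      hsol j s (ψ j) (phase (a j s) π * ψ (j + 1))
    set B : ℤ → Bool → ℝ := fun j s => 2 * K * (‖ψ j‖ + ‖ψ (j + 1)‖ + ‖onEdge y (j, s)‖) with hB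
    have hBm : Memℓp (fun e : Edge => B e.1 e.2) 2 := memℓp_edge fun s =>
      (((memℓp_norm hψ).add (memℓp_norm (memℓp_comp_add hψ 1))).add (memℓp_onEdge y s)).const_mul _
    obtain ⟨f, hf⟩ := exists_L2Graph (u := fun e x => phase (-(a e.1 e.2)) x * w e.1 e.2 x)
      (fun e => hphase _ _ (hw e.1 e.2).memLp₀) hBm (fun e => by
        rw [edgeNorm_phase_mul]
        refine (edgeNorm_le_of_bound (hwb e.1 e.2)).trans ?_
        rw [hYn, norm_mul, norm_phase, one_mul, hB]
        simp only
        linarith)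
    refine ⟨f, w, w₁, fun j s x => -Y j s x - E * w j s x, hw, fun j s => hf (j, s),
      fun j s => ?_, hw0, hwπ, fun j => ?_⟩
    · have e1 : onEdge (y + (E : ℂ) • f) (j, s) = onEdge y (j, s) + (E : ℂ) • onEdge f (j, s) := rfl
      rw [e1]
      filter_upwards [Lp.coeFn_add (onEdge y (j, s)) ((E : ℂ) • onEdge f (j, s)),
        Lp.coeFn_smul (E : ℂ) (onEdge f (j, s)), hf (j, s)] with x h1 h2 h3
      rw [h1, Pi.add_apply, h2, Pi.smul_apply, h3, smul_eq_mul]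
      have := phase_neg_mul (a j s) x
      simp only [hY, ha] at this ⊢
      linear_combination (-(onEdge y (j, s) x)) * this
    · have hk := heq j
      have hSC : (sinPi E : ℂ) ≠ 0 := Complex.ofReal_ne_zero.2 hS
      rw [hR] at hk
      simp only [hd0, hdπ, Fintype.sum_bool, sub_add_cancel, ha, orient, one_mul, neg_mul,
        neg_neg] at hk ⊢
      have p1 := GaugedGraph.phase_add_phase_neg (A j)
      have p2 := GaugedGraph.phase_add_phase_neg (A (j - 1))
      have p3 := phase_neg_mul (A (j - 1)) π
      rw [disc] at hk; push_cast at p1 p2 hk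
      field_simp
      linear_combination 2 * hk + ψ (j + 1) * p1 + ψ (j - 1) * p2 - 2 * (cosPi E : ℂ) * ψ j * p3

/-! ### Symmetry -/

lemma IsPrimitive.conj {F f : ℝ → ℂ} (h : IsPrimitive F f) :
    IsPrimitive (fun x => starRingEnd ℂ (F x)) (fun x => starRingEnd ℂ (f x)) := by
  refine ⟨?_, fun x hx => ?_⟩
  · exact ⟨Complex.conjCLE.integrable_comp_iff.2 h.int.1,
      Complex.conjCLE.integrable_comp_iff.2 h.int.2⟩
  · have := Complex.conjCLE.toContinuousLinearMap.intervalIntegral_comp_comm (sub_interval h.int hx)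
    simp only [ContinuousLinearEquiv.coe_coe, Complex.conjCLE_apply] at this
    rw [this, h.eq x hx, map_add]

lemma IsH2.conj {u u₁ u₂ : ℝ → ℂ} (h : IsH2 u u₁ u₂) :
    IsH2 (fun x => starRingEnd ℂ (u x)) (fun x => starRingEnd ℂ (u₁ x))
      (fun x => starRingEnd ℂ (u₂ x)) :=
  IsH2.of_isPrimitive h.isPrimitive.conj h.isPrimitive₁.conj h.memLp.star

lemma conj_phase (a x : ℝ) : starRingEnd ℂ (phase a x) = phase (-a) x := by
  rw [phase, phase, ← Complex.exp_conj]
  simp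

lemma summable_mul_of_memℓp {φ ψ : ℤ → ℂ} (hφ : Memℓp φ 2) (hψ : Memℓp ψ 2) :
    Summable fun j => φ j * ψ j := by
  refine Summable.of_norm_bounded ((memℓp_two_iff.1 hφ).add (memℓp_two_iff.1 hψ)) fun j => ?_
  rw [norm_mul]
  nlinarith [sq_nonneg (‖φ j‖ - ‖ψ j‖), sq_nonneg (‖φ j‖ + ‖ψ j‖)]

lemma memℓp_conj {ψ : ℤ → ℂ} (hψ : Memℓp ψ 2) : Memℓp (fun j => starRingEnd ℂ (ψ j)) 2 := by
  rw [memℓp_two_iff] at hψ ⊢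
  simpa using hψ

lemma inner_onEdge {f g : L2Graph} {e : Edge} {u v : ℝ → ℂ} {a : ℝ}
    (hf : onEdge f e =ᵐ[edgeMeasure] fun x => phase a x * u x)
    (hg : onEdge g e =ᵐ[edgeMeasure] fun x => phase a x * v x) :
    inner ℂ (onEdge f e) (onEdge g e) = ∫ x, starRingEnd ℂ (u x) * v x ∂edgeMeasure := by
  rw [L2.inner_def]
  refine integral_congr_ae ?_
  filter_upwards [hf, hg] with x h1 h2
  rw [h1, h2, RCLike.inner_apply, map_mul, conj_phase]
  linear_combination (v x * starRingEnd ℂ (u x)) * phase_neg_mul a x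

lemma GaugedGraph.inner_sub_inner {α A : ℤ → ℝ} {f g f' g' : L2Graph} {ψ ψ' : ℤ → ℂ}
    {w w₁ w₂ w' w₁' w₂' : ℤ → Bool → ℝ → ℂ} (h : GaugedGraph α A f g ψ w w₁ w₂)
    (h' : GaugedGraph α A f' g' ψ' w' w₁' w₂') (j : ℤ) (s : Bool) :
    inner ℂ (onEdge g (j, s)) (onEdge f' (j, s)) - inner ℂ (onEdge f (j, s)) (onEdge g' (j, s))
      = (starRingEnd ℂ (w₁ j s 0) * ψ' j - starRingEnd ℂ (ψ j) * w₁' j s 0)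
        - (starRingEnd ℂ (phase (-(orient s * A j)) π * w₁ j s π) * ψ' (j + 1)
          - starRingEnd ℂ (ψ (j + 1)) * (phase (-(orient s * A j)) π * w₁' j s π)) := by
  have e1 := inner_onEdge (u := fun x => -w₂ j s x) (v := w' j s)
    ((h.snd j s).trans (Eventually.of_forall fun x => by ring)) (h'.fst j s)
  have e2 := inner_onEdge (u := w j s) (v := fun x => -w₂' j s x) (h.fst j s)
    ((h'.snd j s).trans (Eventually.of_forall fun x => by ring))
  have hG := (h.isH2 j s).conj.green (h'.isH2 j s)
  have i1 : Integrable (fun x => starRingEnd ℂ (-w₂ j s x) * w' j s x) edgeMeasure := by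
    have := (h.isH2 j s).memLp.neg.star.integrable_mul (h'.isH2 j s).memLp₀
    exact this
  have i2 : Integrable (fun x => starRingEnd ℂ (w j s x) * -w₂' j s x) edgeMeasure := by
    have := (h.isH2 j s).memLp₀.star.integrable_mul (h'.isH2 j s).memLp.neg
    exact this
  rw [e1, e2, ← integral_sub i1 i2]
  have : (fun x => starRingEnd ℂ (-w₂ j s x) * w' j s x - starRingEnd ℂ (w j s x) * -w₂' j s x)
      = fun x => -(starRingEnd ℂ (w₂ j s x) * w' j s x - starRingEnd ℂ (w j s x) * w₂' j s x) := by
    funext x; rw [map_neg]; ring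
  rw [this, integral_neg, hG, h.left, h'.left, h.right, h'.right, map_mul, map_mul, conj_phase,
    conj_phase, neg_neg]
  ring

lemma hasSum_inner_onEdge (f g : L2Graph) :
    HasSum (fun e : Edge => inner ℂ (onEdge f e) (onEdge g e)) (inner ℂ f g) :=
  lp.hasSum_inner f g

lemma hasSum_ring {F : Edge → ℂ} {S : ℂ} (h : HasSum F S) :
    HasSum (fun j => ∑ s, F (j, s)) S :=
  h.prod_fiberwise fun _ => hasSum_fintype _

/-- The Kirchhoff condition at vertex `j + 1` trades the terms at the right ends of ring `j` for
those at the left ends of ring `j + 1`. The `δ`-terms cancel since `α` is real, so the sum over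
rings telescopes. -/
lemma GaugedGraph.sum_inner_sub_inner {α A : ℤ → ℝ} {f g f' g' : L2Graph} {ψ ψ' : ℤ → ℂ}
    {w w₁ w₂ w' w₁' w₂' : ℤ → Bool → ℝ → ℂ} (h : GaugedGraph α A f g ψ w w₁ w₂)
    (h' : GaugedGraph α A f' g' ψ' w' w₁' w₂') (j : ℤ) :
    ∑ s, (inner ℂ (onEdge g (j, s)) (onEdge f' (j, s))
        - inner ℂ (onEdge f (j, s)) (onEdge g' (j, s)))
      = ∑ s, (starRingEnd ℂ (w₁ j s 0) * ψ' j - starRingEnd ℂ (ψ j) * w₁' j s 0)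
        - ∑ s, (starRingEnd ℂ (w₁ (j + 1) s 0) * ψ' (j + 1)
          - starRingEnd ℂ (ψ (j + 1)) * w₁' (j + 1) s 0) := by
  simp only [h.inner_sub_inner h', Finset.sum_sub_distrib, ← Finset.sum_mul, ← Finset.mul_sum,
    ← map_sum]
  have k := h.kirchhoff (j + 1)
  have k' := h'.kirchhoff (j + 1)
  rw [add_sub_cancel_right, sub_eq_iff_eq_add] at k k'
  rw [k, k', map_add, map_mul, Complex.conj_ofReal]
  ring

lemma GaugedGraph.summable_boundary {α A : ℤ → ℝ} {f g f' g' : L2Graph} {ψ ψ' : ℤ → ℂ}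
    {w w₁ w₂ w' w₁' w₂' : ℤ → Bool → ℝ → ℂ} (h : GaugedGraph α A f g ψ w w₁ w₂)
    (h' : GaugedGraph α A f' g' ψ' w' w₁' w₂') :
    Summable fun j => ∑ s, (starRingEnd ℂ (w₁ j s 0) * ψ' j - starRingEnd ℂ (ψ j) * w₁' j s 0) :=
  summable_sum fun s _ =>
    (summable_mul_of_memℓp (memℓp_conj (h.memℓp_deriv s)) h'.memℓp_value).sub
      (summable_mul_of_memℓp (memℓp_conj h.memℓp_value) (h'.memℓp_deriv s))

lemma eq_zero_of_hasSum_telescope {β : ℤ → ℂ} (hβ : Summable β) {S : ℂ}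
    (h : HasSum (fun j => β j - β (j + 1)) S) : S = 0 := by
  have h1 : HasSum (fun j => β (j + 1)) (∑' j, β j) :=
    (Equiv.addRight (1 : ℤ)).hasSum_iff.2 hβ.hasSum
  have h2 := hβ.hasSum.sub h1
  rw [sub_self] at h2
  exact h.unique h2

lemma GaugedGraph.symmetric {α A : ℤ → ℝ} {f g f' g' : L2Graph} {ψ ψ' : ℤ → ℂ}
    {w w₁ w₂ w' w₁' w₂' : ℤ → Bool → ℝ → ℂ} (h : GaugedGraph α A f g ψ w w₁ w₂)
    (h' : GaugedGraph α A f' g' ψ' w' w₁' w₂') :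
    inner ℂ g f' = inner ℂ f g' := by
  have h1 := hasSum_ring ((hasSum_inner_onEdge g f').sub (hasSum_inner_onEdge f g'))
  simp only [h.sum_inner_sub_inner h'] at h1
  exact sub_eq_zero.1 (eq_zero_of_hasSum_telescope (h.summable_boundary h') h1)

lemma magneticLaplacian_symmetric (α A : ℤ → ℝ) (x y : (magneticLaplacian α A).domain) :
    inner ℂ (magneticLaplacian α A x) (y : L2Graph)
      = inner ℂ (x : L2Graph) (magneticLaplacian α A y) := by
  obtain ⟨ψ, w, w₁, w₂, h⟩ := inLaplacianGraph_iff.1 (inLaplacianGraph_apply x)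
  obtain ⟨ψ', w', w₁', w₂', h'⟩ := inLaplacianGraph_iff.1 (inLaplacianGraph_apply y)
  exact h.symmetric h'

/-! ### Spectral consequences -/

/-- The eigenvalue equation in gauged form. -/
lemma exists_gauged_of_eigen {α A : ℤ → ℝ} {E : ℝ} (x : (magneticLaplacian α A).domain) (y : L2Graph)
    (hx : magneticLaplacian α A x - (E : ℂ) • (x : L2Graph) = y) :
    ∃ ψ w w₁ w₂, GaugedGraph α A x (y + (E : ℂ) • (x : L2Graph)) ψ w w₁ w₂ := by
  have := inLaplacianGraph_apply x
  rw [sub_eq_iff_eq_add.1 hx] at this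
  exact inLaplacianGraph_iff.1 this

lemma onEdge_zero_add_smul (E : ℂ) (f : L2Graph) (e : Edge) :
    onEdge (0 + E • f) e = E • onEdge f e := by rw [zero_add]; rfl

/-- A solution of the eigenvalue equation off the Dirichlet spectrum, through its vertex values. -/
lemma exists_value_of_eigen {α A : ℤ → ℝ} {E : ℝ} (hS : sinPi E ≠ 0)
    (x : (magneticLaplacian α A).domain)
    (hx : magneticLaplacian α A x - (E : ℂ) • (x : L2Graph) = 0) :
    ∃ ψ : ℤ → ℂ, Memℓp ψ 2 ∧
      (∀ j, (Real.cos (A j * π) : ℂ) * ψ (j + 1) + (Real.cos (A (j - 1) * π) : ℂ) * ψ (j - 1)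
        = (2 * disc (α j) E : ℝ) * ψ j) ∧
      (∃ w w₁ w₂, GaugedGraph α A x ((E : ℂ) • (x : L2Graph)) ψ w w₁ w₂) ∧ (ψ = 0 → x = 0) := by
  obtain ⟨ψ, w, w₁, w₂, h⟩ := exists_gauged_of_eigen x 0 hx
  have hE := fun e => onEdge_zero_add_smul (E : ℂ) x e
  refine ⟨ψ, h.memℓp_value, fun j => h.difference_eq hS (fun s => hE _) (fun s => hE _),
    ⟨w, w₁, w₂, by rwa [zero_add] at h⟩, fun h0 => Subtype.ext (lp.ext (funext fun e => ?_))⟩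
  exact h.onEdge_eq_zero hS (hE e) (by rw [h0]; rfl) (by rw [h0]; rfl)

/-- Off the Dirichlet spectrum, bijectivity of the magnetic Laplacian follows from bijectivity of
the difference operator. -/
lemma bijective_of_difference {α A : ℤ → ℝ} {E : ℝ} (hS : sinPi E ≠ 0)
    (hinj : ∀ ψ : ℤ → ℂ, Memℓp ψ 2 →
      (∀ j, (Real.cos (A j * π) : ℂ) * ψ (j + 1) + (Real.cos (A (j - 1) * π) : ℂ) * ψ (j - 1)
        = (2 * disc (α j) E : ℝ) * ψ j) → ψ = 0)
    {c₀ ξ₀ : ℝ} (J : Finset ℤ) (h : 2 * |c₀| < |ξ₀|)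
    (hc : ∀ j ∉ J, Real.cos (A j * π) = c₀ ∧ Real.cos (A (j - 1) * π) = c₀)
    (hξ : ∀ j ∉ J, 2 * disc (α j) E = ξ₀) :
    (∀ x : (magneticLaplacian α A).domain,
      magneticLaplacian α A x - (E : ℂ) • (x : L2Graph) = 0 → x = 0) ∧
    (∀ y : L2Graph, ∃ x : (magneticLaplacian α A).domain,
      magneticLaplacian α A x - (E : ℂ) • (x : L2Graph) = y) := by
  refine ⟨fun x hx => ?_, fun y => ?_⟩
  · obtain ⟨ψ, hψ, heq, -, h0⟩ := exists_value_of_eigen hS x hx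
    exact h0 (hinj ψ hψ heq)
  · obtain ⟨r, hr, -, H⟩ := exists_lift α A hS y
    obtain ⟨ψ, hψ, heq⟩ := exists_solution (c := fun j => Real.cos (A j * π))
      (ξ := fun j => 2 * disc (α j) E) J h hc hξ hinj hr
    obtain ⟨f, w, w₁, w₂, hG⟩ := H ψ hψ heq
    obtain ⟨hf, hT⟩ := exists_mem_domain (inLaplacianGraph_iff.2 ⟨_, _, _, _, hG⟩)
    exact ⟨⟨f, hf⟩, by rw [hT]; simp⟩

/-- A nonzero square summable solution of the difference equation, unique up to scalars, gives a
simple eigenvalue. -/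
lemma isSimpleEigenvalue_of_difference {α A : ℤ → ℝ} {E : ℝ} (hS : sinPi E ≠ 0)
    {φ : ℤ → ℂ} (hφ : Memℓp φ 2) (hφ0 : φ 0 ≠ 0)
    (hφeq : ∀ j, (Real.cos (A j * π) : ℂ) * φ (j + 1) + (Real.cos (A (j - 1) * π) : ℂ) * φ (j - 1)
        = (2 * disc (α j) E : ℝ) * φ j)
    (huniq : ∀ ψ : ℤ → ℂ, Memℓp ψ 2 →
      (∀ j, (Real.cos (A j * π) : ℂ) * ψ (j + 1) + (Real.cos (A (j - 1) * π) : ℂ) * ψ (j - 1)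
        = (2 * disc (α j) E : ℝ) * ψ j) → ψ 0 = 0 → ψ = 0) :
    IsSimpleEigenvalue (magneticLaplacian α A) E := by
  obtain ⟨r, hr, hr0, H⟩ := exists_lift α A hS 0
  obtain ⟨f, w, w₁, w₂, hG⟩ := H φ hφ (fun j => by rw [hr0 rfl, hφeq]; simp)
  obtain ⟨hf, hT⟩ := exists_mem_domain (inLaplacianGraph_iff.2 ⟨_, _, _, _, hG⟩)
  have hmem : ∀ x : (magneticLaplacian α A).domain, x ∈ eigenspace (magneticLaplacian α A) E ↔
      magneticLaplacian α A x - (E : ℂ) • (x : L2Graph) = 0 := fun x => Iff.rfl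
  have hF : (⟨f, hf⟩ : (magneticLaplacian α A).domain) ∈ eigenspace (magneticLaplacian α A) E := by
    rw [hmem, hT]; simp
  -- The vertex value at 0 is the trace of the continuous representative, so it depends only on the
  -- `L²` element, and linearly.
  have hval : ∀ (f : L2Graph) (g : L2Graph) (ψ : ℤ → ℂ) (w w₁ w₂ : ℤ → Bool → ℝ → ℂ) (c : ℂ),
      GaugedGraph α A f g ψ w w₁ w₂ → ∀ f' g' ψ' w' w₁' w₂', GaugedGraph α A f' g' ψ' w' w₁' w₂' →
      f' = c • f → ψ' 0 = c * ψ 0 := by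
    intro f g ψ w w₁ w₂ c h f' g' ψ' w' w₁' w₂' h' hc
    have h1 : w' 0 true =ᵐ[edgeMeasure] fun x => c * w 0 true x := by
      have e : onEdge f' (0, true) = c • onEdge f (0, true) := by rw [hc]; rfl
      have e' := h'.fst 0 true
      rw [e] at e'
      filter_upwards [e', h.fst 0 true, Lp.coeFn_smul c (onEdge f (0, true))] with x a1 a2 a3
      rw [a3, Pi.smul_apply, a2, smul_eq_mul] at a1
      exact mul_left_cancel₀ (phase_ne_zero (-(orient true * A 0)) x)
        (by linear_combination -a1)
    have h2 : ContinuousOn (fun x => w' 0 true x - c * w 0 true x) (Icc 0 π) :=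
      (h'.isH2 0 true).continuousOn.sub (continuousOn_const.mul (h.isH2 0 true).continuousOn)
    have h3 := eqOn_zero_of_ae h2 (by filter_upwards [h1] with x hx; simp [hx]) 0
      ⟨le_rfl, Real.pi_pos.le⟩
    rw [h.left, h'.left] at h3
    exact sub_eq_zero.1 h3
  have hFne : (⟨⟨f, hf⟩, hF⟩ : eigenspace (magneticLaplacian α A) E) ≠ 0 := by
    intro h0
    have hf0 : f = (0 : ℂ) • f := by
      rw [zero_smul]; exact congrArg (fun v => ((v.1 : (magneticLaplacian α A).domain) : L2Graph)) h0
    have := hval _ _ _ _ _ _ 0 hG _ _ _ _ _ _ hG hf0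
    rw [zero_mul] at this
    exact hφ0 this
  refine finrank_eq_one _ hFne fun v => ?_
  obtain ⟨v, hv⟩ := v
  obtain ⟨ψ, hψ, heq, ⟨u, u₁, u₂, hU⟩, h0⟩ := exists_value_of_eigen hS v ((hmem v).1 hv)
  refine ⟨ψ 0 / φ 0, ?_⟩
  set c := ψ 0 / φ 0
  -- `c` is chosen so that this combination vanishes at vertex 0; uniqueness then forces it to be
  -- zero.
  set d : (magneticLaplacian α A).domain := c • ⟨f, hf⟩ - v with hd
  have hdmem : d ∈ eigenspace (magneticLaplacian α A) E :=
    Submodule.sub_mem _ (Submodule.smul_mem _ c hF) hv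
  obtain ⟨χ, hχ, hχeq, ⟨z, z₁, z₂, hZ⟩, hχ0⟩ := exists_value_of_eigen hS d ((hmem d).1 hdmem)
  suffices hd0 : d = 0 by
    apply Subtype.ext
    exact sub_eq_zero.1 hd0
  refine hχ0 (huniq χ hχ hχeq ?_)
  have hcomb : z 0 true =ᵐ[edgeMeasure] fun x => c * w 0 true x - u 0 true x := by
    have e : onEdge (d : L2Graph) (0, true)
        = c • onEdge f (0, true) - onEdge (v : L2Graph) (0, true) := rfl
    have e' := hZ.fst 0 true
    rw [e] at e'
    filter_upwards [e', hG.fst 0 true, hU.fst 0 true, Lp.coeFn_smul c (onEdge f (0, true)),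
      Lp.coeFn_sub (c • onEdge f (0, true)) (onEdge (v : L2Graph) (0, true))] with x a1 a2 a3 a4 a5
    rw [a5, Pi.sub_apply, a4, Pi.smul_apply, a2, a3, smul_eq_mul] at a1
    exact mul_left_cancel₀ (phase_ne_zero (-(orient true * A 0)) x) (by linear_combination -a1)
  have hcont : ContinuousOn (fun x => z 0 true x - (c * w 0 true x - u 0 true x)) (Icc 0 π) :=
    (hZ.isH2 0 true).continuousOn.sub ((continuousOn_const.mul (hG.isH2 0 true).continuousOn).sub
      (hU.isH2 0 true).continuousOn)
  have h3 := eqOn_zero_of_ae hcont (by filter_upwards [hcomb] with x hx; simp [hx]) 0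
      ⟨le_rfl, Real.pi_pos.le⟩
  simp only [hZ.left, hG.left, hU.left] at h3
  rw [sub_eq_zero.1 h3, div_mul_cancel₀ _ hφ0, sub_self]

/-! ### Locally perturbed chains -/

/-- The coefficients `α`, `A` agree with the constants `α₀`, `A₀` outside `1, …, n`. -/
structure LocalChain (n : ℕ) (α₀ A₀ : ℝ) (α A : ℤ → ℝ) : Prop where
  coupling_out : ∀ j : ℤ, j ≤ 0 ∨ (n : ℤ) < j → α j = α₀
  potential_out : ∀ j : ℤ, j ≤ 0 ∨ (n : ℤ) < j → A j = A₀
  cos_ne : ∀ j, Real.cos (A j * π) ≠ 0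

lemma exists_unimodular {v : ℝ} (hv : |v| ≤ 1) : ∃ x : ℂ, ‖x‖ = 1 ∧ x + x⁻¹ = 2 * (v : ℂ) := by
  refine ⟨Complex.exp (Real.arccos v * Complex.I), Complex.norm_exp_ofReal_mul_I _, ?_⟩
  have h := Real.cos_arccos (abs_le.1 hv).1 (abs_le.1 hv).2
  conv_rhs => rw [← h, Complex.ofReal_cos, Complex.cos]
  rw [← Complex.exp_neg]
  ring_nf

namespace LocalChain

variable {n : ℕ} {α₀ A₀ : ℝ} {α A : ℤ → ℝ} {E : ℝ}

lemma cos_ne_zero (h : LocalChain n α₀ A₀ α A) : Real.cos (A₀ * π) ≠ 0 := by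
  rw [← h.potential_out 0 (Or.inl le_rfl)]; exact h.cos_ne 0

/-- In a band the free equation has unimodular characteristic roots. -/
lemma exists_root (h : LocalChain n α₀ A₀ α A) (hb : |disc α₀ E| ≤ |Real.cos (A₀ * π)|) :
    ∃ x : ℂ, ‖x‖ = 1 ∧ ∀ (ψ : ℤ → ℂ) (j : ℤ), (j ≤ 0 ∨ (n : ℤ) + 1 < j) →
      (Real.cos (A j * π) : ℂ) * ψ (j + 1) + (Real.cos (A (j - 1) * π) : ℂ) * ψ (j - 1)
        = (2 * disc (α j) E : ℝ) * ψ j →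
      ψ (j + 1) + ψ (j - 1) = (x + x⁻¹) * ψ j := by
  have hc := h.cos_ne_zero
  obtain ⟨x, hx, hx'⟩ := exists_unimodular (v := disc α₀ E / Real.cos (A₀ * π)) (by
    rw [abs_div]; exact div_le_one_of_le₀ hb (abs_nonneg _))
  refine ⟨x, hx, fun ψ j hj heq => ?_⟩
  rw [h.potential_out j (hj.imp_right fun _ => by omega),
    h.potential_out (j - 1) (hj.imp (fun _ => by omega) fun _ => by omega),
    h.coupling_out j (hj.imp_right fun _ => by omega)] at heq
  rw [hx']
  have hcC : (Real.cos (A₀ * π) : ℂ) ≠ 0 := Complex.ofReal_ne_zero.2 hc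
  push_cast at heq hcC ⊢
  field_simp
  linear_combination heq

/-- Decay with unimodular roots gives zero on the free left half-line, and since no `cos(A_j π)`
vanishes, the recursion carries the zero through the perturbed sites. -/
lemma eq_zero_of_le (h : LocalChain n α₀ A₀ α A) (hb : |disc α₀ E| ≤ |Real.cos (A₀ * π)|)
    {ψ : ℤ → ℂ} (hψ : Tendsto ψ cofinite (𝓝 0)) {M : ℤ} (hM : 0 < M)
    (heq : ∀ j < M, (Real.cos (A j * π) : ℂ) * ψ (j + 1) + (Real.cos (A (j - 1) * π) : ℂ) * ψ (j - 1)
      = (2 * disc (α j) E : ℝ) * ψ j) (j : ℤ) (hj : j ≤ M) : ψ j = 0 := by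
  obtain ⟨x, hx, H⟩ := h.exists_root hb
  refine eq_zero_forward (L := 0) (fun j => Complex.ofReal_ne_zero.2 (h.cos_ne j)) heq
    (fun j hj => ?_) j hj
  have := left_decaying_eq_zero hx hψ (N := 0) (fun i hi => H ψ i (Or.inl hi) (heq i (by omega)))
    (j := j - 1) (by omega)
  rwa [sub_add_cancel] at this

lemma eq_zero_of_ge (h : LocalChain n α₀ A₀ α A) (hb : |disc α₀ E| ≤ |Real.cos (A₀ * π)|)
    {ψ : ℤ → ℂ} (hψ : Tendsto ψ cofinite (𝓝 0)) {M : ℤ} (hM : (n : ℤ) < M)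
    (heq : ∀ j > M, (Real.cos (A j * π) : ℂ) * ψ (j + 1) + (Real.cos (A (j - 1) * π) : ℂ) * ψ (j - 1)
      = (2 * disc (α j) E : ℝ) * ψ j) (j : ℤ) (hj : M ≤ j) : ψ j = 0 := by
  obtain ⟨x, hx, H⟩ := h.exists_root hb
  have := right_decaying_eq_zero hx hψ (N := M + 1)
    (fun i hi => H ψ i (Or.inr (by omega)) (heq i (by omega))) (j := j + 1) (by omega)
  rwa [add_sub_cancel_right] at this

lemma not_isEigenvalue_of_band (h : LocalChain n α₀ A₀ α A) (hS : sinPi E ≠ 0)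
    (hb : |disc α₀ E| ≤ |Real.cos (A₀ * π)|) : ¬ IsEigenvalue (magneticLaplacian α A) E := by
  rw [IsEigenvalue, not_not, Submodule.eq_bot_iff]
  intro x hx
  obtain ⟨ψ, hψ, heq, -, h0⟩ := exists_value_of_eigen hS x hx
  refine h0 (funext fun j => ?_)
  exact h.eq_zero_of_le hb (tendsto_of_memℓp hψ) (M := max j 1) (by omega) (fun i _ => heq i) j
    (by omega)

/-- A source supported on a single edge is shown not to be in the range. Its would-be preimage has
zero vertex values on both sides, so the source would have to be orthogonal to `sinE` on that edge,
while it is `sinE` itself up to the gauge phase. -/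
lemma mem_spec_of_band (h : LocalChain n α₀ A₀ α A) (hS : sinPi E ≠ 0)
    (hb : |disc α₀ E| ≤ |Real.cos (A₀ * π)|) : (E : ℂ) ∈ spec (magneticLaplacian α A) := by
  rintro ⟨R, hR, -⟩
  -- The ring is to the right of the perturbation, so both one-sided uniqueness lemmas apply up to
  -- its end vertices.
  set M : ℤ := n + 1 with hM
  set b := -(orient true * A M)
  have hρ : MemLp (fun x => phase b x * (sinE E x : ℂ)) 2 edgeMeasure :=
    memLp_edge_of_continuousOn ((continuous_phase b).mul
      (Complex.continuous_ofReal.comp (continuous_sinE E))).continuousOn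
  set y : L2Graph := lp.single 2 ((M, true) : Edge) (hρ.toLp _) with hy
  have hye : onEdge y (M, true) = hρ.toLp _ := by
    rw [onEdge, hy, lp.single_apply_self]
  have hyn : ∀ e : Edge, e ≠ (M, true) → onEdge y e = 0 := fun e he => by
    rw [onEdge, hy, lp.single_apply_ne _ _ _ he]
  obtain ⟨hf, hT⟩ := hR y
  obtain ⟨ψ, w, w₁, w₂, hG⟩ := exists_gauged_of_eigen ⟨R y, hf⟩ y hT
  simp only at hG
  have hhom : ∀ e : Edge, e ≠ (M, true) →
      onEdge (y + (E : ℂ) • R y) e = (E : ℂ) • onEdge (R y) e := fun e he => by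
    have : onEdge (y + (E : ℂ) • R y) e = onEdge y e + (E : ℂ) • onEdge (R y) e := rfl
    rw [this, hyn e he, zero_add]
  have hring : ∀ j : ℤ, j ≠ M → ∀ s, onEdge (y + (E : ℂ) • R y) (j, s)
      = (E : ℂ) • onEdge (R y) (j, s) := fun j hj s =>
    hhom _ fun he => hj (congrArg Prod.fst he)
  have hψ := tendsto_of_memℓp hG.memℓp_value
  have hL : ψ M = 0 := h.eq_zero_of_le hb hψ (M := M) (by omega)
    (fun j hj => hG.difference_eq hS (hring j (by omega)) (hring (j - 1) (by omega))) M le_rfl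
  have hRt : ∀ j, M + 1 ≤ j → ψ j = 0 := h.eq_zero_of_ge hb hψ (M := M + 1) (by omega)
    (fun j hj => hG.difference_eq hS (hring j (by omega)) (hring (j - 1) (by omega)))
  have hR1 := hRt (M + 1) le_rfl
  have hR2 := hRt (M + 1 + 1) (by omega)
  have hk := hG.kirchhoff (M + 1)
  have d1 : ∀ s, w₁ (M + 1) s 0 = 0 := fun s => by
    rw [(hG.deriv_of_homogeneous hS (hring (M + 1) (by omega) s)).1, hR1, hR2]; simp
  have d2 : w₁ M false π = 0 := by
    rw [(hG.deriv_of_homogeneous hS (hhom (M, false) (by simp))).2, hR1, hL]; simp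
  simp only [Fintype.sum_bool, add_sub_cancel_right, d1, d2, hR1, mul_zero, add_zero, zero_sub,
    neg_eq_zero] at hk
  -- All other edges at the vertex `M + 1` carry zero derivative, so the Kirchhoff condition leaves
  -- only this one.
  have d3 : w₁ M true π = 0 := (mul_eq_zero.1 hk).resolve_left (phase_ne_zero _ _)
  have hw₂ : w₂ M true =ᵐ[edgeMeasure] fun x => -(sinE E x : ℂ) - E * w M true x := by
    have e1 : onEdge (y + (E : ℂ) • R y) (M, true)
      = onEdge y (M, true) + (E : ℂ) • onEdge (R y) (M, true) := rfl
    have e2 := hG.snd M true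
    rw [e1, hye] at e2
    filter_upwards [e2, hG.fst M true, Lp.coeFn_add (hρ.toLp _) ((E : ℂ) • onEdge (R y) (M, true)),
      Lp.coeFn_smul (E : ℂ) (onEdge (R y) (M, true)), hρ.coeFn_toLp] with x h1 h2 h3 h4 h5
    rw [h3, Pi.add_apply, h4, Pi.smul_apply, h5, h2, smul_eq_mul] at h1
    exact mul_left_cancel₀ (phase_ne_zero b x) (by linear_combination h1)
  have hgreen := (hG.isH2 M true).green (isH2_sinE E)
  rw [d3, hG.right, hG.left, hL, hR1, sinE_zero] at hgreen
  simp only [zero_mul, mul_zero, sub_zero, Complex.ofReal_zero] at hgreen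
  have hint : ∫ x, sinE E x ^ 2 ∂edgeMeasure = 0 := by
    have : ∫ x, ((sinE E x ^ 2 : ℝ) : ℂ) ∂edgeMeasure = 0 := by
      rw [← neg_eq_zero, ← integral_neg, ← hgreen]
      refine integral_congr_ae ?_
      filter_upwards [hw₂] with x hx
      rw [hx]; push_cast; ring
    rw [integral_complex_ofReal] at this
    exact_mod_cast this
  have hcont : Continuous fun x => sinE E x ^ 2 := (continuous_sinE E).pow 2
  have hi : Integrable (fun x => sinE E x ^ 2) edgeMeasure :=
    (hcont.integrableOn_Icc (a := 0) (b := π)).mono_set Ioo_subset_Icc_self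
  rw [integral_eq_zero_iff_of_nonneg (fun x => sq_nonneg _) hi] at hint
  have h0 := eqOn_zero_of_ae (u := fun x => (sinE E x : ℂ))
    (Complex.continuous_ofReal.comp (continuous_sinE E)).continuousOn
    (by filter_upwards [hint] with x hx
        simp only [Pi.zero_apply, sq_eq_zero_iff] at hx
        simp [hx]) π ⟨Real.pi_pos.le, le_rfl⟩
  exact hS (Complex.ofReal_eq_zero.1 h0)

end LocalChain

/-! ### The Dirichlet eigenvalues -/

/-- Eigenfunctions vanishing at the vertices. -/
lemma exists_gauged_dirichlet (α A : ℤ → ℝ) {E : ℝ} (hS : sinPi E = 0) {c : ℤ → Bool → ℂ}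
    (J : Finset ℤ) (hJ : ∀ j ∉ J, ∀ s, c j s = 0)
    (hc : ∀ j, ∑ s, c j s = cosPi E * ∑ s, phase (-(orient s * A (j - 1))) π * c (j - 1) s) :
    ∃ f w₁ w₂, GaugedGraph α A f ((E : ℂ) • f) 0 (fun j s x => c j s * sinE E x) w₁ w₂ := by
  have hH : ∀ j s, IsH2 (fun x => c j s * sinE E x) (fun x => c j s * cosE E x)
      (fun x => c j s * (-E * sinE E x)) := fun j s => (isH2_sinE E).smul (c j s)
  have hm : ∀ e : Edge, MemLp (fun x => phase (-(orient e.2 * A e.1)) x * (c e.1 e.2 * sinE E x)) 2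
      edgeMeasure := fun e => memLp_edge_of_continuousOn
    ((continuous_phase _).continuousOn.mul (hH e.1 e.2).continuousOn)
  have hB : Memℓp (fun e : Edge => edgeNorm fun x =>
      phase (-(orient e.2 * A e.1)) x * (c e.1 e.2 * sinE E x)) 2 := by
    rw [memℓp_two_iff]
    refine summable_of_ne_finset_zero (s := J ×ˢ Finset.univ) fun e he => ?_
    have : e.1 ∉ J := fun h => he (by simp [h])
    have h0 : (fun x => phase (-(orient e.2 * A e.1)) x * (c e.1 e.2 * (sinE E x : ℂ)))
        = (0 : ℝ → ℂ) := by
      funext x; rw [hJ _ this]; simp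
    rw [h0]; simp [edgeNorm]
  obtain ⟨f, hf⟩ := exists_L2Graph hm hB fun e => le_rfl
  refine ⟨f, _, _, hH, fun j s => hf (j, s), fun j s => ?_, fun j s => ?_, fun j s => ?_,
    fun j => ?_⟩
  · have e : onEdge ((E : ℂ) • f) (j, s) = (E : ℂ) • onEdge f (j, s) := rfl
    rw [e]
    filter_upwards [Lp.coeFn_smul (E : ℂ) (onEdge f (j, s)), hf (j, s)] with x h1 h2
    rw [h1, Pi.smul_apply, h2, smul_eq_mul]; ring
  · simp [sinE_zero]
  · have : sinE E π = 0 := hS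
    simp [this]
  · have : cosE E π = cosPi E := rfl
    simp only [cosE_zero, this, Complex.ofReal_one, mul_one, hc j, Pi.zero_apply, mul_zero]
    rw [Finset.mul_sum, sub_eq_zero]
    exact Finset.sum_congr rfl fun s _ => by ring

lemma mem_spec_of_isEigenvalue {H : Type*} [NormedAddCommGroup H] [InnerProductSpace ℂ H]
    {T : H →ₗ.[ℂ] H} {z : ℂ} (h : IsEigenvalue T z) : z ∈ spec T := by
  rintro ⟨R, -, hR⟩
  refine h ((Submodule.eq_bot_iff _).2 fun x hx => ?_)
  have hx' : T x - z • (x : H) = 0 := hx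
  have := hR x
  rw [hx', map_zero] at this
  exact Subtype.ext this.symm

/-- The maps `φ k` act as a dual family, making the vectors `x k` linearly independent. -/
lemma not_finite_of_separated {V W : Type*} [AddCommGroup V] [Module ℂ V] [AddCommGroup W]
    [Module ℂ W] (x : ℕ → V) (φ : ℕ → V →ₗ[ℂ] W) (h : ∀ k, φ k (x k) ≠ 0)
    (h' : ∀ k l, k ≠ l → φ k (x l) = 0) : ¬ Module.Finite ℂ V := by
  intro hfin
  have hli : LinearIndependent ℂ x := by
    rw [linearIndependent_iff']
    intro s g hg i hi
    have := congrArg (φ i) hg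
    rw [map_sum, map_zero, Finset.sum_eq_single i, map_smul] at this
    · exact (smul_eq_zero.1 this).resolve_right (h i)
    · intro j _ hj; rw [map_smul, h' i j hj.symm, smul_zero]
    · exact fun hn => absurd hi hn
  exact not_finite_iff_infinite.2 (inferInstanceAs (Infinite ℕ)) hli.finite

/-- Restriction to an edge as a linear map. -/
noncomputable def onEdgeₗ (e : Edge) : L2Graph →ₗ[ℂ] Lp ℂ 2 edgeMeasure where
  toFun f := onEdge f e
  map_add' _ _ := rfl
  map_smul' _ _ := rfl

/-- Infinite multiplicity of the Dirichlet eigenvalues. -/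
lemma LocalChain.dirichlet {n : ℕ} {α₀ A₀ : ℝ} {α A : ℤ → ℝ} (h : LocalChain n α₀ A₀ α A) {E : ℝ}
    (hS : sinPi E = 0) : IsEigenvalue (magneticLaplacian α A) E ∧
      ¬ Module.Finite ℂ (eigenspace (magneticLaplacian α A) E) := by
  set P := phase A₀ π
  set P' := phase (-A₀) π
  set C := ((cosPi E : ℝ) : ℂ)
  have key : ∀ k : ℕ, ∃ x : eigenspace (magneticLaplacian α A) E,
      onEdge ((x : (magneticLaplacian α A).domain) : L2Graph) (-2 * k - 2, true) ≠ 0 ∧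
      ∀ l : ℕ, k ≠ l →
        onEdge ((x : (magneticLaplacian α A).domain) : L2Graph) (-2 * l - 2, true) = 0 := by
    intro k
    set p : ℤ := -2 * k - 2 with hp
    -- One ring cannot carry such a function: Kirchhoff at both its ends would require `exp(2iAπ) =
    -- 1`. With two adjacent rings the amplitudes on the second one compensate the outflow from the
    -- first. Since `p + 1 < 0`, both rings are unperturbed, and distinct `k` give disjoint
    -- supports.
    set c : ℤ → Bool → ℂ := fun j s =>
      if j = p then (if s then 1 else -1)
      else if j = p + 1 then (if s then -C * P else C * P') else 0 with hc
    obtain ⟨f, w₁, w₂, hG⟩ := exists_gauged_dirichlet α A hS (c := c) {p, p + 1}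
      (fun j hj s => by
        simp only [Finset.mem_insert, Finset.mem_singleton, not_or] at hj
        simp [hc, hj.1, hj.2]) (fun j => by
        simp only [Fintype.sum_bool, hc, orient, one_mul, neg_mul, neg_neg]
        rcases eq_or_ne j p with rfl | h1
        · have e1 : p - 1 ≠ p := by omega
          have e2 : p - 1 ≠ p + 1 := by omega
          simp [e1, e2]
        rcases eq_or_ne j (p + 1) with rfl | h2
        · rw [add_sub_cancel_right, h.potential_out p (Or.inl (by omega))]
          simp [P, P']
          ring
        rcases eq_or_ne j (p + 1 + 1) with rfl | h3
        · rw [add_sub_cancel_right, h.potential_out (p + 1) (Or.inl (by omega))]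
          have e1 : p + 1 + 1 ≠ p := by omega
          have e3 : p + 1 ≠ p := by omega
          simp only [if_neg e1, if_neg h2, if_neg e3, if_true, if_false, Bool.false_eq_true]
          change 0 + 0 = C * (P' * -(C * P) + P * (C * P'))
          ring
        · have e1 : j - 1 ≠ p := by omega
          have e2 : j - 1 ≠ p + 1 := by omega
          simp [h1, h2, e1, e2])
    obtain ⟨hf, hT⟩ := exists_mem_domain (inLaplacianGraph_iff.2 ⟨_, _, _, _, hG⟩)
    have hmem : (⟨f, hf⟩ : (magneticLaplacian α A).domain)
        ∈ eigenspace (magneticLaplacian α A) E := by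
      change magneticLaplacian α A ⟨f, hf⟩ - (E : ℂ) • f = 0
      rw [hT, sub_self]
    refine ⟨⟨⟨f, hf⟩, hmem⟩, fun h0 => ?_, fun l hl => ?_⟩
    · have h1 := hG.fst p true
      rw [show onEdge f (p, true) = 0 from h0] at h1
      have h2 : (fun x => (sinE E x : ℂ)) =ᵐ[edgeMeasure] 0 := by
        filter_upwards [h1, Lp.coeFn_zero ℂ 2 edgeMeasure] with x hx hx'
        rw [hx'] at hx
        simpa [hc, phase_ne_zero] using hx.symm
      have h3 := ((isH2_sinE E).ae_eq_zero h2).1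
      have h4 := eqOn_zero_of_ae (isH2_sinE E).continuousOn₁ h3 0 ⟨le_rfl, Real.pi_pos.le⟩
      rw [cosE_zero] at h4
      norm_num at h4
    · have e1 : (-2 * (l : ℤ) - 2) ≠ p := by omega
      have e2 : (-2 * (l : ℤ) - 2) ≠ p + 1 := by omega
      refine Lp.ext ?_
      filter_upwards [hG.fst (-2 * l - 2) true, Lp.coeFn_zero ℂ 2 edgeMeasure] with x hx hx'
      rw [hx', Pi.zero_apply]
      refine hx.trans ?_
      simp only [hc, if_neg e1, if_neg e2]
      simp
  choose x hx hx' using key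
  refine ⟨fun hbot => ?_, not_finite_of_separated x
    (fun k => (onEdgeₗ (-2 * k - 2, true)).comp ((magneticLaplacian α A).domain.subtype.comp
      (eigenspace (magneticLaplacian α A) E).subtype)) hx fun k l hkl => hx' l k hkl.symm⟩
  have : ((x 0 : (magneticLaplacian α A).domain)) = 0 := (Submodule.eq_bot_iff _).1 hbot _ (x 0).2
  refine hx 0 ?_
  rw [this]; rfl

/-! ### The characteristic root in the gaps -/

/-- The root of larger modulus of `x + 1/x = 2v`, for `1 ≤ |v|`. -/
noncomputable def charRoot (v : ℝ) : ℝ := v * (1 + √(1 - (v ^ 2)⁻¹))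

lemma abs_le_abs_charRoot (v : ℝ) : |v| ≤ |charRoot v| := by
  rw [charRoot, abs_mul, abs_of_nonneg (by positivity : 0 ≤ 1 + √(1 - (v ^ 2)⁻¹))]
  exact le_mul_of_one_le_right (abs_nonneg _) (by linarith [Real.sqrt_nonneg (1 - (v ^ 2)⁻¹)])

lemma charRoot_add_inv {v : ℝ} (hv : 1 ≤ |v|) : charRoot v + (charRoot v)⁻¹ = 2 * v := by
  have hv0 : v ≠ 0 := abs_pos.1 (by linarith)
  have h1 : 1 ≤ v ^ 2 := by rwa [one_le_sq_iff_one_le_abs]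
  have h2 : √(1 - (v ^ 2)⁻¹) ^ 2 = 1 - (v ^ 2)⁻¹ :=
    Real.sq_sqrt (by linarith [inv_le_one_of_one_le₀ h1])
  have h3 := Real.sqrt_nonneg (1 - (v ^ 2)⁻¹)
  rw [charRoot]
  generalize √(1 - (v ^ 2)⁻¹) = r at *
  have h4 : 1 + r ≠ 0 := by linarith
  field_simp at h2 ⊢
  linear_combination h2

lemma charRoot_sq_abs (v : ℝ) : charRoot v ^ 2 = charRoot |v| ^ 2 := by
  rw [charRoot, charRoot, mul_pow, mul_pow, sq_abs]

lemma continuousAt_charRoot {v : ℝ} (hv : v ≠ 0) : ContinuousAt charRoot v := by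
  have : v ^ 2 ≠ 0 := pow_ne_zero 2 hv
  unfold charRoot
  fun_prop (disch := assumption)

/-- Used contrapositively: it turns smallness of `1 - y` into closeness of `|disc|` to the band
edge. -/
lemma le_one_sub_inv_charRoot {v u : ℝ} (hu : 1 ≤ u) (h : u ≤ |v|) :
    1 - (u ^ 2)⁻¹ ≤ 1 - (charRoot v ^ 2)⁻¹ := by
  have h1 := h.trans (abs_le_abs_charRoot v)
  have h2 : u ^ 2 ≤ charRoot v ^ 2 := by
    rw [← sq_abs (charRoot v)]; exact pow_le_pow_left₀ (by linarith) h1 2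
  have := inv_anti₀ (by positivity) h2
  linarith

/-- `charRoot` is continuous at 1 with value 1. This supplies an energy level close enough to the
band edge for the mismatch to be negative. -/
lemma exists_charRoot_near {r u : ℝ} (hr : 0 < r) (hu : 1 < u) :
    ∃ v, 1 < v ∧ v < u ∧ 1 - (charRoot v ^ 2)⁻¹ < r := by
  have h1 : charRoot 1 = 1 := by simp [charRoot]
  have hc : ContinuousAt (fun v => 1 - (charRoot v ^ 2)⁻¹) 1 :=
    continuousAt_const.sub (((continuousAt_charRoot one_ne_zero).pow 2).inv₀ (by simp [h1]))
  have h2 : ∀ᶠ v in 𝓝 (1 : ℝ), 1 - (charRoot v ^ 2)⁻¹ < r :=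
    hc.eventually_lt_const (by simpa [h1] using hr)
  have h3 : ∀ᶠ v in 𝓝[>] (1 : ℝ), v ∈ Ioo 1 u := Ioo_mem_nhdsGT hu
  obtain ⟨v, h4, h5⟩ := (h3.and (h2.filter_mono nhdsWithin_le_nhds)).exists
  exact ⟨v, h4.1, h4.2, h5⟩

/-! ### Energies in the gaps of the periodic chain -/

/-- The spectrum of the periodic chain. -/
def bandSet (α A : ℝ) : Set ℝ := {E | sinPi E = 0 ∨ |disc α E| ≤ |Real.cos (A * π)|}

lemma notMem_bandSet {α A E : ℝ} :
    E ∉ bandSet α A ↔ sinPi E ≠ 0 ∧ |Real.cos (A * π)| < |disc α E| := by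
  simp [bandSet]

lemma isClosed_bandSet (α A : ℝ) : IsClosed (bandSet α A) :=
  (isClosed_eq continuous_sinPi continuous_const).union
    (isClosed_le (continuous_disc α).abs continuous_const)

/-- The characteristic root of the periodic chain. -/
noncomputable def gapRoot (α A E : ℝ) : ℝ := charRoot (disc α E / Real.cos (A * π))

/-- The effective coupling at energy `E`. -/
noncomputable def gapCoupling (α A E : ℝ) : ℝ :=
  sinPi E / (2 * Real.cos (A * π) * gapRoot α A E)

/-- The mismatch as a function of the energy. -/
noncomputable def gapMismatch (α A : ℝ) (a s : ℕ → ℝ) (n : ℕ) (E : ℝ) : ℝ :=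
  mismatch (gapRoot α A E ^ 2)⁻¹ (gapCoupling α A E) a s n

lemma abs_div_cos_lt {α A E : ℝ} (hc : Real.cos (A * π) ≠ 0)
    (hE : |Real.cos (A * π)| < |disc α E|) : 1 < |disc α E / Real.cos (A * π)| := by
  rw [abs_div]; exact (one_lt_div (abs_pos.2 hc)).2 hE

lemma inv_gapRoot_sq_mem {α A E : ℝ} (hc : Real.cos (A * π) ≠ 0)
    (hE : |Real.cos (A * π)| < |disc α E|) : (gapRoot α A E ^ 2)⁻¹ ∈ Icc (0 : ℝ) 1 := by
  have h := le_one_sub_inv_charRoot le_rfl (abs_div_cos_lt hc hE).le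
  refine ⟨by positivity, ?_⟩
  simp only [one_pow, inv_one, sub_self] at h
  exact sub_nonneg.1 h

/-- `|cos Aπ| |x| ≥ |disc|`, so the effective coupling inherits the uniform bound of `sinPi` by
`disc`. -/
lemma exists_gapCoupling_bound (α : ℝ) {A : ℝ} (hc : Real.cos (A * π) ≠ 0) :
    ∃ B, 0 ≤ B ∧ ∀ E, |Real.cos (A * π)| < |disc α E| →
      |gapCoupling α A E| ≤ B ∧ |sinPi E| ≤ 2 * B * |disc α E| := by
  obtain ⟨B, hB, H⟩ := abs_sinPi_le_mul_disc α (abs_pos.2 hc)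
  refine ⟨B, hB, fun E hE => ⟨?_, (H E hE.le).trans ?_⟩⟩
  · have h1 := abs_le_abs_charRoot (disc α E / Real.cos (A * π))
    have h2 := H E hE.le
    have h0 : 0 < |Real.cos (A * π)| := abs_pos.2 hc
    rw [abs_div, div_le_iff₀ h0] at h1
    have h3 : 0 < |gapRoot α A E| := by
      by_contra hn
      have : |gapRoot α A E| = 0 := le_antisymm (not_lt.1 hn) (abs_nonneg _)
      rw [gapRoot] at this
      rw [this] at h1
      linarith [h0.trans hE]
    rw [gapCoupling, abs_div, abs_mul, abs_mul, abs_two, div_le_iff₀ (by positivity)]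
    rw [gapRoot] at *
    nlinarith [mul_le_mul_of_nonneg_left h1 hB, mul_nonneg hB (mul_pos h3 h0).le]
  · nlinarith [mul_nonneg hB (abs_nonneg (disc α E))]

lemma continuousOn_riccati {y β : ℝ → ℝ} {a s : ℕ → ℝ} {K : Set ℝ} (hy : ContinuousOn y K)
    (hβ : ContinuousOn β K) (k : ℕ) (h : ∀ E ∈ K, ∀ i < k, 1 + riccati (y E) (β E) a s i ≠ 0) :
    ContinuousOn (fun E => riccati (y E) (β E) a s k) K := by
  induction k with
  | zero => exact continuousOn_const
  | succ k ih =>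
    have hk := ih fun E hE i hi => h E hE i (by omega)
    exact (continuousOn_const.mul hβ).add ((hy.mul (hk.sub continuousOn_const)).div
      (continuousOn_const.add hk) fun E hE => h E hE k (by omega))

/-- A weak local perturbation of the periodic chain. -/
structure WeakChain (n : ℕ) (α₀ A₀ : ℝ) (α A : ℤ → ℝ) (a s : ℕ → ℝ) : Prop
    extends LocalChain n α₀ A₀ α A where
  ratio_pos : ∀ j, 0 < Real.cos (A j * π) / Real.cos (A₀ * π)
  a_eq : ∀ k < n, α ((k + 1 : ℕ) : ℤ) - α₀ = a (k + 1)
  s_eq : ∀ k ≤ n, s k = (Real.cos (A (k : ℤ) * π) / Real.cos (A₀ * π)) ^ 2 - 1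
  riccati_le : ∀ E, |Real.cos (A₀ * π)| < |disc α₀ E| → ∀ k ≤ n,
    |riccati (gapRoot α₀ A₀ E ^ 2)⁻¹ (gapCoupling α₀ A₀ E) a s k| ≤ 1 / 2

namespace WeakChain

variable {n : ℕ} {α₀ A₀ : ℝ} {α A : ℤ → ℝ} {a s : ℕ → ℝ} {E : ℝ}

lemma chainData (h : WeakChain n α₀ A₀ α A a s) (hE : |Real.cos (A₀ * π)| < |disc α₀ E|) :
    ChainData n (gapRoot α₀ A₀ E) (gapCoupling α₀ A₀ E)
      (fun j => Real.cos (A j * π) / Real.cos (A₀ * π))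
      (fun j => (α j - α₀) * gapCoupling α₀ A₀ E) a s where
  hx := (abs_div_cos_lt h.cos_ne_zero hE).trans_le (abs_le_abs_charRoot _)
  t_pos := h.ratio_pos
  t_out j hj := by simp only [h.potential_out j hj, div_self h.cos_ne_zero]
  e_out j hj := by simp only [h.coupling_out j hj, sub_self, zero_mul]
  e_eq k hk := by rw [h.a_eq k hk]
  s_eq := h.s_eq

lemma riccati_pos (h : WeakChain n α₀ A₀ α A a s) (hE : |Real.cos (A₀ * π)| < |disc α₀ E|) :
    ∀ k ≤ n, 0 < 1 + riccati (gapRoot α₀ A₀ E ^ 2)⁻¹ (gapCoupling α₀ A₀ E) a s k := fun k hk => by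
  linarith [(abs_le.1 (h.riccati_le E hE k hk)).1]

/-- `disc` is affine in the coupling, and the factor `1 / (2 x cos Aπ)` in `gapCoupling` is what
makes `x e_j` equal to the change of `2 disc / cos Aπ`. -/
lemma two_disc_eq (h : WeakChain n α₀ A₀ α A a s) (hE : |Real.cos (A₀ * π)| < |disc α₀ E|) (j : ℤ) :
    Real.cos (A₀ * π) * (gapRoot α₀ A₀ E + (gapRoot α₀ A₀ E)⁻¹
      + gapRoot α₀ A₀ E * ((α j - α₀) * gapCoupling α₀ A₀ E)) = 2 * disc (α j) E := by
  have hc := h.cos_ne_zero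
  have hx := (h.chainData hE).x_ne
  have h1 := charRoot_add_inv (abs_div_cos_lt hc hE).le
  change gapRoot α₀ A₀ E + (gapRoot α₀ A₀ E)⁻¹ = _ at h1
  rw [h1, gapCoupling, disc, disc]
  field_simp
  ring

lemma eq_iff (h : WeakChain n α₀ A₀ α A a s) (hE : |Real.cos (A₀ * π)| < |disc α₀ E|) (ψ : ℤ → ℂ)
    (j : ℤ) : (Real.cos (A j * π) : ℂ) * ψ (j + 1) + (Real.cos (A (j - 1) * π) : ℂ) * ψ (j - 1)
        = (2 * disc (α j) E : ℝ) * ψ j ↔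
      ((Real.cos (A j * π) / Real.cos (A₀ * π) : ℝ) : ℂ) * ψ (j + 1)
        + ((Real.cos (A (j - 1) * π) / Real.cos (A₀ * π) : ℝ) : ℂ) * ψ (j - 1)
        = ((gapRoot α₀ A₀ E + (gapRoot α₀ A₀ E)⁻¹
          + gapRoot α₀ A₀ E * ((α j - α₀) * gapCoupling α₀ A₀ E) : ℝ) : ℂ) * ψ j := by
  rw [← h.two_disc_eq hE j]
  have hc : ((Real.cos (A₀ * π) : ℝ) : ℂ) ≠ 0 := Complex.ofReal_ne_zero.2 h.cos_ne_zero
  generalize Real.cos (A₀ * π) = c at *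
  generalize gapRoot α₀ A₀ E + (gapRoot α₀ A₀ E)⁻¹
    + gapRoot α₀ A₀ E * ((α j - α₀) * gapCoupling α₀ A₀ E) = X
  rw [Complex.ofReal_mul, Complex.ofReal_div, Complex.ofReal_div, mul_assoc, div_mul_eq_mul_div,
    div_mul_eq_mul_div, ← add_div, div_eq_iff hc, mul_comm (c : ℂ)]

lemma injective_of_mismatch_ne (h : WeakChain n α₀ A₀ α A a s)
    (hE : |Real.cos (A₀ * π)| < |disc α₀ E|) (hm : gapMismatch α₀ A₀ a s n E ≠ 0) (ψ : ℤ → ℂ)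
    (hψ : Memℓp ψ 2)
    (heq : ∀ j, (Real.cos (A j * π) : ℂ) * ψ (j + 1) + (Real.cos (A (j - 1) * π) : ℂ) * ψ (j - 1)
        = (2 * disc (α j) E : ℝ) * ψ j) : ψ = 0 := by
  have heq' := fun j => (h.eq_iff hE ψ j).1 (heq j)
  have hd := h.chainData hE
  refine hd.eq_zero_of_apply_zero (tendsto_of_memℓp hψ) heq' ?_
  by_contra h0
  exact hm (hd.mismatch_eq_zero (fun k hk => (h.riccati_pos hE k hk).ne') (tendsto_of_memℓp hψ)
    heq' h0)

/-- The bound state at energy `E`. -/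
lemma exists_boundState (h : WeakChain n α₀ A₀ α A a s)
    (hE : |Real.cos (A₀ * π)| < |disc α₀ E|) (hm : gapMismatch α₀ A₀ a s n E = 0) :
    ∃ φ : ℤ → ℝ, (∀ j, 0 < φ j * gapRoot α₀ A₀ E ^ j) ∧ (Summable fun j => φ j ^ 2) ∧
      ∀ j, Real.cos (A j * π) * φ (j + 1) + Real.cos (A (j - 1) * π) * φ (j - 1)
        = 2 * disc (α j) E * φ j := by
  have hd := h.chainData hE
  have hc := h.cos_ne_zero
  refine ⟨_, hd.boundState_sign (h.riccati_pos hE), hd.boundState_summable, fun j => ?_⟩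
  have := hd.boundState_eq (h.riccati_pos hE) hm j
  rw [← h.two_disc_eq hE j, mul_assoc, ← this]
  generalize ChainData.boundState n _ _ _ a s = φ
  generalize Real.cos (A₀ * π) = c at hc ⊢
  field_simp

lemma isSimpleEigenvalue (h : WeakChain n α₀ A₀ α A a s) (hE : E ∉ bandSet α₀ A₀)
    (hm : gapMismatch α₀ A₀ a s n E = 0) : IsSimpleEigenvalue (magneticLaplacian α A) E := by
  obtain ⟨hS, hE⟩ := notMem_bandSet.1 hE
  obtain ⟨φ, hpos, hsum, heq⟩ := h.exists_boundState hE hm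
  refine isSimpleEigenvalue_of_difference hS (φ := fun j => (φ j : ℂ)) ?_ ?_ (fun j => ?_)
    fun ψ hψ hψeq h0 => (h.chainData hE).eq_zero_of_apply_zero (tendsto_of_memℓp hψ)
      (fun j => (h.eq_iff hE ψ j).1 (hψeq j)) h0
  · rw [memℓp_two_iff]; simpa using hsum
  · have := hpos 0
    simp only [zpow_zero, mul_one] at this
    exact Complex.ofReal_ne_zero.2 this.ne'
  · exact_mod_cast heq j

lemma bijective (h : WeakChain n α₀ A₀ α A a s) (hE : E ∉ bandSet α₀ A₀)
    (hm : gapMismatch α₀ A₀ a s n E ≠ 0) :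
    (∀ x : (magneticLaplacian α A).domain,
      magneticLaplacian α A x - (E : ℂ) • (x : L2Graph) = 0 → x = 0) ∧
    (∀ y : L2Graph, ∃ x : (magneticLaplacian α A).domain,
      magneticLaplacian α A x - (E : ℂ) • (x : L2Graph) = y) := by
  obtain ⟨hS, hE⟩ := notMem_bandSet.1 hE
  refine bijective_of_difference hS (h.injective_of_mismatch_ne hE hm)
    (c₀ := Real.cos (A₀ * π)) (ξ₀ := 2 * disc α₀ E) (Finset.Icc 1 (n + 1)) ?_ (fun j hj => ?_)
    fun j hj => ?_
  · rw [abs_mul, abs_two]; linarith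
  · rw [Finset.mem_Icc] at hj
    rw [h.potential_out j (by omega), h.potential_out (j - 1) (by omega)]
    exact ⟨rfl, rfl⟩
  · rw [Finset.mem_Icc] at hj
    rw [h.coupling_out j (by omega)]

lemma mem_resolventSet (h : WeakChain n α₀ A₀ α A a s) (hE : E ∉ bandSet α₀ A₀)
    (hm : gapMismatch α₀ A₀ a s n E ≠ 0) : (E : ℂ) ∈ resolventSet (magneticLaplacian α A) :=
  mem_resolventSet_of_bijective (magneticLaplacian_symmetric α A) (h.bijective hE hm).1
    (h.bijective hE hm).2

lemma mem_resolventSet_of_im (h : WeakChain n α₀ A₀ α A a s) (hE : E ∉ bandSet α₀ A₀)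
    (hm : gapMismatch α₀ A₀ a s n E ≠ 0) {z : ℂ} (hz : z.im ≠ 0) :
    z ∈ resolventSet (magneticLaplacian α A) :=
  mem_resolventSet_of_im_ne_zero (magneticLaplacian_symmetric α A) (h.bijective hE hm).1
    (h.bijective hE hm).2 hz

lemma mismatch_of_isEigenvalue (h : WeakChain n α₀ A₀ α A a s) (hE : E ∉ bandSet α₀ A₀)
    (he : IsEigenvalue (magneticLaplacian α A) E) : gapMismatch α₀ A₀ a s n E = 0 := by
  by_contra hm
  exact he ((Submodule.eq_bot_iff _).2 fun x hx => (h.bijective hE hm).1 x hx)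

/-- Nonreal energies and gap energies without bound state are not in the spectrum. -/
lemma exists_real_of_mem_spec (h : WeakChain n α₀ A₀ α A a s) {E₀ : ℝ} (hE₀ : E₀ ∉ bandSet α₀ A₀)
    (hm : gapMismatch α₀ A₀ a s n E₀ ≠ 0) {z : ℂ} (hz : z ∈ spec (magneticLaplacian α A)) :
    ∃ E : ℝ, z = E ∧ (E ∈ bandSet α₀ A₀ ∨ E ∉ bandSet α₀ A₀ ∧ gapMismatch α₀ A₀ a s n E = 0) := by
  have him : z.im = 0 := by
    by_contra him
    exact hz (h.mem_resolventSet_of_im hE₀ hm him)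
  refine ⟨z.re, by apply Complex.ext <;> simp [him], ?_⟩
  by_cases hE : z.re ∈ bandSet α₀ A₀
  · exact Or.inl hE
  · refine Or.inr ⟨hE, ?_⟩
    by_contra hm'
    have := h.mem_resolventSet hE hm'
    rw [show ((z.re : ℝ) : ℂ) = z from by apply Complex.ext <;> simp [him]] at this
    exact hz this

lemma mem_spec_of_mem_bandSet (h : WeakChain n α₀ A₀ α A a s) (hE : E ∈ bandSet α₀ A₀) :
    (E : ℂ) ∈ spec (magneticLaplacian α A) := by
  by_cases hS : sinPi E = 0
  · exact mem_spec_of_isEigenvalue (h.dirichlet hS).1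
  · exact h.mem_spec_of_band hS (hE.resolve_left hS)

/-- A Dirichlet point has infinite multiplicity, and any other band energy is no eigenvalue at all,
so isolation never has to be examined. -/
lemma not_mem_discreteSpec (h : WeakChain n α₀ A₀ α A a s) (hE : E ∈ bandSet α₀ A₀) :
    (E : ℂ) ∉ discreteSpec (magneticLaplacian α A) := by
  rintro ⟨-, -, h1, h2⟩
  by_cases hS : sinPi E = 0
  · exact (h.dirichlet hS).2 h2
  · exact h.not_isEigenvalue_of_band hS (hE.resolve_left hS) h1

end WeakChain

/-- This provides the real resolvent point needed to exclude nonreal spectrum; `|disc| ≥ 1` places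
it where the mismatch is positive in the attractive case. -/
lemma exists_gap_below (α : ℝ) {A : ℝ} (hA : |Real.cos (A * π)| < 1) :
    ∃ E, E ∉ bandSet α A ∧ 1 ≤ |disc α E| := by
  obtain ⟨l, hl, h⟩ := exists_disc_large α 1
  have := h.trans (le_abs_self _)
  exact ⟨l, notMem_bandSet.2 ⟨(sinPi_pos_of_lt_one hl).ne', hA.trans_le this⟩, this⟩

/-- Absence of bound states. -/
lemma WeakChain.spec_eq {n : ℕ} {α₀ A₀ : ℝ} {α A : ℤ → ℝ} {a s : ℕ → ℝ}
    (h : WeakChain n α₀ A₀ α A a s) (hA : |Real.cos (A₀ * π)| < 1)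
    (hm : ∀ E ∉ bandSet α₀ A₀, gapMismatch α₀ A₀ a s n E ≠ 0) :
    spec (magneticLaplacian α A) = (fun E : ℝ => (E : ℂ)) '' bandSet α₀ A₀ := by
  obtain ⟨E₀, hE₀, -⟩ := exists_gap_below α₀ hA
  ext z
  constructor
  · intro hz
    obtain ⟨E, rfl, hE | ⟨hE, hE'⟩⟩ := h.exists_real_of_mem_spec hE₀ (hm E₀ hE₀) hz
    · exact ⟨E, hE, rfl⟩
    · exact absurd hE' (hm E hE)
  · rintro ⟨E, hE, rfl⟩
    exact h.mem_spec_of_mem_bandSet hE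

/-- The spectrum of the periodic chain. -/
lemma spec_periodicHamiltonian {α A : ℝ} (hc : Real.cos (A * π) ≠ 0)
    (hA : |Real.cos (A * π)| < 1) :
    spec (periodicHamiltonian α A) = (fun E : ℝ => (E : ℂ)) '' bandSet α A := by
  -- The periodic chain is a perturbation on zero sites, with mismatch `1 - x⁻² > 0`.
  have h : WeakChain 0 α A (fun _ => α) (fun _ => A) 0 0 :=
    { coupling_out := fun _ _ => rfl
      potential_out := fun _ _ => rfl
      cos_ne := fun _ => hc
      ratio_pos := fun _ => by rw [div_self hc]; exact one_pos
      a_eq := fun k hk => absurd hk (Nat.not_lt_zero k)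
      s_eq := fun k _ => by simp [div_self hc]
      riccati_le := fun E _ k hk => by
        obtain rfl : k = 0 := by omega
        norm_num [riccati] }
  refine h.spec_eq hA fun E hE => ?_
  have hE' := (notMem_bandSet.1 hE).2
  have hx := (h.chainData hE').hx
  have h1 : 1 < gapRoot α A E ^ 2 := by rwa [one_lt_sq_iff_one_lt_abs]
  have := inv_lt_one_of_one_lt₀ h1
  simp only [gapMismatch, mismatch, riccati, Pi.zero_apply]
  linarith

/-! ### Bound states in the gaps -/

lemma mul_pos_of_ne_zero {f : ℝ → ℝ} {K : Set ℝ} (hK : IsPreconnected K) (hf : ContinuousOn f K)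
    (h0 : ∀ E ∈ K, f E ≠ 0) {x y : ℝ} (hx : x ∈ K) (hy : y ∈ K) : 0 < f x * f y := by
  by_contra hn
  have hlt : f x * f y < 0 :=
    lt_of_le_of_ne (not_lt.1 hn) (mul_ne_zero (h0 x hx) (h0 y hy))
  rcases mul_neg_iff.1 hlt with ⟨h1, h2⟩ | ⟨h1, h2⟩
  · obtain ⟨z, hz, hz'⟩ := hK.intermediate_value hy hx hf ⟨h2.le, h1.le⟩
    exact h0 z hz hz'
  · obtain ⟨z, hz, hz'⟩ := hK.intermediate_value hx hy hf ⟨h1.le, h2.le⟩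
    exact h0 z hz hz'

/-- An attractive weak perturbation: bound states exist close to the bands only. The energies at
distance from the bands are those with `u ≤ |disc α₀ E|`. -/
structure AttractiveChain (n : ℕ) (α₀ A₀ : ℝ) (α A : ℤ → ℝ) (a s : ℕ → ℝ) (u r : ℝ) : Prop
    extends WeakChain n α₀ A₀ α A a s where
  cos_lt : |Real.cos (A₀ * π)| < u
  lt_one : u < 1
  r_pos : 0 < r
  mismatch_neg : ∀ E, |Real.cos (A₀ * π)| < |disc α₀ E| → 1 - (gapRoot α₀ A₀ E ^ 2)⁻¹ < r →
    gapMismatch α₀ A₀ a s n E < 0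
  mismatch_pos : ∀ E, u ≤ |disc α₀ E| → 0 < gapMismatch α₀ A₀ a s n E
  disc_lt_one : ∀ E, |Real.cos (A₀ * π)| < |disc α₀ E| → |disc α₀ E| < u → ∀ j, |disc (α j) E| < 1

namespace AttractiveChain

variable {n : ℕ} {α₀ A₀ : ℝ} {α A : ℤ → ℝ} {a s : ℕ → ℝ} {u r : ℝ}

lemma gapRoot_ne_zero (h : AttractiveChain n α₀ A₀ α A a s u r) {E : ℝ} (hE : E ∉ bandSet α₀ A₀) :
    gapRoot α₀ A₀ E ≠ 0 :=
  (h.chainData (notMem_bandSet.1 hE).2).x_ne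

lemma disc_ne_zero {E : ℝ} (hE : E ∉ bandSet α₀ A₀) : disc α₀ E ≠ 0 :=
  abs_pos.1 ((abs_nonneg _).trans_lt (notMem_bandSet.1 hE).2)

lemma continuousOn_gapRoot (h : AttractiveChain n α₀ A₀ α A a s u r) :
    ContinuousOn (gapRoot α₀ A₀) (bandSet α₀ A₀)ᶜ := fun _ hE =>
  (ContinuousAt.comp (f := fun E => disc α₀ E / Real.cos (A₀ * π)) (g := charRoot)
    (continuousAt_charRoot (div_ne_zero (disc_ne_zero hE) h.cos_ne_zero))
    ((continuous_disc α₀).div_const _).continuousAt).continuousWithinAt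

lemma continuousOn_gapMismatch (h : AttractiveChain n α₀ A₀ α A a s u r) :
    ContinuousOn (gapMismatch α₀ A₀ a s n) (bandSet α₀ A₀)ᶜ := by
  have hy : ContinuousOn (fun E => (gapRoot α₀ A₀ E ^ 2)⁻¹) (bandSet α₀ A₀)ᶜ :=
    (h.continuousOn_gapRoot.pow 2).inv₀ fun E hE => pow_ne_zero 2 (h.gapRoot_ne_zero hE)
  have hβ : ContinuousOn (gapCoupling α₀ A₀) (bandSet α₀ A₀)ᶜ :=
    continuous_sinPi.continuousOn.div (continuousOn_const.mul h.continuousOn_gapRoot) fun _ hE =>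
      mul_ne_zero (mul_ne_zero two_ne_zero h.cos_ne_zero) (h.gapRoot_ne_zero hE)
  exact (continuousOn_const.add (continuousOn_riccati hy hβ n fun E hE i hi =>
    (h.riccati_pos (notMem_bandSet.1 hE).2 i hi.le).ne')).sub (hy.mul continuousOn_const)

/-- A gap contains at most one bound state energy. -/
lemma gapMismatch_unique (h : AttractiveChain n α₀ A₀ α A a s u r) {x y : ℝ} (hxy : x < y)
    (hgap : ∀ E ∈ Icc x y, E ∉ bandSet α₀ A₀) (hx : gapMismatch α₀ A₀ a s n x = 0)
    (hy : gapMismatch α₀ A₀ a s n y = 0) : False := by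
  have hxm : x ∈ Icc x y := left_mem_Icc.2 hxy.le
  have hym : y ∈ Icc x y := right_mem_Icc.2 hxy.le
  have hx' := (notMem_bandSet.1 (hgap x hxm)).2
  have hy' := (notMem_bandSet.1 (hgap y hym)).2
  obtain ⟨φ, hφ, hφs, hφe⟩ := h.exists_boundState hx' hx
  obtain ⟨χ, hχ, hχs, hχe⟩ := h.exists_boundState hy' hy
  have hS : ∀ E ∈ Icc x y, sinPi E ≠ 0 := fun E hE => (notMem_bandSet.1 (hgap E hE)).1
  have hSS := mul_pos_of_ne_zero isPreconnected_Icc continuous_sinPi.continuousOn hS hxm hym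
  -- `gapRoot` is continuous without zeros on the gap, hence of one sign, so the two bound states
  -- have the same sign pattern.
  have hXX : 0 < gapRoot α₀ A₀ x * gapRoot α₀ A₀ y :=
    mul_pos_of_ne_zero isPreconnected_Icc (h.continuousOn_gapRoot.mono hgap)
      (fun E hE => h.gapRoot_ne_zero (hgap E hE)) hxm hym
  have hprod : ∀ j, 0 < φ j * χ j := fun j => by
    have h1 := mul_pos (hφ j) (hχ j)
    rw [show φ j * gapRoot α₀ A₀ x ^ j * (χ j * gapRoot α₀ A₀ y ^ j)
      = φ j * χ j * (gapRoot α₀ A₀ x * gapRoot α₀ A₀ y) ^ j by rw [mul_zpow]; ring] at h1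
    exact pos_of_mul_pos_left h1 (zpow_nonneg hXX.le j)
  -- A bound state lies near the band, where `|disc (α j)| < 1` for every site; this is the range in
  -- which monotonicity of the discriminant is available.
  have hlt : |disc α₀ x| < u := not_le.1 fun hle => (h.mismatch_pos x hle).ne' hx
  have hsign : ∀ j, 0 < (disc (α j) x - disc (α j) y) * sinPi y := fun j => by
    have h1 := disc_sub_div_lt (α j) (h.disc_lt_one x hx' hlt j) hxy hS
    rw [sub_self, zero_div, div_neg_iff] at h1
    rcases h1 with ⟨h1, h2⟩ | ⟨h1, h2⟩ <;> nlinarith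
  have hcos : ∀ j, |Real.cos (A j * π)| ≤ 1 := fun j => Real.abs_cos_le_one _
  have tend : ∀ f : ℤ → ℝ, (Summable fun j => f j ^ 2) → Tendsto f cofinite (𝓝 0) := fun f hf => by
    have h1 := hf.tendsto_cofinite_zero.sqrt
    simp only [Real.sqrt_sq_eq_abs, Real.sqrt_zero] at h1
    exact (tendsto_zero_iff_abs_tendsto_zero f).2 h1
  -- The sign of `sinPi` decides whether `disc` decreases or increases with the energy, and thus the
  -- order of the two solutions in the Wronskian argument.
  rcases lt_or_gt_of_ne (hS y hym) with hneg | hpos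
  · refine wronskian_false hcos (tend χ hχs) (tend φ hφs) hχe hφe fun j => ?_
    have := hsign j
    refine mul_pos ?_ (by rw [mul_comm]; exact hprod j)
    nlinarith
  · refine wronskian_false hcos (tend φ hφs) (tend χ hχs) hφe hχe fun j => ?_
    have := hsign j
    refine mul_pos ?_ (hprod j)
    nlinarith

/-- Every gap contains a bound state energy. -/
lemma exists_gapMismatch_eq_zero (h : AttractiveChain n α₀ A₀ α A a s u r) {x : ℝ}
    (hx : x ∉ bandSet α₀ A₀) :
    ∃ E ∈ connectedComponentIn (bandSet α₀ A₀)ᶜ x, gapMismatch α₀ A₀ a s n E = 0 := by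
  obtain ⟨hSx, hdx⟩ := notMem_bandSet.1 hx
  set c := |Real.cos (A₀ * π)| with hc
  have hc0 : 0 < c := abs_pos.2 h.cos_ne_zero
  obtain ⟨p, hp, l, m, hlx, hxm, hspan, hl, hm⟩ := exists_span α₀ hSx h.lt_one
  have hp2 : p * p = 1 := by rcases hp with rfl | rfl <;> norm_num
  have hpabs : ∀ v, |p * v| = |v| := fun v => by rcases hp with rfl | rfl <;> simp
  -- The level `v c` lies in `(c, u)` and is so close to the band edge `c` that the mismatch is
  -- negative wherever `|disc| = v c`.
  obtain ⟨v, hv1, hvu, hvr⟩ := exists_charRoot_near h.r_pos ((one_lt_div hc0).2 h.cos_lt)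
  rw [lt_div_iff₀ hc0] at hvu
  have hcv : c < v * c := by nlinarith
  -- Between Dirichlet points `p * disc` crosses each level in `(-1, 1)` only downwards. Hence `[l,
  -- m]` consists of a gap part above `c`, one band, and a gap part below `-c`.
  have hmono : ∀ w, |w| < 1 → ∀ y z, l ≤ y → y < z → z ≤ m → p * disc α₀ y ≤ w →
      p * disc α₀ z < w := by
    intro w hw y z hly hyz hzm hle
    have hsp : ∀ E ∈ Icc y z, 0 < p * sinPi E := fun E hE =>
      hspan E ⟨hly.trans hE.1, hE.2.trans hzm⟩
    have h1 := disc_sub_div_lt α₀ (v := p * w) (by rwa [hpabs]) hyz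
      fun E hE h0 => by have := hsp E hE; rw [h0, mul_zero] at this; exact lt_irrefl _ this
    have key : ∀ E, (disc α₀ E - p * w) / sinPi E = (p * disc α₀ E - w) / (p * sinPi E) := fun E => by
      have hp0 : p ≠ 0 := by rintro rfl; norm_num at hp2
      rw [← mul_div_mul_left _ _ hp0]
      congr 1
      linear_combination (-w) * hp2
    rw [key, key] at h1
    have h2 : (p * disc α₀ y - w) / (p * sinPi y) ≤ 0 :=
      div_nonpos_of_nonpos_of_nonneg (by linarith) (hsp y (left_mem_Icc.2 hyz.le)).le
    have h3 := (div_lt_iff₀ (hsp z (right_mem_Icc.2 hyz.le))).1 (h1.trans_le h2)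
    linarith
  have hgap : ∀ E ∈ Icc l m, c < |p * disc α₀ E| → E ∉ bandSet α₀ A₀ := fun E hE hE' => by
    refine notMem_bandSet.2 ⟨fun h0 => ?_, by rwa [hpabs] at hE'⟩
    have := hspan E hE
    rw [h0, mul_zero] at this
    exact lt_irrefl _ this
  have hnear : ∀ E, |p * disc α₀ E| = v * c → gapMismatch α₀ A₀ a s n E < 0 := fun E hE => by
    rw [hpabs] at hE
    refine h.mismatch_neg E (by rw [hE]; exact hcv) ?_
    rw [gapRoot, charRoot_sq_abs, abs_div, hE, ← hc, mul_div_cancel_right₀ _ hc0.ne']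
    exact hvr
  have hcont : ContinuousOn (fun E => p * disc α₀ E) (Icc l m) :=
    (continuous_const.mul (continuous_disc α₀)).continuousOn
  have hlm : l ≤ m := (hlx.trans hxm).le
  have finish : ∀ K : Set ℝ, IsPreconnected K → (∀ E ∈ K, E ∉ bandSet α₀ A₀) → x ∈ K →
      ∀ y ∈ K, ∀ z ∈ K, gapMismatch α₀ A₀ a s n y < 0 → 0 < gapMismatch α₀ A₀ a s n z →
      ∃ E ∈ connectedComponentIn (bandSet α₀ A₀)ᶜ x, gapMismatch α₀ A₀ a s n E = 0 := by
    intro K hK hKg hxK y hy z hz h1 h2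
    obtain ⟨E, hE, hE'⟩ := hK.intermediate_value hy hz (h.continuousOn_gapMismatch.mono hKg)
      ⟨h1.le, h2.le⟩
    exact ⟨E, hK.subset_connectedComponentIn hxK hKg hE, hE'⟩
  have hu1 := h.lt_one
  have hc1 : |c| < 1 := by rw [abs_of_pos hc0]; exact h.cos_lt.trans h.lt_one
  have hvc : |v * c| < 1 := by rw [abs_of_pos (hc0.trans hcv)]; linarith
  obtain ⟨y, hy, hyv⟩ : ∃ y ∈ Icc l m, p * disc α₀ y = v * c :=
    intermediate_value_Icc' hlm hcont ⟨by linarith, by linarith⟩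
  obtain ⟨z, hz, hzv⟩ : ∃ z ∈ Icc l m, p * disc α₀ z = -(v * c) :=
    intermediate_value_Icc' hlm hcont ⟨by linarith, by linarith⟩
  rw [← hpabs, lt_abs] at hdx
  -- In the upper part the interval runs from `l`, where `|disc| ≥ u` and the mismatch is positive,
  -- past both `x` and `y`; in the lower part it ends at `m`. By `hmono` it stays inside the gap.
  rcases hdx with hdx | hdx
  · refine finish (Icc l (max x y)) isPreconnected_Icc (fun E hE => ?_) ⟨hlx.le, le_max_left _ _⟩ y
      ⟨hy.1, le_max_right _ _⟩ l ⟨le_rfl, hlx.le.trans (le_max_left _ _)⟩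
      (hnear y (by rw [hyv, abs_of_pos (hc0.trans hcv)]))
      (h.mismatch_pos l (hl.trans ((le_abs_self _).trans_eq (hpabs _))))
    have hmax : c < p * disc α₀ (max x y) := by
      rcases max_choice x y with h1 | h1 <;> rw [h1]
      · exact hdx
      · rwa [hyv]
    have hEm : E ∈ Icc l m := ⟨hE.1, hE.2.trans (max_le hxm.le hy.2)⟩
    refine hgap E hEm (lt_abs.2 (Or.inl ?_))
    rcases hE.2.eq_or_lt with h1 | h1
    · rwa [h1]
    · by_contra hn
      exact lt_asymm hmax (hmono c hc1 E _ hE.1 h1 (max_le hxm.le hy.2) (not_lt.1 hn))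
  · refine finish (Icc (min x z) m) isPreconnected_Icc (fun E hE => ?_) ⟨min_le_left _ _, hxm.le⟩ z
      ⟨min_le_right _ _, hz.2⟩ m ⟨(min_le_left _ _).trans hxm.le, le_rfl⟩
      (hnear z (by rw [hzv, abs_neg, abs_of_pos (hc0.trans hcv)]))
      (h.mismatch_pos m (by rw [← hpabs]; linarith [neg_le_abs (p * disc α₀ m)]))
    have hmin : p * disc α₀ (min x z) < -c := by
      rcases min_choice x z with h1 | h1 <;> rw [h1]
      · linarith
      · rw [hzv]; linarith
    have hlmin : l ≤ min x z := le_min hlx.le hz.1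
    have hEm : E ∈ Icc l m := ⟨hlmin.trans hE.1, hE.2⟩
    refine hgap E hEm (lt_abs.2 (Or.inr ?_))
    rcases hE.1.eq_or_lt with h1 | h1
    · rw [← h1]; linarith
    · have := hmono (-c) (by rwa [abs_neg]) _ E hlmin h1 hE.2 hmin.le
      linarith

/-- Spectrum inside a gap consists of zeros of the mismatch, which are simple eigenvalues. They are
isolated because an interval free of `bandSet` contains at most one of them. -/
lemma essSpec_eq (h : AttractiveChain n α₀ A₀ α A a s u r) :
    essSpec (magneticLaplacian α A) = (fun E : ℝ => (E : ℂ)) '' bandSet α₀ A₀ := by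
  obtain ⟨E₀, hE₀, hE₀'⟩ := exists_gap_below α₀ (h.cos_lt.trans h.lt_one)
  have hreal := fun z => h.exists_real_of_mem_spec hE₀
    (h.mismatch_pos E₀ (h.lt_one.le.trans hE₀')).ne' (z := z)
  ext z
  constructor
  · rintro ⟨hz, hzd⟩
    obtain ⟨E, rfl, hE | ⟨hE, hm⟩⟩ := hreal z hz
    · exact ⟨E, hE, rfl⟩
    · exfalso
      refine hzd ⟨hz, ?_, ?_, ?_⟩
      · obtain ⟨ρ, hρ, hball⟩ := Metric.isOpen_iff.1 (isClosed_bandSet α₀ A₀).isOpen_compl E hE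
        refine ⟨ρ, hρ, fun w hw hd => ?_⟩
        obtain ⟨E', rfl, hE'⟩ := hreal w hw
        have hd' : E' ∈ Metric.ball E ρ := by
          rw [Metric.mem_ball]
          rwa [Complex.dist_eq, ← Complex.ofReal_sub, Complex.norm_real] at hd
        have hE'm := (hE'.resolve_left (hball hd')).2
        have hconv : ∀ y ∈ Metric.ball E ρ, ∀ z ∈ Metric.ball E ρ, ∀ x ∈ Icc y z,
            x ∉ bandSet α₀ A₀ := fun y hy z hz x hx => hball
          ((convex_ball E ρ).ordConnected.out hy hz hx)
        rcases lt_trichotomy E E' with hlt | heq | hlt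
        · exact (h.gapMismatch_unique hlt
            (hconv _ (Metric.mem_ball_self hρ) _ hd') hm hE'm).elim
        · rw [heq]
        · exact (h.gapMismatch_unique hlt
            (hconv _ hd' _ (Metric.mem_ball_self hρ)) hE'm hm).elim
      · intro hbot
        have := h.isSimpleEigenvalue hE hm
        rw [IsSimpleEigenvalue, hbot, finrank_bot] at this
        exact zero_ne_one this
      · exact Module.finite_of_finrank_pos (by
          rw [show Module.finrank ℂ _ = 1 from h.isSimpleEigenvalue hE hm]; exact one_pos)
  · rintro ⟨E, hE, rfl⟩
    exact ⟨h.mem_spec_of_mem_bandSet hE, h.not_mem_discreteSpec hE⟩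

/-- Every gap of the essential spectrum contains precisely one eigenvalue, which is simple. -/
lemma exists_unique_eigenvalue (h : AttractiveChain n α₀ A₀ α A a s u r) {I : Set ℝ}
    (hI : IsGap (essSpec (magneticLaplacian α A)) I) :
    ∃ E ∈ I, IsSimpleEigenvalue (magneticLaplacian α A) E ∧
      ∀ E' ∈ I, IsEigenvalue (magneticLaplacian α A) E' → E' = E := by
  obtain ⟨x, hx, rfl⟩ := hI
  have hset : {E : ℝ | (E : ℂ) ∉ essSpec (magneticLaplacian α A)} = (bandSet α₀ A₀)ᶜ := by
    ext E
    rw [mem_ofPred_eq, h.essSpec_eq, mem_compl_iff, mem_image]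
    simp
  have hx' : x ∈ (bandSet α₀ A₀)ᶜ := by rw [← hset]; exact hx
  rw [hset]
  have hsub := connectedComponentIn_subset (bandSet α₀ A₀)ᶜ x
  have hord : (connectedComponentIn (bandSet α₀ A₀)ᶜ x).OrdConnected :=
    isPreconnected_connectedComponentIn.ordConnected
  obtain ⟨E, hE, hm⟩ := h.exists_gapMismatch_eq_zero hx'
  refine ⟨E, hE, h.isSimpleEigenvalue (hsub hE) hm, fun E' hE' he => ?_⟩
  have hm' := h.mismatch_of_isEigenvalue (hsub hE') he
  rcases lt_trichotomy E E' with hlt | heq | hlt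
  · exact (h.gapMismatch_unique hlt (fun y hy => hsub (hord.out hE hE' hy)) hm hm').elim
  · exact heq.symm
  · exact (h.gapMismatch_unique hlt (fun y hy => hsub (hord.out hE' hE hy)) hm' hm).elim

end AttractiveChain

/-! ### The weakly perturbed Hamiltonian -/

/-- Restriction of a sequence to `1, …, n`. -/
noncomputable def localize (n : ℕ) (b : ℤ → ℝ) (j : ℤ) : ℝ :=
  if j ∈ Finset.Icc 1 (n : ℤ) then b j else 0

lemma localize_of_out {n : ℕ} (b : ℤ → ℝ) {j : ℤ} (hj : j ≤ 0 ∨ (n : ℤ) < j) :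
    localize n b j = 0 := by
  rw [localize, if_neg]
  rw [Finset.mem_Icc]; omega

lemma sum_localize (n : ℕ) (b : ℤ → ℝ) :
    ∑ i ∈ Finset.range n, localize n b ((i + 1 : ℕ) : ℤ) = ∑ j ∈ Finset.Icc 1 (n : ℤ), b j := by
  refine Finset.sum_nbij' (fun i => ((i + 1 : ℕ) : ℤ)) (fun j => (j - 1).toNat) ?_ ?_ ?_ ?_ ?_
  · intro i hi
    rw [Finset.mem_range] at hi
    rw [Finset.mem_Icc]; omega
  · intro j hj
    rw [Finset.mem_Icc] at hj
    rw [Finset.mem_range]; omega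
  · intro i _; simp
  · intro j hj
    rw [Finset.mem_Icc] at hj
    omega
  · intro i hi
    rw [Finset.mem_range] at hi
    rw [localize, if_pos]
    rw [Finset.mem_Icc]; omega

lemma perturbedHamiltonian_eq (α A : ℝ) (n : ℕ) (a b : ℤ → ℝ) (ε : ℝ) :
    perturbedHamiltonian α A n a b ε = magneticLaplacian (fun j => α + ε * localize n a j)
      (fun j => A + ε * localize n b j) := by
  rw [perturbedHamiltonian]
  congr 1 <;> funext j <;> rw [localize] <;> split_ifs <;> simp

/-! ### First-order expansion of the hopping strengths and smallness in `ε`. -/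

lemma abs_sin_sub_self_le (h : ℝ) : |Real.sin h - h| ≤ 2 * h ^ 2 := by
  wlog hh : 0 ≤ h generalizing h
  · have := this (-h) (by linarith)
    rw [Real.sin_neg, neg_sq, ← abs_neg] at this
    convert this using 2; ring
  have h1 := Real.sin_le hh
  rw [abs_sub_comm, abs_of_nonneg (by linarith)]
  rcases le_or_gt h 1 with h2 | h2
  · rcases hh.eq_or_lt with rfl | hh
    · simp
    · have := Real.sin_gt_sub_cube hh
      nlinarith [sq_nonneg h]
  · nlinarith [Real.neg_one_le_sin h]

lemma abs_cos_add_sub_le (θ h : ℝ) :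
    |Real.cos (θ + h) - Real.cos θ + h * Real.sin θ| ≤ 3 * h ^ 2 := by
  have h1 := Real.one_sub_sq_div_two_le_cos (x := h)
  have h2 := Real.cos_le_one h
  have e1 : |Real.cos θ * (Real.cos h - 1)| ≤ 1 * (h ^ 2 / 2) := by
    rw [abs_mul]
    refine mul_le_mul (Real.abs_cos_le_one _) ?_ (abs_nonneg _) zero_le_one
    rw [abs_le]; constructor <;> nlinarith [sq_nonneg h]
  have e2 : |Real.sin θ * (Real.sin h - h)| ≤ 1 * (2 * h ^ 2) := by
    rw [abs_mul]
    exact mul_le_mul (Real.abs_sin_le_one _) (abs_sin_sub_self_le h) (abs_nonneg _) zero_le_one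
  rw [Real.cos_add, show Real.cos θ * Real.cos h - Real.sin θ * Real.sin h - Real.cos θ
    + h * Real.sin θ = Real.cos θ * (Real.cos h - 1) - Real.sin θ * (Real.sin h - h) by ring]
  refine (abs_sub _ _).trans ?_
  nlinarith [sq_nonneg h]

/-- The relative hopping strength to first order. -/
lemma exists_ratio_expansion {A : ℝ} (hc : Real.cos (A * π) ≠ 0) (b : ℝ) :
    ∃ C > 0, ∀ ε ∈ Ioo (0 : ℝ) 1,
      |((Real.cos ((A + ε * b) * π) / Real.cos (A * π)) ^ 2 - 1)
        - ε * (-2 * π * Real.tan (A * π) * b)| ≤ C * ε ^ 2 := by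
  -- The added 1 only keeps the constant positive when `b = 0`. Doubling the angle makes the squared
  -- ratio linear in a cosine, whose expansion at `2Aπ` produces `tan(Aπ)` and the remainder
  -- constant.
  refine ⟨3 * (2 * π * b) ^ 2 / (2 * Real.cos (A * π) ^ 2) + 1, by positivity, fun ε _ => ?_⟩
  have h1 := abs_cos_add_sub_le (2 * (A * π)) (2 * π * b * ε)
  have h2 : (Real.cos ((A + ε * b) * π) / Real.cos (A * π)) ^ 2 - 1
        - ε * (-2 * π * Real.tan (A * π) * b)
      = (Real.cos (2 * (A * π) + 2 * π * b * ε) - Real.cos (2 * (A * π))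
        + 2 * π * b * ε * Real.sin (2 * (A * π))) / (2 * Real.cos (A * π) ^ 2) := by
    rw [show 2 * (A * π) + 2 * π * b * ε = 2 * ((A + ε * b) * π) by ring, Real.cos_two_mul,
      Real.cos_two_mul, Real.sin_two_mul, Real.tan_eq_sin_div_cos]
    generalize Real.cos ((A + ε * b) * π) = u
    generalize Real.cos (A * π) = c at *
    field_simp
    ring
  have hpos : 0 < 2 * Real.cos (A * π) ^ 2 := by positivity
  rw [h2, abs_div, abs_of_pos hpos, div_le_iff₀ hpos]
  refine h1.trans ?_
  rw [add_mul, add_mul, div_mul_eq_mul_div, div_mul_cancel₀ _ hpos.ne']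
  nlinarith [mul_nonneg (sq_nonneg ε) hpos.le]

/-- A localized sequence takes only finitely many values, so pointwise smallness conditions hold
simultaneously for all sites. -/
lemma eventually_localize {P : ℝ → ℝ → Prop} (n : ℕ) (b : ℤ → ℝ)
    (h : ∀ x, ∀ᶠ ε in 𝓝[>] (0 : ℝ), P ε x) : ∀ᶠ ε in 𝓝[>] (0 : ℝ), ∀ j, P ε (localize n b j) := by
  have h1 : ∀ᶠ ε in 𝓝[>] (0 : ℝ), ∀ j ∈ Finset.Icc 1 (n : ℤ), P ε (localize n b j) :=
    (Filter.eventually_all_finset _).2 fun j _ => h _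
  filter_upwards [h1, h 0] with ε h2 h3 j
  by_cases hj : j ∈ Finset.Icc 1 (n : ℤ)
  · exact h2 j hj
  · rwa [localize, if_neg hj]

lemma eventually_ratio_pos {A : ℝ} (hc : Real.cos (A * π) ≠ 0) (n : ℕ) (b : ℤ → ℝ) :
    ∀ᶠ ε in 𝓝[>] (0 : ℝ), ∀ j,
      0 < Real.cos ((A + ε * localize n b j) * π) / Real.cos (A * π) := by
  refine eventually_localize (P := fun ε x => 0 < Real.cos ((A + ε * x) * π) / Real.cos (A * π)) n b
    fun x => ?_
  have hcont : ContinuousAt (fun ε : ℝ => Real.cos ((A + ε * x) * π) / Real.cos (A * π)) 0 := by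
    fun_prop
  refine (hcont.eventually_const_lt ?_).filter_mono nhdsWithin_le_nhds
  simp [div_self hc]

lemma eventually_mul_lt (n : ℕ) (a : ℤ → ℝ) (B : ℝ) {η : ℝ} (hη : 0 < η) :
    ∀ᶠ ε in 𝓝[>] (0 : ℝ), ∀ j, ε * |localize n a j| * B < η := by
  refine eventually_localize (P := fun ε x => ε * |x| * B < η) n a fun x => ?_
  have hcont : ContinuousAt (fun ε : ℝ => ε * |x| * B) 0 := by fun_prop
  refine (hcont.eventually_lt_const ?_).filter_mono nhdsWithin_le_nhds
  simpa using hη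

section

variable {α A : ℝ} (n : ℕ) (a b : ℤ → ℝ)

/-- The squared relative hopping strengths, minus one. -/
noncomputable def hoppingDefect (A : ℝ) (n : ℕ) (b : ℤ → ℝ) (ε : ℝ) (k : ℕ) : ℝ :=
  (Real.cos ((A + ε * localize n b k) * π) / Real.cos (A * π)) ^ 2 - 1

lemma weakChain_of_riccati_le {ε : ℝ}
    (hpos : ∀ j, 0 < Real.cos ((A + ε * localize n b j) * π) / Real.cos (A * π))
    (hr : ∀ E, |Real.cos (A * π)| < |disc α E| → ∀ k ≤ n,
      |riccati (gapRoot α A E ^ 2)⁻¹ (gapCoupling α A E) (fun k => ε * localize n a k)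
        (hoppingDefect A n b ε) k| ≤ 1 / 2) :
    WeakChain n α A (fun j => α + ε * localize n a j) (fun j => A + ε * localize n b j)
      (fun k => ε * localize n a k) (hoppingDefect A n b ε) where
  coupling_out j hj := by simp only [localize_of_out a hj, mul_zero, add_zero]
  potential_out j hj := by simp only [localize_of_out b hj, mul_zero, add_zero]
  cos_ne j h0 := by
    have := hpos j
    rw [h0, zero_div] at this
    exact lt_irrefl _ this
  ratio_pos := hpos
  a_eq k _ := by simp only [add_sub_cancel_left]
  s_eq _ _ := rfl
  riccati_le := hr

lemma eventually_of_exists_Ioo {P : ℝ → Prop} (h : ∃ ε₁ ∈ Ioo (0 : ℝ) 1, ∀ ε ∈ Ioo 0 ε₁, P ε) :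
    ∀ᶠ ε in 𝓝[>] (0 : ℝ), P ε := by
  obtain ⟨ε₁, h1, h2⟩ := h
  filter_upwards [Ioo_mem_nhdsGT h1.1] using h2

lemma exists_Ioo_of_eventually {P : ℝ → Prop} (h : ∀ᶠ ε in 𝓝[>] (0 : ℝ), P ε) :
    ∃ ε₁ ∈ Ioo (0 : ℝ) 1, ∀ ε ∈ Ioo 0 ε₁, P ε := by
  obtain ⟨u, hu, h⟩ := mem_nhdsGT_iff_exists_Ioo_subset.1 h
  have hu : 0 < u := hu
  refine ⟨min u (1 / 2), ⟨lt_min hu (by norm_num), (min_le_right _ _).trans_lt (by norm_num)⟩,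
    fun ε hε => h ⟨hε.1, hε.2.trans_le (min_le_left _ _)⟩⟩

lemma sum_firstOrder (κ : ℝ) : ∑ i ∈ Finset.range n, κ * localize n b ((i + 1 : ℕ) : ℤ)
    = κ * ∑ j ∈ Finset.Icc 1 (n : ℤ), b j := by
  rw [← Finset.mul_sum, sum_localize]

/-- In the repulsive case the spectrum is unchanged. -/
lemma eventually_spec_eq (ha : ∑ j ∈ Finset.Icc 1 (n : ℤ), a j = 0)
    (hc : Real.cos (A * π) ≠ 0) (hA : |Real.cos (A * π)| < 1)
    (hκ : 0 < Real.tan (A * π) * ∑ j ∈ Finset.Icc 1 (n : ℤ), b j) :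
    ∀ᶠ ε in 𝓝[>] (0 : ℝ),
      spec (perturbedHamiltonian α A n a b ε) = spec (periodicHamiltonian α A) := by
  obtain ⟨B, hB, hβ⟩ := exists_gapCoupling_bound α hc
  have h1 := eventually_of_exists_Ioo (mismatch_pos n (fun k => localize n a k)
    (fun k => -2 * π * Real.tan (A * π) * localize n b k) (hoppingDefect A n b) B hB
    (fun ε => by simp [hoppingDefect, localize, div_self hc])
    (fun k => exists_ratio_expansion hc _) ((sum_localize n a).trans ha) (by
      rw [sum_firstOrder]
      nlinarith [Real.pi_pos, mul_pos Real.pi_pos hκ]))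
  filter_upwards [h1, eventually_ratio_pos hc n b] with ε h2 h3
  rw [perturbedHamiltonian_eq, spec_periodicHamiltonian hc hA]
  refine (weakChain_of_riccati_le n a b h3 fun E hE =>
    (h2 _ (inv_gapRoot_sq_mem hc hE) _ (hβ E hE).1).1).spec_eq hA fun E hE => ?_
  have hE := (notMem_bandSet.1 hE).2
  exact (h2 _ (inv_gapRoot_sq_mem hc hE) _ (hβ E hE).1).2.ne'

/-- In the attractive case there is one bound state in every gap. -/
lemma eventually_attractive (ha : ∑ j ∈ Finset.Icc 1 (n : ℤ), a j = 0)
    (hc : Real.cos (A * π) ≠ 0) (hA : |Real.cos (A * π)| < 1)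
    (hκ : Real.tan (A * π) * ∑ j ∈ Finset.Icc 1 (n : ℤ), b j < 0) :
    ∀ᶠ ε in 𝓝[>] (0 : ℝ), ∃ u r, AttractiveChain n α A (fun j => α + ε * localize n a j)
      (fun j => A + ε * localize n b j) (fun k => ε * localize n a k) (hoppingDefect A n b ε)
      u r := by
  obtain ⟨B, hB, hβ⟩ := exists_gapCoupling_bound α hc
  -- Any `u` strictly between `|cos Aπ|` and 1 separates energies near a band from the rest,
  -- independently of `ε`. The `δ` below is chosen so that `1 - y < δ` forces `|disc| < u`.
  obtain ⟨u, hcu, hu⟩ := exists_between hA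
  have hc0 : 0 < |Real.cos (A * π)| := abs_pos.2 hc
  have huc : 1 < u / |Real.cos (A * π)| := (one_lt_div hc0).2 hcu
  have hδ : 0 < 1 - ((u / |Real.cos (A * π)|) ^ 2)⁻¹ :=
    sub_pos.2 (inv_lt_one_of_one_lt₀ (one_lt_pow₀ huc two_ne_zero))
  have h1 := eventually_of_exists_Ioo (mismatch_sign n (fun k => localize n a k)
    (fun k => -2 * π * Real.tan (A * π) * localize n b k) (hoppingDefect A n b) B hB
    (fun ε => by simp [hoppingDefect, localize, div_self hc])
    (fun k => exists_ratio_expansion hc _) ((sum_localize n a).trans ha) (by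
      rw [sum_firstOrder]
      nlinarith [Real.pi_pos, mul_pos Real.pi_pos (neg_pos.2 hκ)]) _ hδ)
  -- The threshold `4 (1 - u)` comes from `|disc(α + ε a_j) - disc α| ≤ ε |a_j| (2B) / 4`, valid
  -- where `|disc α| < u < 1`.
  filter_upwards [h1, eventually_ratio_pos hc n b,
    eventually_mul_lt n a (2 * B) (by linarith : 0 < 4 * (1 - u)), self_mem_nhdsWithin]
    with ε h2 h3 h4 h5
  obtain ⟨r, hr, h2⟩ := h2
  have h6 := fun E (hE : |Real.cos (A * π)| < |disc α E|) =>
    h2 _ (inv_gapRoot_sq_mem hc hE) _ (hβ E hE).1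
  refine ⟨u, r,
    { weakChain_of_riccati_le n a b h3 fun E hE => (h6 E hE).1 with
      cos_lt := hcu
      lt_one := hu
      r_pos := hr
      mismatch_neg := fun E hE => (h6 E hE).2.1
      mismatch_pos := fun E hE => ?_
      disc_lt_one := fun E hE hE' j => ?_ }⟩
  · by_contra hn
    have h7 := (h6 E (hcu.trans_le hE)).2.2 (not_lt.1 hn)
    refine absurd h7 (not_lt.2 (le_one_sub_inv_charRoot huc.le ?_))
    rw [abs_div]
    exact div_le_div_of_nonneg_right hE hc0.le
  · have h7 := (hβ E hE).2
    have h8 : disc (α + ε * localize n a j) E = disc α E + ε * localize n a j / 4 * sinPi E := by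
      rw [disc, disc]; ring
    have hε : 0 < ε := h5
    have h9 : |ε * localize n a j / 4 * sinPi E| ≤ ε * |localize n a j| / 4 * (2 * B * 1) := by
      rw [abs_mul, abs_div, abs_mul, abs_of_pos hε, abs_of_pos (by norm_num : (0 : ℝ) < 4)]
      refine mul_le_mul_of_nonneg_left (h7.trans ?_) (by positivity)
      exact mul_le_mul_of_nonneg_left (by linarith) (by positivity)
    rw [h8]
    refine (abs_add_le _ _).trans_lt ?_
    linarith [h4 j]

end

/-! ### The sign condition and the conclusion. -/

lemma cos_mul_pi_ne_zero {A : ℝ} (hA' : ∀ m : ℤ, A - 1 / 2 ≠ m) : Real.cos (A * π) ≠ 0 := by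
  intro h
  obtain ⟨k, hk⟩ := Real.cos_eq_zero_iff.1 h
  refine hA' k ?_
  have hp := Real.pi_pos.ne'
  have : A = (2 * k + 1) / 2 := mul_right_cancel₀ hp (by rw [hk]; ring)
  rw [this]; ring

lemma sin_mul_pi_ne_zero {A : ℝ} (hA : ∀ m : ℤ, A ≠ m) : Real.sin (A * π) ≠ 0 := by
  intro h
  obtain ⟨k, hk⟩ := Real.sin_eq_zero_iff.1 h
  exact hA k (mul_right_cancel₀ Real.pi_pos.ne' hk.symm)

/-- `tan` and `cot` are reciprocal and so have the same sign; the first-order coefficient is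
naturally expressed through `tan`. -/
lemma sign_eq_neg_sign_cot_iff {θ x : ℝ} (hs : Real.sin θ ≠ 0) (hc : Real.cos θ ≠ 0) :
    SignType.sign x = -SignType.sign (Real.cot θ) ↔ Real.tan θ * x < 0 := by
  have h0 : Real.cot θ ≠ 0 := by
    rw [Real.cot_eq_cos_div_sin]; exact div_ne_zero hc hs
  have ht : Real.tan θ = (Real.cot θ)⁻¹ := by
    rw [Real.cot_eq_cos_div_sin, Real.tan_eq_sin_div_cos, inv_div]
  rcases lt_or_gt_of_ne h0 with h1 | h1
  · have h3 : Real.tan θ < 0 := by rw [ht]; exact inv_lt_zero.2 h1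
    rw [sign_neg h1, neg_neg, sign_eq_one_iff, mul_neg_iff]
    exact ⟨fun h => Or.inr ⟨h3, h⟩, fun h => (h.resolve_left fun h => lt_asymm h.1 h3).2⟩
  · have h3 : 0 < Real.tan θ := by rw [ht]; exact inv_pos.2 h1
    rw [sign_pos h1, sign_eq_neg_one_iff, mul_neg_iff]
    exact ⟨fun h => Or.inl ⟨h3, h⟩, fun h => (h.resolve_right fun h => lt_asymm h.1 h3).2⟩

end RingChain

theorem mainTheorem8 (α A : ℝ) (hA : ∀ m : ℤ, A ≠ m) (hA' : ∀ m : ℤ, A - 1 / 2 ≠ m)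
    (n : ℕ) (a b : ℤ → ℝ)
    (ha : ∑ j ∈ Finset.Icc 1 (n : ℤ), a j = 0)
    (hb : ∑ j ∈ Finset.Icc 1 (n : ℤ), b j ≠ 0) :
    ∃ ε₀ ∈ Set.Ioo (0 : ℝ) 1, ∀ ε ∈ Set.Ioo 0 ε₀,
      (SignType.sign (∑ j ∈ Finset.Icc 1 (n : ℤ), b j) ≠ -SignType.sign (Real.cot (A * π)) →
        RingChain.spec (RingChain.perturbedHamiltonian α A n a b ε)
          = RingChain.spec (RingChain.periodicHamiltonian α A)) ∧
      (SignType.sign (∑ j ∈ Finset.Icc 1 (n : ℤ), b j) = -SignType.sign (Real.cot (A * π)) →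
        RingChain.essSpec (RingChain.perturbedHamiltonian α A n a b ε)
          = RingChain.spec (RingChain.periodicHamiltonian α A) ∧
        ∀ I : Set ℝ,
          RingChain.IsGap (RingChain.essSpec (RingChain.perturbedHamiltonian α A n a b ε)) I →
          ∃ E ∈ I,
            RingChain.IsSimpleEigenvalue (RingChain.perturbedHamiltonian α A n a b ε) (E : ℂ) ∧
            ∀ E' ∈ I,
              RingChain.IsEigenvalue (RingChain.perturbedHamiltonian α A n a b ε) (E' : ℂ) →
              E' = E) := by

  have hs := RingChain.sin_mul_pi_ne_zero hA
  have hc := RingChain.cos_mul_pi_ne_zero hA'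
  have hc1 : |Real.cos (A * π)| < 1 := by
    rw [← sq_lt_one_iff_abs_lt_one]
    have h1 := Real.sin_sq_add_cos_sq (A * π)
    have h2 : 0 < Real.sin (A * π) ^ 2 := by positivity
    linarith
  have ht : Real.tan (A * π) ≠ 0 := by
    rw [Real.tan_eq_sin_div_cos]; exact div_ne_zero hs hc
  rw [Ne, RingChain.sign_eq_neg_sign_cot_iff hs hc]
  -- The product is nonzero and independent of `ε`, so `ε₀` may be chosen separately for each sign,
  -- and the other bullet is then vacuous.
  rcases lt_or_gt_of_ne (mul_ne_zero ht hb) with hκ | hκ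
  · obtain ⟨ε₀, h0, h⟩ := RingChain.exists_Ioo_of_eventually
      (RingChain.eventually_attractive (α := α) n a b ha hc hc1 hκ)
    refine ⟨ε₀, h0, fun ε hε => ⟨fun hn => absurd hκ hn, fun _ => ?_⟩⟩
    obtain ⟨u, r, hchain⟩ := h ε hε
    rw [RingChain.perturbedHamiltonian_eq, RingChain.spec_periodicHamiltonian hc hc1]
    exact ⟨hchain.essSpec_eq, fun I hI => hchain.exists_unique_eigenvalue hI⟩
  · obtain ⟨ε₀, h0, h⟩ := RingChain.exists_Ioo_of_eventually
      (RingChain.eventually_spec_eq (α := α) n a b ha hc hc1 hκ)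
    exact ⟨ε₀, h0, fun ε hε => ⟨fun _ => h ε hε, fun hn => absurd hn hκ.not_gt⟩⟩
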